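/- **Theorem 4.2 (gradient descent for the stochastic LQ problem).** Let $W$ be a standard one-dimensional Brownian motion with respect to a filtration $(\mathcal F_t)_{t\ge 0}$ on a probability space, let $A,C\in\mathbb R^{n\times n}$, $B,D\in\mathbb R^{n\times m}$, let $Q\in\mathbb R^{n\times n}$, $R\in\mathbb R^{m\times m}$ be symmetric positive definite, and let $X(0)$ be a square-integrable $\mathcal F_0$-measurable initial state such that $\Sigma_0=\mathbb E[X(0)X(0)^\top]$ is positive definite. For $K\in\mathbb R^{m\times n}$ consider $$dX(t)=(A+BK)X(t)\,dt+(C+DK)X(t)\,dW(t),\qquad J(K)=\mathbb E\int_0^\infty X(t)^\top(Q+K^\top RK)X(t)\,dt\in[0,\infty].$$ Let $\mathcal K$ be the set of mean-square stabilizers, i.e. of those $K$ for which $\mathbb E[X(t)^\top X(t)]\to0$ as $t\to\infty$ for every (square-integrable, $\mathcal F_0$-measurable) initial state. Fix $K_0\in\mathcal K$ and put $\mathcal K_0=\{K: J(K)\le J(K_0)\}$. Then $\mathcal K$ is open, $J$ is finite and twice continuously differentiable on $\mathcal K$, and $J$ has a unique minimizer $K_*$ over $\mathcal K$. Call $L>0$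 a smoothness constant if $|\nabla^2J(K)[E,E]|\le L\|E\|_F^2$ for all $K\in\mathcal K_0$ and $E\in\mathbb R^{m\times n}$. If $B\ne0$, then $$L=\frac{2J(K_0)}{\lambda_1(Q)}\left[\lambda_{\max}(R)+\frac{J(K_0)\|D\|^2}{\lambda_1(\Sigma_0)}+2\left(\|B\|+\|C\|\|D\|+\|D\|_F^2\,\kappa\right)\xi\right]$$ is a smoothness constant, where $\lambda_1$, $\lambda_{\max}$ are the least and the largest eigenvalue, $\|\cdot\|$ is the spectral norm, and $$\kappa=\frac{2\|B\|J(K_0)}{\lambda_1(\Sigma_0)\lambda_1(R)}+\frac{\|A\|}{\|B\|},\qquad \tilde\mu=\|B\|+\|D\|\|C\|_F+\|D\|^2\kappa,$$ $$\xi=\frac{\sqrt n\,J(K_0)}{\lambda_1(\Sigma_0)}\left(\frac{\tilde\mu J(K_0)}{\lambda_1(\Sigma_0)\lambda_1(Q)}+\sqrt{\Big(\frac{\tilde\mu J(K_0)}{\lambda_1(\Sigma_0)\lambda_1(Q)}\Big)^2+\frac{\lambda_{\max}(R)}{\lambda_1(Q)}}\right).$$ Let $L$ be any smoothness constant, and consider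 gradient descent $K_{k+1}=K_k-\alpha_k\nabla J(K_k)$, started at $K_0$. 1. If $0<\alpha_k\le 2/L$ for all $k$, then for all $k$: $K_k\in\mathcal K\cap\mathcal K_0$ and $$J(K_{k+1})\le J(K_k)-\alpha_k\left(1-\frac{L\alpha_k}{2}\right)\|\nabla J(K_k)\|_F^2 .$$ 2. Let $\varepsilon_1,\varepsilon_2>0$ and $C_0=\varepsilon_1\varepsilon_2L/2$. There are $q\in[0,1)$ and $c\in\mathbb R$, not depending on the step sizes, such that whenever $\varepsilon_1\le\alpha_k\le 2/L-\varepsilon_2$ for all $k$, one has $\nabla J(K_k)\to0$ and, for all $k\ge0$, $$\min_{0\le j\le k}\|\nabla J(K_j)\|_F^2\le\frac{J(K_0)}{C_0(k+1)},\qquad J(K_k)-J(K_*)\le q^k\big(J(K_0)-J(K_*)\big),\qquad \|K_k-K_*\|_F^2\le c\,q^k .$$ -/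

import Mathlib

open MeasureTheory ProbabilityTheory Filter Topology
open scoped NNReal ENNReal Matrix

/- On matrices `‖·‖` is the Frobenius norm. -/
attribute [local instance] Matrix.frobeniusNormedAddCommGroup Matrix.frobeniusNormedSpace

noncomputable section

namespace SLQ

/-! ### Brownian motion and the Itô integral -/

/-- `W` is a standard one-dimensional Brownian motion with respect to the filtration `𝓕`:
a Brownian motion that is adapted and whose increments after time `s` are independent of `𝓕 s`. -/
structure IsBrownianWrt {Ω : Type*} {mΩ : MeasurableSpace Ω} (P : Measure Ω)
    (𝓕 : Filtration ℝ≥0 mΩ) (W : ℝ≥0 → Ω → ℝ) : Prop where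
  brownian : IsBrownianReal W P
  adapted : StronglyAdapted 𝓕 W
  indep : ∀ s t : ℝ≥0, s ≤ t →
    Indep (MeasurableSpace.comap (fun ω => W t ω - W s ω) inferInstance) (𝓕 s) P

/-- A simple process `∑ i < N, coef i * 1_{(time i, time (i+1)]}` with square integrable,
`𝓕 (time i)`-measurable coefficients. -/
structure SimpleProcess {Ω : Type*} {mΩ : MeasurableSpace Ω} (P : Measure Ω)
    (𝓕 : Filtration ℝ≥0 mΩ) where
  N : ℕ
  time : ℕ → ℝ≥0
  mono : Monotone time
  coef : ℕ → Ω → ℝ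
  meas : ∀ i, StronglyMeasurable[𝓕 (time i)] (coef i)
  memLp : ∀ i, MemLp (coef i) 2 P

/-- The value of a simple process at time `s`. -/
def SimpleProcess.value {Ω : Type*} {mΩ : MeasurableSpace Ω} {P : Measure Ω}
    {𝓕 : Filtration ℝ≥0 mΩ} (S : SimpleProcess P 𝓕) (s : ℝ≥0) (ω : Ω) : ℝ :=
  ∑ i ∈ Finset.range S.N,
    (Set.Ioc (S.time i) (S.time (i + 1))).indicator (fun _ => S.coef i ω) s

/-- The elementary stochastic integral of a simple process. -/
def SimpleProcess.integral {Ω : Type*} {mΩ : MeasurableSpace Ω} {P : Measure Ω}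
    {𝓕 : Filtration ℝ≥0 mΩ} (S : SimpleProcess P 𝓕) (W : ℝ≥0 → Ω → ℝ) (ω : Ω) : ℝ :=
  ∑ i ∈ Finset.range S.N, S.coef i ω * (W (S.time (i + 1)) ω - W (S.time i) ω)

/-- `I = ∫₀ᵗ H dW` in the sense of Itô: there are simple processes `S k` on `(0, t]` with
`E ∫₀ᵗ |H - S k|² ds → 0` and `E |I - ∫ S k dW|² → 0`. -/
def IsItoIntegral {Ω : Type*} {mΩ : MeasurableSpace Ω} (P : Measure Ω)
    (𝓕 : Filtration ℝ≥0 mΩ) (W : ℝ≥0 → Ω → ℝ) (t : ℝ≥0) (H : ℝ≥0 → Ω → ℝ) (I : Ω → ℝ) : Prop :=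
  MemLp I 2 P ∧ ∃ S : ℕ → SimpleProcess P 𝓕,
    (∀ k, (S k).time (S k).N ≤ t) ∧
    Tendsto (fun k => ∫⁻ ω, (∫⁻ s in Set.Ioc (0 : ℝ) t,
      ‖H s.toNNReal ω - (S k).value s.toNNReal ω‖ₑ ^ 2) ∂P) atTop (𝓝 0) ∧
    Tendsto (fun k => ∫⁻ ω, ‖I ω - (S k).integral W ω‖ₑ ^ 2 ∂P) atTop (𝓝 0)

/-- An admissible initial state: `𝓕 0`-measurable and square integrable. -/
structure IsInitialState {Ω : Type*} {mΩ : MeasurableSpace Ω} (P : Measure Ω)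
    (𝓕 : Filtration ℝ≥0 mΩ) {n : ℕ} (ξ : Ω → Fin n → ℝ) : Prop where
  meas : StronglyMeasurable[𝓕 0] ξ
  memLp : MemLp ξ 2 P

/-- `X` solves `dX = F X dt + G X dW`, `X(0) = ξ`: it is progressively measurable, square
integrable on bounded time intervals, and for every `t` and every coordinate, almost surely
`X(t) = ξ + ∫₀ᵗ F X ds + ∫₀ᵗ G X dW`. (Such a solution is unique up to modification.) -/
structure IsLinearSDESolution {Ω : Type*} {mΩ : MeasurableSpace Ω} (P : Measure Ω)
    (𝓕 : Filtration ℝ≥0 mΩ) (W : ℝ≥0 → Ω → ℝ) {n : ℕ} (F G : Matrix (Fin n) (Fin n) ℝ)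
    (ξ : Ω → Fin n → ℝ) (X : ℝ≥0 → Ω → Fin n → ℝ) : Prop where
  progressive : IsStronglyProgressive 𝓕 X
  sq_integrable : ∀ T : ℝ≥0, ∫⁻ ω, (∫⁻ s in Set.Ioc (0 : ℝ) T,
    ENNReal.ofReal (X s.toNNReal ω ⬝ᵥ X s.toNNReal ω)) ∂P < ∞
  equation : ∀ (t : ℝ≥0) (i : Fin n), IsItoIntegral P 𝓕 W t (fun s ω => (G *ᵥ X s ω) i)
    (fun ω => X t ω i - ξ ω i - ∫ s in (0 : ℝ)..t, (F *ᵥ X s.toNNReal ω) i)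

/-! ### The linear-quadratic problem -/

/-- The coefficients of the state equation and the weights of the cost. -/
structure LQData (n m : ℕ) where
  A : Matrix (Fin n) (Fin n) ℝ
  B : Matrix (Fin n) (Fin m) ℝ
  C : Matrix (Fin n) (Fin n) ℝ
  D : Matrix (Fin n) (Fin m) ℝ
  Q : Matrix (Fin n) (Fin n) ℝ
  R : Matrix (Fin m) (Fin m) ℝ

/-- `X` is the closed-loop state under `u = K X` with initial state `ξ`:
`dX = (A + B K) X dt + (C + D K) X dW`, `X(0) = ξ`. -/
def IsState {Ω : Type*} {mΩ : MeasurableSpace Ω} (P : Measure Ω)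
    (𝓕 : Filtration ℝ≥0 mΩ) (W : ℝ≥0 → Ω → ℝ) {n m : ℕ} (S : LQData n m)
    (ξ : Ω → Fin n → ℝ) (K : Matrix (Fin m) (Fin n) ℝ) (X : ℝ≥0 → Ω → Fin n → ℝ) : Prop :=
  IsLinearSDESolution P 𝓕 W (S.A + S.B * K) (S.C + S.D * K) ξ X

/-- The set `𝒦` of mean-square stabilizers: `E[X(t)ᵀ X(t)] → 0` for every initial state. -/
def stabilizers {Ω : Type*} {mΩ : MeasurableSpace Ω} (P : Measure Ω)
    (𝓕 : Filtration ℝ≥0 mΩ) (W : ℝ≥0 → Ω → ℝ) {n m : ℕ} (S : LQData n m) :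
    Set (Matrix (Fin m) (Fin n) ℝ) :=
  {K | ∀ (ξ : Ω → Fin n → ℝ) (X : ℝ≥0 → Ω → Fin n → ℝ), IsInitialState P 𝓕 ξ →
    IsState P 𝓕 W S ξ K X →
    Tendsto (fun t => ∫⁻ ω, ENNReal.ofReal (X t ω ⬝ᵥ X t ω) ∂P) atTop (𝓝 0)}

/-- The cost `E ∫₀^∞ X(t)ᵀ (Q + Kᵀ R K) X(t) dt ∈ [0, ∞]` of the feedback `K`, where `X` is the
state under `K` started at `ξ`. The state is unique up to modification, so the infimum is over
equal values. -/
def cost {Ω : Type*} {mΩ : MeasurableSpace Ω} (P : Measure Ω)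
    (𝓕 : Filtration ℝ≥0 mΩ) (W : ℝ≥0 → Ω → ℝ) {n m : ℕ} (S : LQData n m)
    (ξ : Ω → Fin n → ℝ) (K : Matrix (Fin m) (Fin n) ℝ) : ℝ≥0∞ :=
  ⨅ (X : ℝ≥0 → Ω → Fin n → ℝ) (_ : IsState P 𝓕 W S ξ K X),
    ∫⁻ ω, (∫⁻ t in Set.Ioi (0 : ℝ), ENNReal.ofReal
      (X t.toNNReal ω ⬝ᵥ ((S.Q + Kᵀ * S.R * K) *ᵥ X t.toNNReal ω))) ∂P

/-- The cost as a real number (used where it is finite). -/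
def J {Ω : Type*} {mΩ : MeasurableSpace Ω} (P : Measure Ω)
    (𝓕 : Filtration ℝ≥0 mΩ) (W : ℝ≥0 → Ω → ℝ) {n m : ℕ} (S : LQData n m)
    (ξ : Ω → Fin n → ℝ) (K : Matrix (Fin m) (Fin n) ℝ) : ℝ :=
  (cost P 𝓕 W S ξ K).toReal

/-- The sublevel set `𝒦₀ = {K | J(K) ≤ J(K₀)}`, where `J` takes values in `[0, ∞]`. -/
def sublevel {Ω : Type*} {mΩ : MeasurableSpace Ω} (P : Measure Ω)
    (𝓕 : Filtration ℝ≥0 mΩ) (W : ℝ≥0 → Ω → ℝ) {n m : ℕ} (S : LQData n m)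
    (ξ : Ω → Fin n → ℝ) (K₀ : Matrix (Fin m) (Fin n) ℝ) : Set (Matrix (Fin m) (Fin n) ℝ) :=
  {K | cost P 𝓕 W S ξ K ≤ cost P 𝓕 W S ξ K₀}

/-- The gradient `∇J(K)`: the matrix of partial derivatives of `J` at `K`. -/
def gradJ {Ω : Type*} {mΩ : MeasurableSpace Ω} (P : Measure Ω)
    (𝓕 : Filtration ℝ≥0 mΩ) (W : ℝ≥0 → Ω → ℝ) {n m : ℕ} (S : LQData n m)
    (ξ : Ω → Fin n → ℝ) (K : Matrix (Fin m) (Fin n) ℝ) : Matrix (Fin m) (Fin n) ℝ :=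
  Matrix.of fun i j => fderiv ℝ (J P 𝓕 W S ξ) K (Matrix.single i j 1)

/-- The second directional derivative `∇²J(K)[E, E]`. -/
def hessJ {Ω : Type*} {mΩ : MeasurableSpace Ω} (P : Measure Ω)
    (𝓕 : Filtration ℝ≥0 mΩ) (W : ℝ≥0 → Ω → ℝ) {n m : ℕ} (S : LQData n m)
    (ξ : Ω → Fin n → ℝ) (K E : Matrix (Fin m) (Fin n) ℝ) : ℝ :=
  iteratedDeriv 2 (fun t : ℝ => J P 𝓕 W S ξ (K + t • E)) 0

/-- `L > 0` is a smoothness constant of `J` on `𝒦₀`: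
`|∇²J(K)[E, E]| ≤ L ‖E‖_F²` for all `K ∈ 𝒦₀` and all `E`. -/
def IsSmoothnessConstant {Ω : Type*} {mΩ : MeasurableSpace Ω} (P : Measure Ω)
    (𝓕 : Filtration ℝ≥0 mΩ) (W : ℝ≥0 → Ω → ℝ) {n m : ℕ} (S : LQData n m)
    (ξ : Ω → Fin n → ℝ) (K₀ : Matrix (Fin m) (Fin n) ℝ) (L : ℝ) : Prop :=
  0 < L ∧ ∀ K ∈ sublevel P 𝓕 W S ξ K₀, ∀ E : Matrix (Fin m) (Fin n) ℝ,
    |hessJ P 𝓕 W S ξ K E| ≤ L * ‖E‖ ^ 2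

/-- `K` minimizes the cost over all stabilizers. -/
def IsOptimal {Ω : Type*} {mΩ : MeasurableSpace Ω} (P : Measure Ω)
    (𝓕 : Filtration ℝ≥0 mΩ) (W : ℝ≥0 → Ω → ℝ) {n m : ℕ} (S : LQData n m)
    (ξ : Ω → Fin n → ℝ) (K : Matrix (Fin m) (Fin n) ℝ) : Prop :=
  K ∈ stabilizers P 𝓕 W S ∧
    ∀ K' ∈ stabilizers P 𝓕 W S, cost P 𝓕 W S ξ K ≤ cost P 𝓕 W S ξ K'

/-- `Kseq` is generated by gradient descent from `K₀` with step sizes `α`. -/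
def IsGradientDescent {Ω : Type*} {mΩ : MeasurableSpace Ω} (P : Measure Ω)
    (𝓕 : Filtration ℝ≥0 mΩ) (W : ℝ≥0 → Ω → ℝ) {n m : ℕ} (S : LQData n m)
    (ξ : Ω → Fin n → ℝ) (K₀ : Matrix (Fin m) (Fin n) ℝ) (α : ℕ → ℝ)
    (Kseq : ℕ → Matrix (Fin m) (Fin n) ℝ) : Prop :=
  Kseq 0 = K₀ ∧ ∀ k, Kseq (k + 1) = Kseq k - α k • gradJ P 𝓕 W S ξ (Kseq k)

/-! ### The explicit smoothness constant -/

/-- The matrix of second moments `E[ξ ξᵀ]`. -/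
def secondMoment {Ω : Type*} {mΩ : MeasurableSpace Ω} (P : Measure Ω) {n : ℕ}
    (ξ : Ω → Fin n → ℝ) : Matrix (Fin n) (Fin n) ℝ :=
  Matrix.of fun i j => ∫ ω, ξ ω i * ξ ω j ∂P

/-- The spectral norm of a matrix. -/
def specNorm {k l : ℕ} (M : Matrix (Fin k) (Fin l) ℝ) : ℝ :=
  ‖LinearMap.toContinuousLinearMap (Matrix.toEuclideanLin M)‖

/-- The minimal eigenvalue of a symmetric matrix. -/
def minEig {k : ℕ} (M : Matrix (Fin k) (Fin k) ℝ) : ℝ := sInf (spectrum ℝ M)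

/-- The maximal eigenvalue of a symmetric matrix. -/
def maxEig {k : ℕ} (M : Matrix (Fin k) (Fin k) ℝ) : ℝ := sSup (spectrum ℝ M)

/-- `2 ‖B‖ j / (λ₁(Σ₀) λ₁(R)) + ‖A‖ / ‖B‖`, where `j` stands for `J(K₀)`. -/
def gainBound {n m : ℕ} (S : LQData n m) (Sig : Matrix (Fin n) (Fin n) ℝ) (j : ℝ) : ℝ :=
  2 * specNorm S.B * j / (minEig Sig * minEig S.R) + specNorm S.A / specNorm S.B

/-- The constant `μ̃`. -/
def muTilde {n m : ℕ} (S : LQData n m) (Sig : Matrix (Fin n) (Fin n) ℝ) (j : ℝ) : ℝ :=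
  specNorm S.B + specNorm S.D * ‖S.C‖ + specNorm S.D ^ 2 * gainBound S Sig j

/-- The constant `ξ`. -/
def xiConst {n m : ℕ} (S : LQData n m) (Sig : Matrix (Fin n) (Fin n) ℝ) (j : ℝ) : ℝ :=
  √n * j / minEig Sig *
    (muTilde S Sig j * j / (minEig Sig * minEig S.Q) +
      √((muTilde S Sig j * j / (minEig Sig * minEig S.Q)) ^ 2 + maxEig S.R / minEig S.Q))

/-- The explicit smoothness constant. -/
def explicitL {n m : ℕ} (S : LQData n m) (Sig : Matrix (Fin n) (Fin n) ℝ) (j : ℝ) : ℝ :=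
  2 * j / minEig S.Q *
    (maxEig S.R + j * specNorm S.D ^ 2 / minEig Sig +
      2 * (specNorm S.B + specNorm S.C * specNorm S.D + ‖S.D‖ ^ 2 * gainBound S Sig j) *
        xiConst S Sig j)

end SLQ

end

/-!
The second moments of a solution of `dX = F X dt + G X dW` solve a linear matrix equation, and this
turns the stochastic problem into matrix analysis. Existence of solutions and the moment formula
`E[X(t) Y(t)ᵀ] = exp (t ℒ) E[X(0) Y(0)ᵀ]`, with `ℒ M = F M + M Fᵀ + G M Gᵀ`
(`isLinearSDESolution_eulerLimit`, `IsLinearSDESolution.crossMoment_eq`), both come from the Euler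
scheme. The Itô isometry for simple processes and a Gronwall inequality show that all approximate
solutions are close in mean square (`exists_isApproxSolution_bound`), and the moments of the Euler
scheme are powers of `1 + h ℒ + O(h²)`.

Hence `K` is a mean-square stabilizer iff the semigroup `exp (t ℒ_K)` tends to zero, which is an open
condition on `K` (`isOpen_stabilizes`), and then
`J(K) = tr ((Q + Kᵀ R K) Σ_K) = tr (P_K Σ₀)`, where `Σ_K` and `P_K` solve the Lyapunov equations
`ℒ_K Σ_K = -Σ₀` and `ℒ_Kᵀ P_K = -(Q + Kᵀ R K)`. This is smooth in `K`, because inversion of operators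
is. Conversely a finite cost makes `f(t) = exp (t ℒ_K) Σ₀` integrable, because `Q` is positive
definite; then `f' = ℒ_K f` is integrable too, so `f → 0`. As `Σ₀` is positive definite, `K` then is a
stabilizer (`tendsto_trace_exp_of_lintegral_lt_top`). So the sublevel sets of `J` consist of stabilizers.

Everything else follows from the exact increment formula `lqCost_add_sub`,
`J(K + Δ) - J(K) = tr ((Δᵀ E_K + E_Kᵀ Δ + Δᵀ M_K Δ) Σ_{K + Δ})`,
with `E_K = R K + Bᵀ P_K + Dᵀ P_K (C + D K)` and `M_K = R + Dᵀ P_K D ≥ R`.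

* It gives `∇J(K) = 2 E_K Σ_K` (`gradJ_eq`) and the Hessian, which is bounded by estimating the
  directional derivative of `P_K` through that of `Q + Kᵀ R K`
  (`GainBounds.abs_iteratedDeriv_le`, `isSmoothnessConstant_explicitL`).
* On a sublevel set `Σ_K` is bounded above and below, and `K` is bounded (`exists_sublevel_bounds`).
  By Fatou's lemma the sublevel set is closed, hence compact, and a minimizer `K_*` exists.
  Completing the square in the increment formula yields gradient domination
  `J(K) - J(K_*) ≤ C ‖∇J(K)‖²` (`lqCost_sub_le`), and since `E_{K_*} = 0` it yields quadratic growth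
  `σ r ‖K - K_*‖² ≤ J(K) - J(K_*)` (`mul_norm_sq_le_lqCost_sub`), and so uniqueness.
* The sublevel set need not be convex, so descent for a step of length up to `2 / L` needs an
  argument: along the segment from `K` the cost stays below its initial value as long as the segment
  remains in the sublevel set, so the segment cannot leave it (`gradient_step`). Descent with gradient
  domination gives linear convergence of the cost, and quadratic growth carries it over to the gains
  (`exists_linear_convergence`).
-/

namespace SLQ

/-! ### Increments of Brownian motion -/

section Increments

variable {Ω : Type*} {mΩ : MeasurableSpace Ω} {P : Measure Ω}
  {𝓕 : Filtration ℝ≥0 mΩ} {W : ℝ≥0 → Ω → ℝ}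

theorem IsBrownianWrt.stronglyMeasurable_inc (hW : IsBrownianWrt P 𝓕 W) {s t u : ℝ≥0}
    (hs : s ≤ u) (ht : t ≤ u) : StronglyMeasurable[𝓕 u] fun ω => W t ω - W s ω :=
  ((hW.adapted t).mono (𝓕.mono ht)).sub ((hW.adapted s).mono (𝓕.mono hs))

theorem IsBrownianWrt.hasLaw_inc (hW : IsBrownianWrt P 𝓕 W) {s t : ℝ≥0} (hst : s ≤ t) :
    HasLaw (fun ω => W t ω - W s ω) (gaussianReal 0 (t - s)) P := by
  have h := hW.brownian.hasLaw_sub t s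
  have e : nndist (t : ℝ) (s : ℝ) = t - s := by
    ext
    rw [coe_nndist, Real.dist_eq, NNReal.coe_sub hst,
      abs_of_nonneg (sub_nonneg.2 (NNReal.coe_le_coe.2 hst))]
  exact e ▸ h

theorem IsBrownianWrt.memLp_inc (hW : IsBrownianWrt P 𝓕 W) {s t : ℝ≥0} (hst : s ≤ t) :
    MemLp (fun ω => W t ω - W s ω) 2 P := by
  have h := hW.hasLaw_inc hst
  have h2 : MemLp id (2 : ℝ≥0) (gaussianReal 0 (t - s)) := memLp_id_gaussianReal 2
  rw [← h.map_eq] at h2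
  exact (memLp_map_measure_iff (by fun_prop) h.aemeasurable).1 h2

theorem IsBrownianWrt.integral_inc (hW : IsBrownianWrt P 𝓕 W) {s t : ℝ≥0} (hst : s ≤ t) :
    ∫ ω, (W t ω - W s ω) ∂P = 0 := by
  have h := (hW.hasLaw_inc hst).integral_eq
  simpa using h

theorem IsBrownianWrt.integral_inc_sq (hW : IsBrownianWrt P 𝓕 W) {s t : ℝ≥0} (hst : s ≤ t) :
    ∫ ω, (W t ω - W s ω) ^ 2 ∂P = (t : ℝ) - s := by
  have h := (hW.hasLaw_inc hst).variance_eq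
  rw [variance_of_integral_eq_zero (hW.hasLaw_inc hst).aemeasurable (hW.integral_inc hst)] at h
  rw [h, variance_id_gaussianReal, NNReal.coe_sub hst]

theorem IsBrownianWrt.indepFun_inc (hW : IsBrownianWrt P 𝓕 W) {s t : ℝ≥0} (hst : s ≤ t)
    {Z : Ω → ℝ} (hZ : StronglyMeasurable[𝓕 s] Z) : IndepFun Z (fun ω => W t ω - W s ω) P := by
  have h := (hW.indep s t hst).symm
  rw [IndepFun_iff_Indep]
  exact indep_of_indep_of_le_left h hZ.measurable.comap_le

theorem IsBrownianWrt.integral_mul_inc (hW : IsBrownianWrt P 𝓕 W) {s t : ℝ≥0} (hst : s ≤ t)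
    {Z : Ω → ℝ} (hZ : StronglyMeasurable[𝓕 s] Z) : ∫ ω, Z ω * (W t ω - W s ω) ∂P = 0 := by
  rw [(hW.indepFun_inc hst hZ).integral_fun_mul_eq_mul_integral
    (hZ.mono (𝓕.le s)).aestronglyMeasurable (hW.memLp_inc hst).1, hW.integral_inc hst, mul_zero]

theorem IsBrownianWrt.integral_mul_inc_sq (hW : IsBrownianWrt P 𝓕 W) {s t : ℝ≥0} (hst : s ≤ t)
    {Z : Ω → ℝ} (hZ : StronglyMeasurable[𝓕 s] Z) :
    ∫ ω, Z ω * (W t ω - W s ω) ^ 2 ∂P = (∫ ω, Z ω ∂P) * ((t : ℝ) - s) := by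
  have hi : IndepFun Z (fun ω => (W t ω - W s ω) ^ 2) P :=
    (hW.indepFun_inc hst hZ).comp measurable_id (measurable_id.pow_const 2)
  rw [hi.integral_fun_mul_eq_mul_integral (hZ.mono (𝓕.le s)).aestronglyMeasurable
    ((hW.memLp_inc hst).1.pow 2), hW.integral_inc_sq hst]

theorem IsBrownianWrt.memLp_mul_inc (hW : IsBrownianWrt P 𝓕 W) {s t : ℝ≥0} (hst : s ≤ t)
    {Z : Ω → ℝ} (hZ : StronglyMeasurable[𝓕 s] Z) (hZ2 : MemLp Z 2 P) :
    MemLp (fun ω => Z ω * (W t ω - W s ω)) 2 P := by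
  have hm := (hZ.mono (𝓕.le s)).aestronglyMeasurable (μ := P)
  refine (memLp_two_iff_integrable_sq (hm.mul (hW.memLp_inc hst).1)).2 ?_
  have hi : IndepFun (fun ω => Z ω ^ 2) (fun ω => (W t ω - W s ω) ^ 2) P :=
    (hW.indepFun_inc hst hZ).comp (measurable_id.pow_const 2) (measurable_id.pow_const 2)
  refine (hi.integrable_mul hZ2.integrable_sq (hW.memLp_inc hst).integrable_sq).congr
    (Eventually.of_forall fun ω => ?_)
  simp [mul_pow]

/-- The pairing of two elementary stochastic integrals over intervals with the same left end. -/
theorem IsBrownianWrt.integral_mul_inc_mul_inc_same (hW : IsBrownianWrt P 𝓕 W) {u t v : ℝ≥0}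
    (ht : u ≤ t) (hv : u ≤ v) {a b : Ω → ℝ} (ha : StronglyMeasurable[𝓕 u] a) (ha2 : MemLp a 2 P)
    (hb : StronglyMeasurable[𝓕 u] b) (hb2 : MemLp b 2 P) :
    ∫ ω, (a ω * (W t ω - W u ω)) * (b ω * (W v ω - W u ω)) ∂P
      = (∫ ω, a ω * b ω ∂P) * ((min t v : ℝ≥0) - u : ℝ) := by
  wlog htv : t ≤ v generalizing t v a b
  · have := this hv ht hb hb2 ha ha2 (le_of_not_ge htv)
    rw [min_comm, ← integral_congr_ae (Eventually.of_forall fun ω => mul_comm (b ω) (a ω)), ← this]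
    exact integral_congr_ae (Eventually.of_forall fun ω => mul_comm _ _)
  rw [min_eq_left htv, ← hW.integral_mul_inc_sq ht (Z := fun ω => a ω * b ω) (ha.mul hb)]
  have h1 : Integrable (fun ω => (a ω * (W t ω - W u ω)) * (b ω * (W t ω - W u ω))) P :=
    (hW.memLp_mul_inc ht ha ha2).integrable_mul (hW.memLp_mul_inc ht hb hb2)
  have hbt : StronglyMeasurable[𝓕 t] b := hb.mono (𝓕.mono ht)
  have h2 : Integrable (fun ω => (a ω * (W t ω - W u ω)) * (b ω * (W v ω - W t ω))) P :=
    (hW.memLp_mul_inc ht ha ha2).integrable_mul (hW.memLp_mul_inc htv hbt hb2)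
  have h3 : ∫ ω, (a ω * (W t ω - W u ω)) * (b ω * (W v ω - W t ω)) ∂P = 0 := by
    rw [← hW.integral_mul_inc htv (Z := fun ω => (a ω * (W t ω - W u ω)) * b ω)]
    · exact integral_congr_ae (Eventually.of_forall fun ω => by ring)
    · exact ((ha.mono (𝓕.mono ht)).mul (hW.stronglyMeasurable_inc ht le_rfl)).mul hbt
  calc _ = ∫ ω, ((a ω * (W t ω - W u ω)) * (b ω * (W t ω - W u ω))
        + (a ω * (W t ω - W u ω)) * (b ω * (W v ω - W t ω))) ∂P :=
        integral_congr_ae (Eventually.of_forall fun ω => by ring)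
    _ = _ := by
        rw [integral_add h1 h2, h3, add_zero]
        exact integral_congr_ae (Eventually.of_forall fun ω => by ring)

/-- The pairing of two elementary stochastic integrals: the expectation of the product of the
coefficients times the length of the overlap of the two time intervals. -/
theorem IsBrownianWrt.integral_mul_inc_mul_inc (hW : IsBrownianWrt P 𝓕 W) {s t u v : ℝ≥0}
    (hst : s ≤ t) (huv : u ≤ v) {a b : Ω → ℝ} (ha : StronglyMeasurable[𝓕 s] a) (ha2 : MemLp a 2 P)
    (hb : StronglyMeasurable[𝓕 u] b) (hb2 : MemLp b 2 P) :
    ∫ ω, (a ω * (W t ω - W s ω)) * (b ω * (W v ω - W u ω)) ∂P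
      = (∫ ω, a ω * b ω ∂P) * max (min (t : ℝ) v - max (s : ℝ) u) 0 := by
  wlog hsu : s ≤ u generalizing s t u v a b
  · have := this huv hst hb hb2 ha ha2 (le_of_not_ge hsu)
    rw [min_comm, max_comm (s : ℝ), ← integral_congr_ae
      (Eventually.of_forall fun ω => mul_comm (b ω) (a ω)), ← this]
    exact integral_congr_ae (Eventually.of_forall fun ω => mul_comm _ _)
  have hsu' : (s : ℝ) ≤ u := hsu
  -- an increment that ends before `u` is orthogonal to one that starts at `u`
  have key : ∀ p : ℝ≥0, s ≤ p → p ≤ u →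
      ∫ ω, (a ω * (W p ω - W s ω)) * (b ω * (W v ω - W u ω)) ∂P = 0 := by
    intro p hsp hpu
    rw [← hW.integral_mul_inc huv (Z := fun ω => (a ω * (W p ω - W s ω)) * b ω)]
    · exact integral_congr_ae (Eventually.of_forall fun ω => by ring)
    · exact ((ha.mono (𝓕.mono hsu)).mul (hW.stronglyMeasurable_inc hsu hpu)).mul hb
  rcases le_total t u with htu | hut
  · have htu' : (t : ℝ) ≤ u := htu
    rw [key t hst htu, max_eq_right (a := _ - _), mul_zero]
    rw [max_eq_right hsu']
    linarith [min_le_left (t : ℝ) v]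
  · have hau : StronglyMeasurable[𝓕 u] a := ha.mono (𝓕.mono hsu)
    have h1 : Integrable (fun ω => (a ω * (W u ω - W s ω)) * (b ω * (W v ω - W u ω))) P :=
      (hW.memLp_mul_inc hsu ha ha2).integrable_mul (hW.memLp_mul_inc huv hb hb2)
    have h2 : Integrable (fun ω => (a ω * (W t ω - W u ω)) * (b ω * (W v ω - W u ω))) P :=
      (hW.memLp_mul_inc hut hau ha2).integrable_mul (hW.memLp_mul_inc huv hb hb2)
    calc _ = ∫ ω, ((a ω * (W u ω - W s ω)) * (b ω * (W v ω - W u ω))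
          + (a ω * (W t ω - W u ω)) * (b ω * (W v ω - W u ω))) ∂P :=
          integral_congr_ae (Eventually.of_forall fun ω => by ring)
      _ = _ := by
          have hmin : (u : ℝ) ≤ min (t : ℝ) v := le_min hut huv
          rw [integral_add h1 h2, key u hsu le_rfl, zero_add,
            hW.integral_mul_inc_mul_inc_same hut huv hau ha2 hb hb2, max_eq_right hsu',
            max_eq_left (by linarith), NNReal.coe_min]

end Increments

/-! ### The isometry for simple processes -/

section Isometry

variable {Ω : Type*} {mΩ : MeasurableSpace Ω} {P : Measure Ω}
  {𝓕 : Filtration ℝ≥0 mΩ} {W : ℝ≥0 → Ω → ℝ}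

theorem lintegral_enorm_sq_eq {α : Type*} {m : MeasurableSpace α} {μ : Measure α} {f : α → ℝ}
    (hf : MemLp f 2 μ) : ∫⁻ x, ‖f x‖ₑ ^ 2 ∂μ = ENNReal.ofReal (∫ x, f x ^ 2 ∂μ) := by
  rw [ofReal_integral_eq_lintegral_ofReal hf.integrable_sq
    (Eventually.of_forall fun x => sq_nonneg _)]
  refine lintegral_congr fun x => ?_
  rw [← Real.enorm_of_nonneg (sq_nonneg _), enorm_pow]

theorem enorm_sq_eq_ofReal (x : ℝ) : ‖x‖ₑ ^ 2 = ENNReal.ofReal (x ^ 2) := by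
  rw [← Real.enorm_of_nonneg (sq_nonneg _), enorm_pow]

theorem toNNReal_mem_Ioc {s : ℝ} {a b : ℝ≥0} :
    s.toNNReal ∈ Set.Ioc a b ↔ s ∈ Set.Ioc (a : ℝ) b := by
  rw [Set.mem_Ioc, Set.mem_Ioc, Real.lt_toNNReal_iff_coe_lt, Real.toNNReal_le_iff_le_coe]

theorem integral_sum_sq {α ι : Type*} [Fintype ι] {m : MeasurableSpace α} {μ : Measure α}
    (f : ι → α → ℝ) (hf : ∀ i, MemLp (f i) 2 μ) :
    ∫ x, (∑ i, f i x) ^ 2 ∂μ = ∑ i, ∑ j, ∫ x, f i x * f j x ∂μ := by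
  have hi : ∀ i j, Integrable (fun x => f i x * f j x) μ := fun i j =>
    (hf i).integrable_mul (hf j)
  simp_rw [sq, Finset.sum_mul_sum]
  rw [integral_finsetSum _ fun i _ => integrable_finsetSum _ fun j _ => hi i j]
  exact Finset.sum_congr rfl fun i _ => integral_finsetSum _ fun j _ => hi i j

/-- The isometry for finite families of elementary integrands. The family need not be ordered in
time, so that it covers differences of simple processes. -/
theorem IsBrownianWrt.isometry_sum (hW : IsBrownianWrt P 𝓕 W) {ι : Type*} [Fintype ι]
    {T : ℝ≥0} (s t : ι → ℝ≥0) (hst : ∀ i, s i ≤ t i) (htT : ∀ i, t i ≤ T) (c : ι → Ω → ℝ)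
    (hc : ∀ i, StronglyMeasurable[𝓕 (s i)] (c i)) (hc2 : ∀ i, MemLp (c i) 2 P) :
    ∫⁻ ω, ‖∑ i, c i ω * (W (t i) ω - W (s i) ω)‖ₑ ^ 2 ∂P
      = ∫⁻ ω, (∫⁻ r in Set.Ioc (0 : ℝ) T,
          ‖∑ i, (Set.Ioc (s i) (t i)).indicator (fun _ => c i ω) r.toNNReal‖ₑ ^ 2) ∂P := by
  set ov : ι → ι → ℝ := fun i j => max (min (t i : ℝ) (t j) - max (s i : ℝ) (s j)) 0 with hov
  have hint : ∀ i j, Integrable (fun ω => c i ω * c j ω) P := fun i j =>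
    (hc2 i).integrable_mul (hc2 j)
  have hL : MemLp (fun ω => ∑ i, c i ω * (W (t i) ω - W (s i) ω)) 2 P :=
    memLp_finsetSum _ fun i _ => hW.memLp_mul_inc (hst i) (hc i) (hc2 i)
  have hcongr : ∀ (i : ι) (ω : Ω) (r : ℝ),
      (Set.Ioc (s i) (t i)).indicator (fun _ => c i ω) r.toNNReal
        = (Set.Ioc (s i : ℝ) (t i)).indicator (fun _ => c i ω) r := by
    intro i ω r
    by_cases h : r ∈ Set.Ioc (s i : ℝ) (t i)
    · rw [Set.indicator_of_mem h, Set.indicator_of_mem (toNNReal_mem_Ioc.2 h)]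
    · rw [Set.indicator_of_notMem h,
        Set.indicator_of_notMem (fun h' => h (toNNReal_mem_Ioc.1 h'))]
  have hind : ∀ (i : ι) (ω : Ω), MemLp
      (fun r => (Set.Ioc (s i : ℝ) (t i)).indicator (fun _ => c i ω) r) 2
      (volume.restrict (Set.Ioc (0 : ℝ) T)) := fun i ω =>
    (memLp_const (c i ω)).indicator measurableSet_Ioc
  have hpair : ∀ (i j : ι) (ω : Ω), ∫ r in Set.Ioc (0 : ℝ) T,
      (Set.Ioc (s i : ℝ) (t i)).indicator (fun _ => c i ω) r *
      (Set.Ioc (s j : ℝ) (t j)).indicator (fun _ => c j ω) r = c i ω * c j ω * ov i j := by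
    intro i j ω
    have h1 : (fun r => (Set.Ioc (s i : ℝ) (t i)).indicator (fun _ => c i ω) r *
        (Set.Ioc (s j : ℝ) (t j)).indicator (fun _ => c j ω) r)
        = (Set.Ioc (max (s i : ℝ) (s j)) (min (t i : ℝ) (t j))).indicator
            (fun _ => c i ω * c j ω) := by
      funext r
      rw [← Set.Ioc_inter_Ioc, Set.inter_indicator_mul]
    have h2 : Set.Ioc (0 : ℝ) T ∩ Set.Ioc (max (s i : ℝ) (s j)) (min (t i : ℝ) (t j))
        = Set.Ioc (max (s i : ℝ) (s j)) (min (t i : ℝ) (t j)) :=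
      Set.inter_eq_right.2 (Set.Ioc_subset_Ioc (le_max_of_le_left (s i).2)
        ((min_le_left _ _).trans (htT i)))
    rw [h1, setIntegral_indicator measurableSet_Ioc, h2, setIntegral_const, smul_eq_mul, mul_comm]
    congr 1
    rw [measureReal_def, Real.volume_Ioc, ENNReal.toReal_ofReal']
  have hQ : ∀ ω, ∫ r in Set.Ioc (0 : ℝ) T,
      (∑ i, (Set.Ioc (s i : ℝ) (t i)).indicator (fun _ => c i ω) r) ^ 2
        = ∑ i, ∑ j, c i ω * c j ω * ov i j := by
    intro ω
    rw [integral_sum_sq _ fun i => hind i ω]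
    exact Finset.sum_congr rfl fun i _ => Finset.sum_congr rfl fun j _ => hpair i j ω
  have hR : ∀ ω, ∫⁻ r in Set.Ioc (0 : ℝ) T,
      ‖∑ i, (Set.Ioc (s i) (t i)).indicator (fun _ => c i ω) r.toNNReal‖ₑ ^ 2
        = ENNReal.ofReal (∑ i, ∑ j, c i ω * c j ω * ov i j) := by
    intro ω
    simp_rw [hcongr]
    rw [lintegral_enorm_sq_eq (memLp_finsetSum _ fun i _ => hind i ω), hQ]
  have hpos : ∀ ω, 0 ≤ ∑ i, ∑ j, c i ω * c j ω * ov i j := by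
    intro ω
    rw [← hQ ω]
    exact integral_nonneg fun r => sq_nonneg _
  rw [lintegral_enorm_sq_eq hL, lintegral_congr hR,
    ← ofReal_integral_eq_lintegral_ofReal _ (Eventually.of_forall hpos)]
  · congr 1
    rw [integral_sum_sq _ fun i => hW.memLp_mul_inc (hst i) (hc i) (hc2 i),
      integral_finsetSum _ fun i _ => integrable_finsetSum _ fun j _ =>
        (hint i j).mul_const _]
    refine Finset.sum_congr rfl fun i _ => ?_
    rw [integral_finsetSum _ fun j _ => (hint i j).mul_const _]
    refine Finset.sum_congr rfl fun j _ => ?_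
    rw [hW.integral_mul_inc_mul_inc (hst i) (hst j) (hc i) (hc2 i) (hc j) (hc2 j),
      integral_mul_const]
  · exact integrable_finsetSum _ fun i _ => integrable_finsetSum _ fun j _ =>
      (hint i j).mul_const _

theorem SimpleProcess.time_le (S : SimpleProcess P 𝓕) {T : ℝ≥0} (h : S.time S.N ≤ T) {i : ℕ}
    (hi : i < S.N) : S.time (i + 1) ≤ T :=
  (S.mono hi).trans h

/-- The isometry for the difference of two simple processes. -/
theorem SimpleProcess.isometry_sub (hW : IsBrownianWrt P 𝓕 W) {T : ℝ≥0} (S S' : SimpleProcess P 𝓕)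
    (hS : S.time S.N ≤ T) (hS' : S'.time S'.N ≤ T) :
    ∫⁻ ω, ‖S.integral W ω - S'.integral W ω‖ₑ ^ 2 ∂P
      = ∫⁻ ω, (∫⁻ r in Set.Ioc (0 : ℝ) T,
          ‖S.value r.toNNReal ω - S'.value r.toNNReal ω‖ₑ ^ 2) ∂P := by
  have h := hW.isometry_sum (ι := Fin S.N ⊕ Fin S'.N) (T := T)
    (Sum.elim (fun i => S.time i) (fun i => S'.time i))
    (Sum.elim (fun i => S.time (i + 1)) (fun i => S'.time (i + 1)))
    (by rintro (i | i); exacts [S.mono (Nat.le_succ _), S'.mono (Nat.le_succ _)])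
    (by rintro (i | i); exacts [S.time_le hS i.2, S'.time_le hS' i.2])
    (Sum.elim (fun i => S.coef i) (fun i ω => -S'.coef i ω))
    (by rintro (i | i); exacts [S.meas i, (S'.meas i).neg])
    (by rintro (i | i); exacts [S.memLp i, (S'.memLp i).neg])
  simp only [Fintype.sum_sum_type, Sum.elim_inl, Sum.elim_inr, Set.indicator_neg, neg_mul,
    Finset.sum_neg_distrib, ← sub_eq_add_neg] at h
  simpa only [SimpleProcess.integral, SimpleProcess.value, Finset.sum_range] using h

end Isometry

/-! ### Comparison of Itô integrals -/

theorem enorm_sub_sq_le_three (a b c d : ℝ) :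
    ‖a - d‖ₑ ^ 2 ≤ 3 * (‖a - b‖ₑ ^ 2 + ‖b - c‖ₑ ^ 2 + ‖c - d‖ₑ ^ 2) := by
  have h3 : (3 : ℝ≥0∞) = ENNReal.ofReal 3 := by simp
  simp only [enorm_sq_eq_ofReal]
  rw [← ENNReal.ofReal_add (sq_nonneg _) (sq_nonneg _),
    ← ENNReal.ofReal_add (by positivity) (sq_nonneg _), h3, ← ENNReal.ofReal_mul (by norm_num)]
  refine ENNReal.ofReal_le_ofReal ?_
  nlinarith [sq_nonneg ((a - b) - (b - c)), sq_nonneg ((b - c) - (c - d)),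
    sq_nonneg ((a - b) - (c - d))]

theorem enorm_add_sq_le_two (a b : ℝ) : ‖a + b‖ₑ ^ 2 ≤ 2 * (‖a‖ₑ ^ 2 + ‖b‖ₑ ^ 2) := by
  have h2 : (2 : ℝ≥0∞) = ENNReal.ofReal 2 := by simp
  simp only [enorm_sq_eq_ofReal]
  rw [← ENNReal.ofReal_add (sq_nonneg _) (sq_nonneg _), h2, ← ENNReal.ofReal_mul (by norm_num)]
  refine ENNReal.ofReal_le_ofReal ?_
  nlinarith [sq_nonneg (a - b)]

theorem lintegral_add_three {α : Type*} {m : MeasurableSpace α} {μ : Measure α}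
    {f g h : α → ℝ≥0∞} (hf : AEMeasurable f μ) (hg : AEMeasurable g μ) :
    ∫⁻ x, f x + g x + h x ∂μ = ∫⁻ x, f x ∂μ + ∫⁻ x, g x ∂μ + ∫⁻ x, h x ∂μ := by
  rw [lintegral_add_left' (f := fun x => f x + g x) (hf.add hg), lintegral_add_left' hf]

/-- A process is jointly measurable in time and state, time being read as a real number. -/
def IsMeasurableProcess {Ω E : Type*} [MeasurableSpace Ω] [MeasurableSpace E]
    (H : ℝ≥0 → Ω → E) : Prop :=
  Measurable fun p : ℝ × Ω => H p.1.toNNReal p.2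

section Ito

variable {Ω : Type*} {mΩ : MeasurableSpace Ω} {P : Measure Ω} {𝓕 : Filtration ℝ≥0 mΩ}
  {W : ℝ≥0 → Ω → ℝ}

theorem SimpleProcess.measurable_value (S : SimpleProcess P 𝓕) :
    IsMeasurableProcess S.value := by
  refine Finset.measurable_sum _ fun i _ => ?_
  have h : MeasurableSet {p : ℝ × Ω | p.1.toNNReal ∈ Set.Ioc (S.time i) (S.time (i + 1))} :=
    (measurable_real_toNNReal.comp measurable_fst) measurableSet_Ioc
  have hc : Measurable fun p : ℝ × Ω => S.coef i p.2 :=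
    ((S.meas i).mono (𝓕.le _)).measurable.comp measurable_snd
  exact hc.indicator h

theorem SimpleProcess.memLp_integral (hW : IsBrownianWrt P 𝓕 W) (S : SimpleProcess P 𝓕) :
    MemLp (S.integral W) 2 P :=
  memLp_finsetSum _ fun i _ => hW.memLp_mul_inc (S.mono (Nat.le_succ i)) (S.meas i) (S.memLp i)

/-- The mean square distance of two Itô integrals is controlled by that of the integrands. (It is
equal to it; the factor `9` is what the triangle inequality gives and does no harm.) -/
theorem IsItoIntegral.lintegral_sub_le [IsProbabilityMeasure P] (hW : IsBrownianWrt P 𝓕 W)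
    {t : ℝ≥0} {H H' : ℝ≥0 → Ω → ℝ} {I I' : Ω → ℝ} (h : IsItoIntegral P 𝓕 W t H I)
    (h' : IsItoIntegral P 𝓕 W t H' I') (hH : IsMeasurableProcess H)
    (hH' : IsMeasurableProcess H') :
    ∫⁻ ω, ‖I ω - I' ω‖ₑ ^ 2 ∂P ≤ 9 * ∫⁻ ω, (∫⁻ s in Set.Ioc (0 : ℝ) t,
      ‖H s.toNNReal ω - H' s.toNNReal ω‖ₑ ^ 2) ∂P := by
  obtain ⟨hI, S, hSt, hSH, hSI⟩ := h
  obtain ⟨hI', S', hSt', hSH', hSI'⟩ := h'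
  set D := fun (A B : ℝ≥0 → Ω → ℝ) => ∫⁻ ω, (∫⁻ s in Set.Ioc (0 : ℝ) t,
      ‖A s.toNNReal ω - B s.toNNReal ω‖ₑ ^ 2) ∂P with hD
  have hsq : ∀ {A B : ℝ≥0 → Ω → ℝ}, IsMeasurableProcess A → IsMeasurableProcess B →
      Measurable fun p : ℝ × Ω => ‖A p.1.toNNReal p.2 - B p.1.toNNReal p.2‖ₑ ^ 2 :=
    fun hA hB => (hA.sub hB).enorm.pow_const 2
  have hDm : ∀ {A B : ℝ≥0 → Ω → ℝ}, IsMeasurableProcess A → IsMeasurableProcess B →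
      Measurable fun ω => ∫⁻ s in Set.Ioc (0 : ℝ) t, ‖A s.toNNReal ω - B s.toNNReal ω‖ₑ ^ 2 :=
    fun hA hB => (hsq hA hB).lintegral_prod_left'
  have hDsymm : ∀ A B, D A B = D B A := fun A B => by
    simp only [hD]
    refine lintegral_congr fun ω => lintegral_congr fun s => ?_
    rw [← enorm_neg, neg_sub]
  have hDle : ∀ k, D (S k).value (S' k).value ≤
      3 * (D H (S k).value + D H H' + D H' (S' k).value) := by
    intro k
    have m := (S k).measurable_value
    have m' := (S' k).measurable_value
    rw [hDsymm H (S k).value]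
    simp only [hD]
    rw [← lintegral_add_three (hDm m hH).aemeasurable (hDm hH hH').aemeasurable,
      ← lintegral_const_mul' _ _ (by simp)]
    refine lintegral_mono fun ω => ?_
    have s1 := (hsq m hH).comp (measurable_prodMk_right (y := ω))
    have s2 := (hsq hH hH').comp (measurable_prodMk_right (y := ω))
    simp only [Function.comp_def] at s1 s2
    rw [← lintegral_add_three s1.aemeasurable s2.aemeasurable, ← lintegral_const_mul' _ _ (by simp)]
    exact lintegral_mono fun s => enorm_sub_sq_le_three _ _ _ _
  have hle : ∀ k, ∫⁻ ω, ‖I ω - I' ω‖ₑ ^ 2 ∂P ≤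
      3 * (∫⁻ ω, ‖I ω - (S k).integral W ω‖ₑ ^ 2 ∂P +
        3 * (D H (S k).value + D H H' + D H' (S' k).value) +
        ∫⁻ ω, ‖I' ω - (S' k).integral W ω‖ₑ ^ 2 ∂P) := by
    intro k
    have n := ((S k).memLp_integral hW).1
    have n' := ((S' k).memLp_integral hW).1
    have e1 : AEMeasurable (fun ω => ‖I ω - (S k).integral W ω‖ₑ ^ 2) P :=
      (hI.1.sub n).enorm.pow_const 2
    have e2 : AEMeasurable (fun ω => ‖(S k).integral W ω - (S' k).integral W ω‖ₑ ^ 2) P :=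
      (n.sub n').enorm.pow_const 2
    have e3 : AEMeasurable (fun ω => ‖I' ω - (S' k).integral W ω‖ₑ ^ 2) P :=
      (hI'.1.sub n').enorm.pow_const 2
    calc _ ≤ ∫⁻ ω, 3 * (‖I ω - (S k).integral W ω‖ₑ ^ 2 +
          ‖(S k).integral W ω - (S' k).integral W ω‖ₑ ^ 2 +
          ‖I' ω - (S' k).integral W ω‖ₑ ^ 2) ∂P := by
          refine lintegral_mono fun ω => ?_
          have := enorm_sub_sq_le_three (I ω) ((S k).integral W ω) ((S' k).integral W ω) (I' ω)
          rwa [← enorm_neg ((S' k).integral W ω - I' ω), neg_sub] at this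
      _ = 3 * (∫⁻ ω, ‖I ω - (S k).integral W ω‖ₑ ^ 2 ∂P +
          ∫⁻ ω, ‖(S k).integral W ω - (S' k).integral W ω‖ₑ ^ 2 ∂P +
          ∫⁻ ω, ‖I' ω - (S' k).integral W ω‖ₑ ^ 2 ∂P) := by
          rw [lintegral_const_mul' _ _ (by simp), lintegral_add_three e1 e2]
      _ ≤ _ := by
          gcongr
          rw [SimpleProcess.isometry_sub hW (S k) (S' k) (hSt k) (hSt' k)]
          exact hDle k
  have hlim : Tendsto (fun k => 3 * (∫⁻ ω, ‖I ω - (S k).integral W ω‖ₑ ^ 2 ∂P +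
        3 * (D H (S k).value + D H H' + D H' (S' k).value) +
        ∫⁻ ω, ‖I' ω - (S' k).integral W ω‖ₑ ^ 2 ∂P)) atTop
      (𝓝 (3 * (0 + 3 * (0 + D H H' + 0) + 0))) := by
    refine ENNReal.Tendsto.const_mul ((hSI.add (ENNReal.Tendsto.const_mul
      ((hSH.add tendsto_const_nhds).add hSH') (Or.inr (by simp)))).add hSI') (Or.inr (by simp))
  have := ge_of_tendsto' hlim hle
  rw [zero_add, add_zero, zero_add, add_zero, ← mul_assoc] at this
  norm_num at this
  exact this

end Ito

/-! ### A Gronwall inequality -/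

theorem lintegral_exp_le {l : ℝ} (hl : 0 < l) (t : ℝ≥0) :
    ∫⁻ s in Set.Ioc (0 : ℝ) t, ENNReal.ofReal (Real.exp (l * s))
      ≤ ENNReal.ofReal (Real.exp (l * t) / l) := by
  have hc : Continuous fun s : ℝ => Real.exp (l * s) := by fun_prop
  rw [← ofReal_integral_eq_lintegral_ofReal
    ((hc.integrableOn_Icc (a := 0) (b := (t : ℝ))).mono_set Set.Ioc_subset_Icc_self)
    (Eventually.of_forall fun s => (Real.exp_pos _).le)]
  refine ENNReal.ofReal_le_ofReal ?_
  rw [← intervalIntegral.integral_of_le t.coe_nonneg,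
    intervalIntegral.integral_comp_mul_left (fun x => Real.exp x) hl.ne', integral_exp,
    smul_eq_mul, mul_comm, div_eq_mul_inv]
  refine mul_le_mul_of_nonneg_right ?_ (inv_nonneg.2 hl.le)
  linarith [Real.exp_pos (l * 0)]

/-- A Gronwall inequality without any regularity of `u`: the weighted supremum
`S = sup u(t) e^{-lt}` satisfies `S ≤ ε + S / 2`. -/
theorem gronwall_ennreal {T C : ℝ≥0} {u : ℝ≥0 → ℝ≥0∞} {ε B : ℝ≥0∞} (hB : B ≠ ∞)
    (hb : ∀ t ≤ T, u t ≤ B)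
    (h : ∀ t ≤ T, u t ≤ ε + C * ∫⁻ s in Set.Ioc (0 : ℝ) t, u s.toNNReal) :
    ∀ t ≤ T, u t ≤ 2 * ENNReal.ofReal (Real.exp ((2 * C + 1) * T)) * ε := by
  set l : ℝ := 2 * C + 1 with hl
  have hl0 : 0 < l := by positivity
  have hee : ∀ x : ℝ, ENNReal.ofReal (Real.exp (-x)) * ENNReal.ofReal (Real.exp x) = 1 := by
    intro x
    rw [← ENNReal.ofReal_mul (Real.exp_pos _).le, ← Real.exp_add]
    simp
  set S : ℝ≥0∞ := ⨆ (t : ℝ≥0) (_ : t ≤ T), ENNReal.ofReal (Real.exp (-(l * t))) * u t with hS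
  have hSB : S ≤ B := by
    refine iSup₂_le fun t ht => ?_
    calc _ ≤ 1 * B := by
          gcongr
          · rw [← ENNReal.ofReal_one]
            refine ENNReal.ofReal_le_ofReal (Real.exp_le_one_iff.2 ?_)
            have := t.2
            simp only [Left.neg_nonpos_iff]
            positivity
          · exact hb t ht
      _ = B := one_mul _
  have hu : ∀ t ≤ T, u t ≤ ENNReal.ofReal (Real.exp (l * t)) * S := by
    intro t ht
    calc u t = ENNReal.ofReal (Real.exp (l * t)) *
          (ENNReal.ofReal (Real.exp (-(l * t))) * u t) := by
          rw [← mul_assoc, mul_comm (ENNReal.ofReal (Real.exp (l * t))), hee, one_mul]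
      _ ≤ _ := by
          gcongr
          exact le_iSup₂ (f := fun (t : ℝ≥0) (_ : t ≤ T) =>
            ENNReal.ofReal (Real.exp (-(l * t))) * u t) t ht
  have hkey : S ≤ ε + S / 2 := by
    refine iSup₂_le fun t ht => ?_
    have h1 : ∫⁻ s in Set.Ioc (0 : ℝ) t, u s.toNNReal ≤
        ENNReal.ofReal (Real.exp (l * t) / l) * S := by
      calc _ ≤ ∫⁻ s in Set.Ioc (0 : ℝ) t, ENNReal.ofReal (Real.exp (l * s)) * S := by
            refine setLIntegral_mono' measurableSet_Ioc fun s hs => ?_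
            have := hu s.toNNReal ((Real.toNNReal_le_iff_le_coe.2 hs.2).trans ht)
            rwa [Real.coe_toNNReal _ hs.1.le] at this
        _ = (∫⁻ s in Set.Ioc (0 : ℝ) t, ENNReal.ofReal (Real.exp (l * s))) * S :=
            lintegral_mul_const _ (by fun_prop)
        _ ≤ _ := by gcongr; exact lintegral_exp_le hl0 t
    calc _ ≤ ENNReal.ofReal (Real.exp (-(l * t))) *
          (ε + C * (ENNReal.ofReal (Real.exp (l * t) / l) * S)) := by
          gcongr
          exact (h t ht).trans (by gcongr)
      _ = ENNReal.ofReal (Real.exp (-(l * t))) * ε +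
          ENNReal.ofReal (Real.exp (-(l * t)) * C * (Real.exp (l * t) / l)) * S := by
          rw [mul_add, ENNReal.ofReal_mul (by positivity), ENNReal.ofReal_mul (by positivity),
            ENNReal.ofReal_coe_nnreal]
          ring
      _ ≤ 1 * ε + ENNReal.ofReal (1 / 2) * S := by
          gcongr
          · rw [← ENNReal.ofReal_one]
            refine ENNReal.ofReal_le_ofReal (Real.exp_le_one_iff.2 ?_)
            have := t.2
            simp only [Left.neg_nonpos_iff]
            positivity
          · have : Real.exp (-(l * t)) * C * (Real.exp (l * t) / l) = C / l := by
              rw [Real.exp_neg]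
              field_simp
            rw [this, div_le_div_iff₀ hl0 two_pos, hl]
            linarith
      _ = ε + S / 2 := by
          rw [one_mul, ENNReal.div_eq_inv_mul, one_div, ENNReal.ofReal_inv_of_pos two_pos,
            ENNReal.ofReal_ofNat]
  have hSfin : S ≠ ∞ := ne_top_of_le_ne_top hB hSB
  have hS2 : S ≤ 2 * ε := by
    have h2 : S / 2 ≠ ∞ := (ENNReal.div_lt_top hSfin (by simp)).ne
    have h3 : S / 2 ≤ ε := by
      have : S / 2 + S / 2 ≤ ε + S / 2 := by rwa [ENNReal.add_halves]
      exact (ENNReal.add_le_add_iff_right h2).1 this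
    calc S = 2 * (S / 2) := (ENNReal.mul_div_cancel (by simp) (by simp)).symm
      _ ≤ _ := by gcongr
  intro t ht
  calc u t ≤ _ := hu t ht
    _ ≤ ENNReal.ofReal (Real.exp (l * T)) * (2 * ε) := by
        gcongr
    _ = _ := by ring

/-! ### Square norms and measurable processes -/

/-- The square of the Euclidean norm of a vector, as an extended nonnegative real. -/
noncomputable def esq {n : ℕ} (x : Fin n → ℝ) : ℝ≥0∞ := ∑ i, ‖x i‖ₑ ^ 2

theorem esq_eq {n : ℕ} (x : Fin n → ℝ) : esq x = ENNReal.ofReal (x ⬝ᵥ x) := by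
  simp only [esq, enorm_sq_eq_ofReal]
  rw [← ENNReal.ofReal_sum_of_nonneg fun i _ => sq_nonneg _]
  simp [dotProduct, sq]

theorem measurable_esq {n : ℕ} : Measurable (esq : (Fin n → ℝ) → ℝ≥0∞) := by
  unfold esq
  fun_prop

theorem esq_sub_le {n : ℕ} (x y : Fin n → ℝ) : esq (x - y) ≤ 2 * (esq x + esq y) := by
  unfold esq
  rw [← Finset.sum_add_distrib, Finset.mul_sum]
  refine Finset.sum_le_sum fun i _ => ?_
  have := enorm_add_sq_le_two (x i) (-y i)
  rwa [enorm_neg, ← sub_eq_add_neg] at this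

theorem esq_sub_comm {n : ℕ} (x y : Fin n → ℝ) : esq (x - y) = esq (y - x) := by
  unfold esq
  refine Finset.sum_congr rfl fun i _ => ?_
  rw [← enorm_neg]
  simp

theorem esq_sub_le_three {n : ℕ} (x y z w : Fin n → ℝ) :
    esq (x - w) ≤ 3 * (esq (x - y) + esq (y - z) + esq (z - w)) := by
  unfold esq
  rw [← Finset.sum_add_distrib, ← Finset.sum_add_distrib, Finset.mul_sum]
  exact Finset.sum_le_sum fun i _ => enorm_sub_sq_le_three _ _ _ _

theorem frobenius_norm_sq {k l : ℕ} (M : Matrix (Fin k) (Fin l) ℝ) :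
    ‖M‖ ^ 2 = ∑ i, ∑ j, M i j ^ 2 := by
  rw [Matrix.frobenius_norm_def, ← Real.sqrt_eq_rpow, Real.sq_sqrt (by positivity)]
  simp

theorem enorm_mulVec_sq_le {k l : ℕ} (M : Matrix (Fin k) (Fin l) ℝ) (x : Fin l → ℝ) (i : Fin k) :
    ‖(M *ᵥ x) i‖ₑ ^ 2 ≤ ENNReal.ofReal (‖M‖ ^ 2) * esq x := by
  rw [esq_eq, enorm_sq_eq_ofReal, ← ENNReal.ofReal_mul (sq_nonneg _)]
  refine ENNReal.ofReal_le_ofReal ?_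
  have h1 : (M *ᵥ x) i ^ 2 ≤ (∑ j, M i j ^ 2) * ∑ j, x j ^ 2 :=
    Finset.sum_mul_sq_le_sq_mul_sq Finset.univ (fun j => M i j) x
  have h2 : ∑ j, M i j ^ 2 ≤ ‖M‖ ^ 2 := by
    rw [frobenius_norm_sq]
    exact Finset.single_le_sum (f := fun i => ∑ j, M i j ^ 2)
      (fun i _ => Finset.sum_nonneg fun j _ => sq_nonneg _) (Finset.mem_univ i)
  have h3 : x ⬝ᵥ x = ∑ j, x j ^ 2 := by simp [dotProduct, sq]
  rw [h3]
  exact h1.trans (mul_le_mul_of_nonneg_right h2 (Finset.sum_nonneg fun j _ => sq_nonneg _))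

theorem enorm_intervalIntegral_sq_le {t : ℝ≥0} {f : ℝ → ℝ} (hf : Measurable f) :
    ‖∫ s in (0 : ℝ)..t, f s‖ₑ ^ 2 ≤ t * ∫⁻ s in Set.Ioc (0 : ℝ) t, ‖f s‖ₑ ^ 2 := by
  have h1 : ‖∫ s in (0 : ℝ)..t, f s‖ₑ ≤ ∫⁻ s in Set.Ioc (0 : ℝ) t, ‖f s‖ₑ := by
    rw [intervalIntegral.integral_of_le t.coe_nonneg]
    exact enorm_integral_le_lintegral_enorm _
  have h2 := ENNReal.lintegral_mul_le_Lp_mul_Lq (volume.restrict (Set.Ioc (0 : ℝ) t))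
    Real.HolderConjugate.two_two hf.enorm.aemeasurable (aemeasurable_const (b := (1 : ℝ≥0∞)))
  simp only [Pi.mul_apply, mul_one, lintegral_const,
    Measure.restrict_apply_univ, Real.volume_Ioc, sub_zero, ENNReal.ofReal_coe_nnreal,
    ENNReal.rpow_two] at h2
  have h3 := (h1.trans h2)
  calc _ ≤ _ := pow_le_pow_left' h3 2
    _ = _ := by
      rw [mul_pow, ← ENNReal.rpow_natCast, ← ENNReal.rpow_natCast, ← ENNReal.rpow_mul,
        ← ENNReal.rpow_mul]
      norm_num
      rw [mul_comm]

section Processes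

variable {Ω : Type*} {mΩ : MeasurableSpace Ω} {P : Measure Ω} {𝓕 : Filtration ℝ≥0 mΩ}

theorem isMeasurableProcess_of_progressive {n : ℕ} {X : ℝ≥0 → Ω → Fin n → ℝ}
    (hX : IsStronglyProgressive 𝓕 X) : IsMeasurableProcess X := by
  have h : Measurable fun p : ℝ≥0 × Ω => X p.1 p.2 := by
    refine measurable_of_tendsto_metrizable
      (f := fun (k : ℕ) (p : ℝ≥0 × Ω) => X (min p.1 k) p.2) (fun k => ?_) ?_
    · have h1 : Measurable fun p : Set.Iic (k : ℝ≥0) × Ω => X p.1 p.2 :=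
        (hX (k : ℝ≥0)).measurable.mono
          (sup_le_sup le_rfl (MeasurableSpace.comap_mono (𝓕.le _))) le_rfl
      have h2 : Measurable fun p : ℝ≥0 × Ω =>
          ((⟨min p.1 k, Set.mem_Iic.2 (min_le_right _ _)⟩ : Set.Iic (k : ℝ≥0)), p.2) :=
        Measurable.prodMk (Measurable.subtype_mk (by fun_prop)) measurable_snd
      exact h1.comp h2
    · rw [tendsto_pi_nhds]
      rintro ⟨t, ω⟩
      obtain ⟨N, hN⟩ := exists_nat_ge t
      refine tendsto_const_nhds.congr' ?_
      filter_upwards [eventually_ge_atTop N] with k hk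
      have : t ≤ k := hN.trans (by exact_mod_cast hk)
      simp [min_eq_left this]
  exact h.comp ((measurable_real_toNNReal.comp measurable_fst).prodMk measurable_snd)

theorem IsMeasurableProcess.mulVec {k n : ℕ} {X : ℝ≥0 → Ω → Fin n → ℝ}
    (hX : IsMeasurableProcess X) (M : Matrix (Fin k) (Fin n) ℝ) (i : Fin k) :
    IsMeasurableProcess fun s ω => (M *ᵥ X s ω) i := by
  unfold IsMeasurableProcess at *
  simp only [Matrix.mulVec, dotProduct]
  exact Finset.measurable_sum _ fun j _ => ((measurable_pi_apply j).comp hX).const_mul _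

theorem IsMeasurableProcess.measurable_eval {E : Type*} [MeasurableSpace E] {H : ℝ≥0 → Ω → E}
    (hH : IsMeasurableProcess H) (t : ℝ≥0) : Measurable (H t) := by
  have := hH.comp (measurable_prodMk_left (x := (t : ℝ)))
  simpa [Function.comp_def] using this

theorem IsMeasurableProcess.measurable_path {E : Type*} [MeasurableSpace E] {H : ℝ≥0 → Ω → E}
    (hH : IsMeasurableProcess H) (ω : Ω) : Measurable fun s : ℝ => H s.toNNReal ω :=
  hH.comp (measurable_prodMk_right (y := ω))

end Processes

/-! ### Comparison of approximate solutions -/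

section Compare

variable {Ω : Type*} {mΩ : MeasurableSpace Ω} {P : Measure Ω} {𝓕 : Filtration ℝ≥0 mΩ}
  {W : ℝ≥0 → Ω → ℝ} {n : ℕ}

/-- An approximate solution `(X, Y)` of `dX = F X dt + G X dW`: the process `Y` in the
coefficients is allowed to differ from `X`. A solution is an approximate solution with `Y = X`, and
the Euler scheme is one with `Y` a step process. -/
structure IsApproxSolution (P : Measure Ω) (𝓕 : Filtration ℝ≥0 mΩ) (W : ℝ≥0 → Ω → ℝ)
    (F G : Matrix (Fin n) (Fin n) ℝ) (ξ : Ω → Fin n → ℝ) (X Y : ℝ≥0 → Ω → Fin n → ℝ) : Prop where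
  meas : ∀ t, AEMeasurable (X t) P
  measY : IsMeasurableProcess Y
  sq : ∀ T : ℝ≥0, ∫⁻ ω, (∫⁻ s in Set.Ioc (0 : ℝ) T, esq (Y s.toNNReal ω)) ∂P < ∞
  equation : ∀ (t : ℝ≥0) (i : Fin n), IsItoIntegral P 𝓕 W t (fun s ω => (G *ᵥ Y s ω) i)
    (fun ω => X t ω i - ξ ω i - ∫ s in (0 : ℝ)..t, (F *ᵥ Y s.toNNReal ω) i)

theorem IsLinearSDESolution.isApproxSolution {F G : Matrix (Fin n) (Fin n) ℝ} {ξ : Ω → Fin n → ℝ}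
    {X : ℝ≥0 → Ω → Fin n → ℝ} (h : IsLinearSDESolution P 𝓕 W F G ξ X) :
    IsApproxSolution P 𝓕 W F G ξ X X where
  meas t := ((isMeasurableProcess_of_progressive h.progressive).measurable_eval t).aemeasurable
  measY := isMeasurableProcess_of_progressive h.progressive
  sq T := by simpa only [esq_eq] using h.sq_integrable T
  equation := h.equation

theorem lintegral_esq_swap {Z : ℝ≥0 → Ω → Fin n → ℝ} (hZ : IsMeasurableProcess Z)
    [SFinite P] (A : Set ℝ) :
    ∫⁻ ω, (∫⁻ s in A, esq (Z s.toNNReal ω)) ∂P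
      = ∫⁻ s in A, (∫⁻ ω, esq (Z s.toNNReal ω) ∂P) := by
  refine lintegral_lintegral_swap ?_
  exact ((measurable_esq.comp hZ).comp measurable_swap).aemeasurable

theorem intervalIntegrable_mulVec_of_esq {y : ℝ → Fin n → ℝ} (hy : Measurable y) {t : ℝ≥0}
    (hfin : ∫⁻ s in Set.Ioc (0 : ℝ) t, esq (y s) < ∞) (M : Matrix (Fin n) (Fin n) ℝ) (i : Fin n) :
    IntervalIntegrable (fun s => (M *ᵥ y s) i) volume 0 t := by
  rw [intervalIntegrable_iff_integrableOn_Ioc_of_le t.coe_nonneg]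
  have hmeas : Measurable fun s : ℝ => (M *ᵥ y s) i :=
    ((continuous_apply i).comp
      (Continuous.matrix_mulVec continuous_const continuous_id)).measurable.comp hy
  have h2 : MemLp (fun s : ℝ => (M *ᵥ y s) i) 2 (volume.restrict (Set.Ioc (0 : ℝ) t)) := by
    refine ⟨hmeas.aestronglyMeasurable, ?_⟩
    rw [eLpNorm_lt_top_iff_lintegral_rpow_enorm_lt_top (by simp) (by simp)]
    simp only [ENNReal.toReal_ofNat, ENNReal.rpow_two]
    calc _ ≤ ∫⁻ s in Set.Ioc (0 : ℝ) t, ENNReal.ofReal (‖M‖ ^ 2) * esq (y s) :=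
          lintegral_mono fun s => enorm_mulVec_sq_le M _ i
      _ = ENNReal.ofReal (‖M‖ ^ 2) * ∫⁻ s in Set.Ioc (0 : ℝ) t, esq (y s) :=
          lintegral_const_mul' _ _ ENNReal.ofReal_ne_top
      _ < ∞ := ENNReal.mul_lt_top ENNReal.ofReal_lt_top hfin
  exact h2.integrable one_le_two

theorem IsApproxSolution.integrable_path {F G : Matrix (Fin n) (Fin n) ℝ} {ξ : Ω → Fin n → ℝ}
    {X Y : ℝ≥0 → Ω → Fin n → ℝ} (h : IsApproxSolution P 𝓕 W F G ξ X Y) (t : ℝ≥0)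
    (M : Matrix (Fin n) (Fin n) ℝ) (i : Fin n) :
    ∀ᵐ ω ∂P, IntervalIntegrable (fun s => (M *ᵥ Y s.toNNReal ω) i) volume 0 t := by
  have hm : Measurable fun ω => ∫⁻ s in Set.Ioc (0 : ℝ) t, esq (Y s.toNNReal ω) :=
    (measurable_esq.comp h.measY).lintegral_prod_left'
  filter_upwards [ae_lt_top hm (h.sq t).ne] with ω hω
  exact intervalIntegrable_mulVec_of_esq (h.measY.measurable_path ω) hω M i

/-- One step of the comparison: the distance of two approximate solutions in terms of that of the
processes in the coefficients. -/
theorem IsApproxSolution.lintegral_esq_sub_le [IsProbabilityMeasure P] (hW : IsBrownianWrt P 𝓕 W)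
    {F G : Matrix (Fin n) (Fin n) ℝ} {ξ : Ω → Fin n → ℝ} {X Y X' Y' : ℝ≥0 → Ω → Fin n → ℝ}
    (h : IsApproxSolution P 𝓕 W F G ξ X Y) (h' : IsApproxSolution P 𝓕 W F G ξ X' Y') (t : ℝ≥0) :
    ∫⁻ ω, esq (X t ω - X' t ω) ∂P ≤
      ENNReal.ofReal (n * (18 * ‖G‖ ^ 2 + 2 * t * ‖F‖ ^ 2)) *
        ∫⁻ s in Set.Ioc (0 : ℝ) t, ∫⁻ ω, esq (Y s.toNNReal ω - Y' s.toNNReal ω) ∂P := by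
  have hZ : IsMeasurableProcess fun s ω => Y s ω - Y' s ω := h.measY.sub h'.measY
  rw [← lintegral_esq_swap hZ]
  set V := ∫⁻ ω, (∫⁻ s in Set.Ioc (0 : ℝ) t, esq (Y s.toNNReal ω - Y' s.toNNReal ω)) ∂P with hV
  have hVm : Measurable fun ω =>
      ∫⁻ s in Set.Ioc (0 : ℝ) t, esq (Y s.toNNReal ω - Y' s.toNNReal ω) :=
    (measurable_esq.comp hZ).lintegral_prod_left'
  have hcoord : ∀ i, ∫⁻ ω, ‖X t ω i - X' t ω i‖ₑ ^ 2 ∂P ≤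
      ENNReal.ofReal (18 * ‖G‖ ^ 2 + 2 * t * ‖F‖ ^ 2) * V := by
    intro i
    set I := fun ω => X t ω i - ξ ω i - ∫ s in (0 : ℝ)..t, (F *ᵥ Y s.toNNReal ω) i with hI
    set I' := fun ω => X' t ω i - ξ ω i - ∫ s in (0 : ℝ)..t, (F *ᵥ Y' s.toNNReal ω) i with hI'
    have hito := IsItoIntegral.lintegral_sub_le hW (h.equation t i) (h'.equation t i)
      (h.measY.mulVec G i) (h'.measY.mulVec G i)
    have e1 : AEMeasurable (fun ω => ‖I ω - I' ω‖ₑ ^ 2) P :=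
      ((h.equation t i).1.1.sub (h'.equation t i).1.1).enorm.pow_const 2
    have hG : ∫⁻ ω, ‖I ω - I' ω‖ₑ ^ 2 ∂P ≤ 9 * (ENNReal.ofReal (‖G‖ ^ 2) * V) := by
      refine hito.trans ?_
      gcongr
      rw [hV, ← lintegral_const_mul' _ _ ENNReal.ofReal_ne_top]
      refine lintegral_mono fun ω => ?_
      rw [← lintegral_const_mul' _ _ ENNReal.ofReal_ne_top]
      refine lintegral_mono fun s => ?_
      have := enorm_mulVec_sq_le G (Y s.toNNReal ω - Y' s.toNNReal ω) i
      rwa [Matrix.mulVec_sub] at this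
    have hpt : ∀ᵐ ω ∂P, ‖X t ω i - X' t ω i‖ₑ ^ 2 ≤ 2 * (‖I ω - I' ω‖ₑ ^ 2 +
        t * (ENNReal.ofReal (‖F‖ ^ 2) *
          ∫⁻ s in Set.Ioc (0 : ℝ) t, esq (Y s.toNNReal ω - Y' s.toNNReal ω))) := by
      filter_upwards [h.integrable_path t F i, h'.integrable_path t F i] with ω h1 h2
      have e : X t ω i - X' t ω i = (I ω - I' ω) + ∫ s in (0 : ℝ)..t,
          (F *ᵥ (Y s.toNNReal ω - Y' s.toNNReal ω)) i := by
        simp only [Matrix.mulVec_sub, Pi.sub_apply]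
        rw [intervalIntegral.integral_sub h1 h2]
        simp only [hI, hI']
        ring
      rw [e]
      refine (enorm_add_sq_le_two _ _).trans ?_
      gcongr
      refine (enorm_intervalIntegral_sq_le ((hZ.mulVec F i).measurable_path ω)).trans ?_
      gcongr
      rw [← lintegral_const_mul' _ _ ENNReal.ofReal_ne_top]
      exact lintegral_mono fun s => enorm_mulVec_sq_le F _ i
    refine (lintegral_mono_ae hpt).trans ?_
    rw [lintegral_const_mul' _ _ (by simp), lintegral_add_left' e1,
      lintegral_const_mul' _ _ (by simp), lintegral_const_mul' _ _ ENNReal.ofReal_ne_top]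
    calc _ ≤ 2 * (9 * (ENNReal.ofReal (‖G‖ ^ 2) * V) + t * (ENNReal.ofReal (‖F‖ ^ 2) * V)) := by
          gcongr
      _ = _ := by
          rw [ENNReal.ofReal_add (by positivity) (by positivity), ENNReal.ofReal_mul (by norm_num),
            ENNReal.ofReal_mul (by positivity), ENNReal.ofReal_mul (by norm_num),
            ENNReal.ofReal_coe_nnreal]
          simp only [ENNReal.ofReal_ofNat]
          ring
  have hcm : ∀ i, AEMeasurable (fun ω => ‖X t ω i - X' t ω i‖ₑ ^ 2) P := fun i =>
    (((measurable_pi_apply i).comp_aemeasurable (h.meas t)).sub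
      ((measurable_pi_apply i).comp_aemeasurable (h'.meas t))).enorm.pow_const 2
  simp only [esq, Pi.sub_apply] at hcoord ⊢
  rw [lintegral_finsetSum' _ fun i _ => hcm i]
  refine (Finset.sum_le_sum fun i _ => hcoord i).trans ?_
  rw [Finset.sum_const, Finset.card_univ, Fintype.card_fin, nsmul_eq_mul,
    ENNReal.ofReal_mul (by positivity), ENNReal.ofReal_natCast]
  exact le_of_eq (mul_assoc _ _ _).symm

/-- Two approximate solutions with the same initial state are close in mean square if each is close
to the process in its coefficients. -/
theorem exists_isApproxSolution_bound [IsProbabilityMeasure P] (hW : IsBrownianWrt P 𝓕 W)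
    (F G : Matrix (Fin n) (Fin n) ℝ) (T : ℝ≥0) :
    ∃ K : ℝ≥0, ∀ (ξ : Ω → Fin n → ℝ) (X Y X' Y' : ℝ≥0 → Ω → Fin n → ℝ) (δ δ' : ℝ≥0∞),
      IsApproxSolution P 𝓕 W F G ξ X Y → IsApproxSolution P 𝓕 W F G ξ X' Y' →
      (∀ s ≤ T, ∫⁻ ω, esq (X s ω - Y s ω) ∂P ≤ δ) → (∀ s ≤ T, ∫⁻ ω, esq (X' s ω - Y' s ω) ∂P ≤ δ') →
      ∀ t ≤ T, ∫⁻ ω, esq (X t ω - X' t ω) ∂P ≤ K * (δ + δ') := by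
  set c : ℝ≥0 := (n * (18 * ‖G‖ ^ 2 + 2 * T * ‖F‖ ^ 2)).toNNReal with hc
  refine ⟨2 * (Real.exp ((2 * ((c * 3 : ℝ≥0) : ℝ) + 1) * T)).toNNReal * (c * (3 * T)), ?_⟩
  intro ξ X Y X' Y' δ δ' h h' hδ hδ' t ht
  set u : ℝ≥0 → ℝ≥0∞ := fun t => ∫⁻ ω, esq (X t ω - X' t ω) ∂P with hu
  set v : ℝ≥0 → ℝ≥0∞ := fun t => ∫⁻ ω, esq (Y t ω - Y' t ω) ∂P with hv
  have hstep : ∀ t ≤ T, u t ≤ c * ∫⁻ s in Set.Ioc (0 : ℝ) t, v s.toNNReal := by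
    intro t ht
    refine (h.lintegral_esq_sub_le hW h' t).trans ?_
    gcongr
    rw [hc]
    change ENNReal.ofReal _ ≤ ENNReal.ofReal _
    refine ENNReal.ofReal_le_ofReal ?_
    gcongr
  have hvfin : ∫⁻ s in Set.Ioc (0 : ℝ) T, v s.toNNReal < ∞ := by
    rw [hv, ← lintegral_esq_swap (Z := fun s ω => Y s ω - Y' s ω) (h.measY.sub h'.measY)]
    have m1 : Measurable fun ω => ∫⁻ s in Set.Ioc (0 : ℝ) T, esq (Y s.toNNReal ω) :=
      (measurable_esq.comp h.measY).lintegral_prod_left'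
    calc _ ≤ ∫⁻ ω, 2 * ((∫⁻ s in Set.Ioc (0 : ℝ) T, esq (Y s.toNNReal ω)) +
          ∫⁻ s in Set.Ioc (0 : ℝ) T, esq (Y' s.toNNReal ω)) ∂P := by
          refine lintegral_mono fun ω => ?_
          have m2 : Measurable fun s : ℝ => esq (Y s.toNNReal ω) :=
            measurable_esq.comp (h.measY.measurable_path ω)
          rw [← lintegral_add_left m2, ← lintegral_const_mul' _ _ (by simp)]
          exact lintegral_mono fun s => esq_sub_le _ _
      _ < ∞ := by
          rw [lintegral_const_mul' _ _ (by simp), lintegral_add_left m1]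
          exact ENNReal.mul_lt_top (by simp) (ENNReal.add_lt_top.2 ⟨h.sq T, h'.sq T⟩)
  have hvle : ∀ s ≤ T, v s ≤ 3 * (δ + δ' + u s) := by
    intro s hs
    have n1 : AEMeasurable (fun ω => esq (Y s ω - X s ω)) P :=
      measurable_esq.comp_aemeasurable ((h.measY.measurable_eval s).aemeasurable.sub (h.meas s))
    have n2 : AEMeasurable (fun ω => esq (X s ω - X' s ω)) P :=
      measurable_esq.comp_aemeasurable ((h.meas s).sub (h'.meas s))
    calc v s ≤ ∫⁻ ω, 3 * (esq (Y s ω - X s ω) + esq (X s ω - X' s ω) + esq (X' s ω - Y' s ω)) ∂P :=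
          lintegral_mono fun ω => esq_sub_le_three _ _ _ _
      _ = 3 * (∫⁻ ω, esq (Y s ω - X s ω) ∂P + u s + ∫⁻ ω, esq (X' s ω - Y' s ω) ∂P) := by
          rw [lintegral_const_mul' _ _ (by simp), lintegral_add_three n1 n2]
      _ ≤ 3 * (δ + u s + δ') := by
          gcongr
          · simp_rw [esq_sub_comm (Y s _)]
            exact hδ s hs
          · exact hδ' s hs
      _ = _ := by ring
  have hmain := gronwall_ennreal (T := T) (C := c * 3) (u := u) (ε := c * (3 * T) * (δ + δ'))
    (B := c * ∫⁻ s in Set.Ioc (0 : ℝ) T, v s.toNNReal)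
    (ENNReal.mul_lt_top (by simp) hvfin).ne
    (fun t ht => (hstep t ht).trans (by gcongr))
    (fun t ht => ?_) t ht
  · refine hmain.trans (le_of_eq ?_)
    push_cast
    rw [ENNReal.ofReal]
    ring
  · refine (hstep t ht).trans ?_
    calc _ ≤ c * ∫⁻ s in Set.Ioc (0 : ℝ) t, 3 * (δ + δ' + u s.toNNReal) := by
          gcongr 1
          refine setLIntegral_mono' measurableSet_Ioc fun s hs => ?_
          exact hvle _ ((Real.toNNReal_le_iff_le_coe.2 hs.2).trans ht)
      _ = c * (3 * ((δ + δ') * t + ∫⁻ s in Set.Ioc (0 : ℝ) t, u s.toNNReal)) := by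
          rw [lintegral_const_mul' _ _ (by simp), lintegral_add_left measurable_const,
            setLIntegral_const, Real.volume_Ioc, sub_zero, ENNReal.ofReal_coe_nnreal]
      _ ≤ c * (3 * ((δ + δ') * T + ∫⁻ s in Set.Ioc (0 : ℝ) t, u s.toNNReal)) := by gcongr
      _ = _ := by
          push_cast
          ring

end Compare

/-! ### The Euler scheme -/

section Euler

variable {Ω : Type*} {mΩ : MeasurableSpace Ω} {P : Measure Ω} {𝓕 : Filtration ℝ≥0 mΩ}
  {W : ℝ≥0 → Ω → ℝ} {n : ℕ}

/-- The Euler scheme of mesh `h` for `dX = F X dt + G X dW`, at the grid points `k * h`. -/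
noncomputable def euler (W : ℝ≥0 → Ω → ℝ) (F G : Matrix (Fin n) (Fin n) ℝ) (ξ : Ω → Fin n → ℝ)
    (h : ℝ≥0) : ℕ → Ω → Fin n → ℝ
  | 0 => ξ
  | k + 1 => fun ω => euler W F G ξ h k ω + (h : ℝ) • (F *ᵥ euler W F G ξ h k ω) +
      (W ((k + 1 : ℕ) * h) ω - W (k * h) ω) • (G *ᵥ euler W F G ξ h k ω)

/-- The index `k` of the mesh interval `(k h, (k + 1) h]` that contains `t` (and `0` for `t = 0`,
by truncated subtraction). -/
noncomputable def meshIndex (h t : ℝ≥0) : ℕ := ⌈t / h⌉₊ - 1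

/-- The step process of the Euler scheme, constant on the mesh intervals. -/
noncomputable def eulerStep (W : ℝ≥0 → Ω → ℝ) (F G : Matrix (Fin n) (Fin n) ℝ)
    (ξ : Ω → Fin n → ℝ) (h t : ℝ≥0) (ω : Ω) : Fin n → ℝ :=
  euler W F G ξ h (meshIndex h t) ω

/-- The interpolated Euler scheme. -/
noncomputable def eulerInterp (W : ℝ≥0 → Ω → ℝ) (F G : Matrix (Fin n) (Fin n) ℝ)
    (ξ : Ω → Fin n → ℝ) (h t : ℝ≥0) (ω : Ω) : Fin n → ℝ :=
  eulerStep W F G ξ h t ω + ((t : ℝ) - meshIndex h t * h) • (F *ᵥ eulerStep W F G ξ h t ω) +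
    (W t ω - W (meshIndex h t * h) ω) • (G *ᵥ eulerStep W F G ξ h t ω)

theorem meshIndex_eq {h : ℝ≥0} (hh : 0 < h) {t : ℝ≥0} {k : ℕ} (h1 : k * h < t)
    (h2 : t ≤ (k + 1 : ℕ) * h) : meshIndex h t = k := by
  have : ⌈t / h⌉₊ = k + 1 := by
    rw [Nat.ceil_eq_iff (by omega), lt_div_iff₀ hh, div_le_iff₀ hh]
    exact ⟨by simpa using h1, h2⟩
  simp [meshIndex, this]

theorem meshIndex_mono {h s t : ℝ≥0} (hst : s ≤ t) : meshIndex h s ≤ meshIndex h t := by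
  unfold meshIndex
  gcongr

theorem meshIndex_mul_lt {h : ℝ≥0} (hh : 0 < h) {t : ℝ≥0} (ht : 0 < t) : meshIndex h t * h < t := by
  have h0 : 0 < ⌈t / h⌉₊ := Nat.ceil_pos.2 (div_pos ht hh)
  have h1 : ((meshIndex h t : ℕ) : ℝ≥0) < t / h := by
    unfold meshIndex
    exact Nat.lt_ceil.1 (by omega)
  exact (lt_div_iff₀ hh).1 h1

theorem meshIndex_mul_le {h : ℝ≥0} (hh : 0 < h) (t : ℝ≥0) : meshIndex h t * h ≤ t := by
  rcases eq_zero_or_pos t with rfl | ht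
  · simp [meshIndex]
  · exact (meshIndex_mul_lt hh ht).le

theorem le_meshIndex_succ_mul {h : ℝ≥0} (hh : 0 < h) (t : ℝ≥0) :
    t ≤ (meshIndex h t + 1 : ℕ) * h := by
  rw [← div_le_iff₀ hh]
  refine (Nat.le_ceil _).trans ?_
  unfold meshIndex
  exact_mod_cast (by omega : ⌈t / h⌉₊ ≤ ⌈t / h⌉₊ - 1 + 1)

theorem euler_measurable (hW : IsBrownianWrt P 𝓕 W) (F G : Matrix (Fin n) (Fin n) ℝ)
    {ξ : Ω → Fin n → ℝ} (hξ : IsInitialState P 𝓕 ξ) (h : ℝ≥0) (k : ℕ) :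
    StronglyMeasurable[𝓕 (k * h)] (euler W F G ξ h k) := by
  induction k with
  | zero =>
    have h0 : ((0 : ℕ) : ℝ≥0) * h = 0 := by simp
    rw [h0]
    exact hξ.meas
  | succ k ih =>
    have hle : (k : ℝ≥0) * h ≤ (k + 1 : ℕ) * h := by gcongr; omega
    have h1 := ih.mono (𝓕.mono hle)
    have hmul : ∀ M : Matrix (Fin n) (Fin n) ℝ, StronglyMeasurable[𝓕 ((k + 1 : ℕ) * h)]
        fun ω => M *ᵥ euler W F G ξ h k ω := fun M =>
      (Continuous.matrix_mulVec continuous_const continuous_id).comp_stronglyMeasurable h1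
    exact (h1.add ((hmul F).const_smul (h : ℝ))).add
      ((hW.stronglyMeasurable_inc hle le_rfl).smul (hmul G))

theorem stronglyMeasurable_mulVec {k l : ℕ} {m : MeasurableSpace Ω} {x : Ω → Fin l → ℝ}
    (hx : StronglyMeasurable x) (M : Matrix (Fin k) (Fin l) ℝ) (i : Fin k) :
    StronglyMeasurable fun ω => (M *ᵥ x ω) i :=
  ((continuous_apply i).comp
    (Continuous.matrix_mulVec continuous_const continuous_id)).comp_stronglyMeasurable hx

theorem memLp_mulVec {k l : ℕ} {x : Ω → Fin l → ℝ} (hx : ∀ j, MemLp (fun ω => x ω j) 2 P)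
    (M : Matrix (Fin k) (Fin l) ℝ) (i : Fin k) : MemLp (fun ω => (M *ᵥ x ω) i) 2 P := by
  simp only [Matrix.mulVec, dotProduct]
  exact memLp_finsetSum _ fun j _ => (hx j).const_mul _

theorem IsInitialState.memLp_apply {ξ : Ω → Fin n → ℝ} (hξ : IsInitialState P 𝓕 ξ) (i : Fin n) :
    MemLp (fun ω => ξ ω i) 2 P := hξ.memLp.eval i

theorem grid_le (h : ℝ≥0) (k : ℕ) : (k : ℝ≥0) * h ≤ (k + 1 : ℕ) * h := by
  gcongr
  omega

theorem grid_sub (h : ℝ≥0) (k : ℕ) :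
    (((k + 1 : ℕ) * h : ℝ≥0) : ℝ) - ((k * h : ℝ≥0) : ℝ) = h := by
  push_cast
  ring

theorem euler_memLp (hW : IsBrownianWrt P 𝓕 W) (F G : Matrix (Fin n) (Fin n) ℝ)
    {ξ : Ω → Fin n → ℝ} (hξ : IsInitialState P 𝓕 ξ) (h : ℝ≥0) (k : ℕ) :
    ∀ i, MemLp (fun ω => euler W F G ξ h k ω i) 2 P := by
  induction k with
  | zero => exact hξ.memLp_apply
  | succ k ih =>
    intro i
    have h1 := (hW.memLp_mul_inc (grid_le h k)
      (stronglyMeasurable_mulVec (euler_measurable hW F G hξ h k) G i) (memLp_mulVec ih G i))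
    refine (((ih i).add ((memLp_mulVec ih F i).const_mul (h : ℝ))).add h1).congr_norm
      (by
        have := ((euler_measurable hW F G hξ h (k + 1)).mono (𝓕.le _))
        exact ((continuous_apply i).comp_stronglyMeasurable this).aestronglyMeasurable)
      (Eventually.of_forall fun ω => ?_)
    simp only [euler, Pi.add_apply, Pi.smul_apply, smul_eq_mul]
    congr 1
    ring

/-! ### The Euler scheme as an approximate solution -/

theorem euler_eq_sum (F G : Matrix (Fin n) (Fin n) ℝ) (ξ : Ω → Fin n → ℝ) (h : ℝ≥0) (k : ℕ)
    (ω : Ω) (i : Fin n) : euler W F G ξ h k ω i = ξ ω i +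
      (∑ j ∈ Finset.range k, (h : ℝ) * (F *ᵥ euler W F G ξ h j ω) i) +
      ∑ j ∈ Finset.range k, (G *ᵥ euler W F G ξ h j ω) i *
        (W ((j + 1 : ℕ) * h) ω - W (j * h) ω) := by
  induction k with
  | zero => simp [euler]
  | succ k ih =>
    rw [Finset.sum_range_succ, Finset.sum_range_succ]
    simp only [euler, Pi.add_apply, Pi.smul_apply, smul_eq_mul]
    rw [ih]
    ring

/-- On a mesh interval a function of the mesh index is constant. -/
theorem intervalIntegral_mesh {h : ℝ≥0} (hh : 0 < h) (f : ℕ → ℝ) (k : ℕ) {t : ℝ≥0}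
    (h1 : k * h ≤ t) (h2 : t ≤ (k + 1 : ℕ) * h) :
    IntervalIntegrable (fun s => f (meshIndex h s.toNNReal)) volume ((k * h : ℝ≥0) : ℝ) t ∧
    ∫ s in ((k * h : ℝ≥0) : ℝ)..t, f (meshIndex h s.toNNReal) = ((t : ℝ) - k * h) * f k := by
  have he : ∀ s ∈ Set.Ioc ((k * h : ℝ≥0) : ℝ) t, f (meshIndex h s.toNNReal) = f k := by
    intro s hs
    rw [meshIndex_eq hh (Real.lt_toNNReal_iff_coe_lt.2 hs.1)
      ((Real.toNNReal_le_iff_le_coe.2 hs.2).trans h2)]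
  have hle : ((k * h : ℝ≥0) : ℝ) ≤ t := h1
  constructor
  · rw [intervalIntegrable_iff_integrableOn_Ioc_of_le hle]
    exact (integrableOn_const (C := f k) (by simp)).congr_fun (fun s hs => (he s hs).symm)
      measurableSet_Ioc
  · rw [intervalIntegral.integral_of_le hle, setIntegral_congr_fun measurableSet_Ioc he,
      setIntegral_const, measureReal_def, Real.volume_Ioc,
      ENNReal.toReal_ofReal (sub_nonneg.2 hle), smul_eq_mul]
    push_cast
    rfl

theorem integral_mesh {h : ℝ≥0} (hh : 0 < h) (f : ℕ → ℝ) (t : ℝ≥0) :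
    ∫ s in (0 : ℝ)..t, f (meshIndex h s.toNNReal) =
      (∑ j ∈ Finset.range (meshIndex h t), (h : ℝ) * f j) +
        ((t : ℝ) - meshIndex h t * h) * f (meshIndex h t) := by
  set k := meshIndex h t with hk
  have hgrid : ∀ j : ℕ, IntervalIntegrable (fun s => f (meshIndex h s.toNNReal)) volume
      ((j * h : ℝ≥0) : ℝ) (((j + 1 : ℕ) * h : ℝ≥0) : ℝ) := fun j =>
    (intervalIntegral_mesh hh f j (grid_le h j) le_rfl).1
  have hlast := intervalIntegral_mesh hh f k (meshIndex_mul_le hh t) (le_meshIndex_succ_mul hh t)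
  have hsum := intervalIntegral.sum_integral_adjacent_intervals (a := fun j : ℕ =>
    ((j * h : ℝ≥0) : ℝ)) (n := k) fun j _ => hgrid j
  have hint : IntervalIntegrable (fun s => f (meshIndex h s.toNNReal)) volume
      ((0 : ℕ) * h : ℝ≥0) ((k * h : ℝ≥0) : ℝ) :=
    IntervalIntegrable.trans_iterate (a := fun j : ℕ => ((j * h : ℝ≥0) : ℝ)) fun j _ => hgrid j
  have h0 : (((0 : ℕ) * h : ℝ≥0) : ℝ) = 0 := by simp
  simp only [h0] at hsum
  rw [h0] at hint
  rw [← intervalIntegral.integral_add_adjacent_intervals hint hlast.1, hlast.2, ← hsum]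
  congr 1
  refine Finset.sum_congr rfl fun j _ => ?_
  rw [(intervalIntegral_mesh hh f j (grid_le h j) le_rfl).2]
  push_cast
  ring

/-- The coefficient `(G Y) i` of the Euler step process `Y` on `(0, t]`, as a simple process. -/
noncomputable def eulerSimple (hW : IsBrownianWrt P 𝓕 W) (F G : Matrix (Fin n) (Fin n) ℝ)
    {ξ : Ω → Fin n → ℝ} (hξ : IsInitialState P 𝓕 ξ) {h : ℝ≥0} (hh : 0 < h) (t : ℝ≥0) (i : Fin n) :
    SimpleProcess P 𝓕 where
  N := meshIndex h t + 1
  time j := min (j * h) t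
  mono j k hjk := by
    refine min_le_min_right _ ?_
    gcongr
  coef j := if j ≤ meshIndex h t then fun ω => (G *ᵥ euler W F G ξ h j ω) i else 0
  meas j := by
    split_ifs with hj
    · have : (j : ℝ≥0) * h ≤ t := (by gcongr : (j : ℝ≥0) * h ≤ meshIndex h t * h).trans
        (meshIndex_mul_le hh t)
      rw [min_eq_left this]
      exact stronglyMeasurable_mulVec (euler_measurable hW F G hξ h j) G i
    · exact stronglyMeasurable_zero
  memLp j := by
    split_ifs with hj
    · exact memLp_mulVec (euler_memLp hW F G hξ h j) G i
    · exact MemLp.zero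

theorem eulerSimple_value (hW : IsBrownianWrt P 𝓕 W) (F G : Matrix (Fin n) (Fin n) ℝ)
    {ξ : Ω → Fin n → ℝ} (hξ : IsInitialState P 𝓕 ξ) {h : ℝ≥0} (hh : 0 < h) {t s : ℝ≥0}
    (hs : 0 < s) (hst : s ≤ t) (i : Fin n) (ω : Ω) :
    (eulerSimple hW F G hξ hh t i).value s ω = (G *ᵥ eulerStep W F G ξ h s ω) i := by
  have hle : meshIndex h s ≤ meshIndex h t := meshIndex_mono hst
  unfold SimpleProcess.value
  rw [Finset.sum_eq_single (meshIndex h s)]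
  · rw [Set.indicator_of_mem]
    · simp [eulerSimple, hle, eulerStep]
    · refine ⟨min_lt_of_left_lt (meshIndex_mul_lt hh hs), le_min (le_meshIndex_succ_mul hh s) hst⟩
  · intro j _ hj
    refine Set.indicator_of_notMem (fun hm => hj ?_) _
    have h1 : (j : ℝ≥0) * h < s := by
      rcases min_lt_iff.1 hm.1 with h1 | h1
      · exact h1
      · exact absurd h1 (not_lt.2 hst)
    exact (meshIndex_eq hh h1 (le_min_iff.1 hm.2).1).symm
  · intro hj
    exact absurd (Finset.mem_range.2 (Nat.lt_succ_of_le hle)) hj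

theorem eulerSimple_integral (hW : IsBrownianWrt P 𝓕 W) (F G : Matrix (Fin n) (Fin n) ℝ)
    {ξ : Ω → Fin n → ℝ} (hξ : IsInitialState P 𝓕 ξ) {h : ℝ≥0} (hh : 0 < h) (t : ℝ≥0)
    (i : Fin n) (ω : Ω) :
    eulerInterp W F G ξ h t ω i - ξ ω i - ∫ s in (0 : ℝ)..t,
      (F *ᵥ eulerStep W F G ξ h s.toNNReal ω) i = (eulerSimple hW F G hξ hh t i).integral W ω := by
  have h1 := integral_mesh hh (fun j => (F *ᵥ euler W F G ξ h j ω) i) t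
  simp only [eulerStep] at *
  rw [h1]
  simp only [eulerInterp, eulerStep, Pi.add_apply, Pi.smul_apply, smul_eq_mul]
  rw [euler_eq_sum F G ξ h (meshIndex h t) ω i]
  have h2 : (eulerSimple hW F G hξ hh t i).integral W ω =
      (∑ j ∈ Finset.range (meshIndex h t), (G *ᵥ euler W F G ξ h j ω) i *
        (W ((j + 1 : ℕ) * h) ω - W (j * h) ω)) +
      (G *ᵥ euler W F G ξ h (meshIndex h t) ω) i * (W t ω - W (meshIndex h t * h) ω) := by
    have hk := meshIndex_mul_le hh t
    unfold SimpleProcess.integral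
    change ∑ j ∈ Finset.range (meshIndex h t + 1), _ = _
    rw [Finset.sum_range_succ]
    congr 1
    · refine Finset.sum_congr rfl fun j hj => ?_
      have hj' := Finset.mem_range.1 hj
      have e1 : ((j + 1 : ℕ) : ℝ≥0) * h ≤ t :=
        (by gcongr; omega : ((j + 1 : ℕ) : ℝ≥0) * h ≤ meshIndex h t * h).trans hk
      have e2 : (j : ℝ≥0) * h ≤ t := (grid_le h j).trans e1
      simp only [eulerSimple, hj'.le, if_true, min_eq_left e1, min_eq_left e2]
    · have e1 : min (((meshIndex h t + 1 : ℕ) : ℝ≥0) * h) t = t :=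
        min_eq_right (le_meshIndex_succ_mul hh t)
      simp only [eulerSimple, le_refl, if_true, e1, min_eq_left hk]
  rw [h2]
  ring

theorem measurable_meshIndex (h T : ℝ≥0) : Measurable fun s : Set.Iic T => meshIndex h (s : ℝ≥0) := by
  have hc : Measurable fun s : Set.Iic T => ⌈(s : ℝ≥0) / h⌉₊ :=
    Nat.measurable_ceil.comp (measurable_subtype_coe.div_const h)
  have hs : Measurable fun k : ℕ => k - 1 := measurable_from_nat
  exact hs.comp hc

theorem measurable_comp_index {S Ω : Type*} {mS : MeasurableSpace S} {m : MeasurableSpace Ω}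
    {x : ℕ → Ω → Fin n → ℝ} {f : S → ℕ} (hf : Measurable f)
    (hx : ∀ s, Measurable (x (f s))) : Measurable fun p : S × Ω => x (f p.1) p.2 := by
  classical
  have hg : Measurable fun p : ℕ × Ω => if p.1 ∈ Set.range f then x p.1 p.2 else 0 := by
    refine measurable_from_prod_countable_right fun j => ?_
    by_cases hj : j ∈ Set.range f
    · obtain ⟨s, rfl⟩ := hj
      simpa only [Set.mem_range_self, if_true] using hx s
    · simpa only [hj, if_false] using measurable_const
  have hp : Measurable fun p : S × Ω => (f p.1, p.2) :=
    (hf.comp measurable_fst).prodMk measurable_snd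
  have := hg.comp hp
  simpa only [Function.comp_def, Set.mem_range_self, if_true] using this

theorem eulerStep_progressive (hW : IsBrownianWrt P 𝓕 W) (F G : Matrix (Fin n) (Fin n) ℝ)
    {ξ : Ω → Fin n → ℝ} (hξ : IsInitialState P 𝓕 ξ) {h : ℝ≥0} (hh : 0 < h) :
    IsStronglyProgressive 𝓕 (eulerStep W F G ξ h) := by
  intro T
  exact (@measurable_comp_index n (Set.Iic T) Ω _ (𝓕 T) (euler W F G ξ h) _
    (measurable_meshIndex h T) fun s => ((euler_measurable hW F G hξ h _).mono
      (𝓕.mono ((meshIndex_mul_le hh _).trans s.2))).measurable).stronglyMeasurable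

theorem lintegral_esq_lt_top {x : Ω → Fin n → ℝ} (hx : ∀ i, MemLp (fun ω => x ω i) 2 P) :
    ∫⁻ ω, esq (x ω) ∂P < ∞ := by
  unfold esq
  rw [lintegral_finsetSum' _ fun i _ => (hx i).1.enorm.pow_const 2]
  refine ENNReal.sum_lt_top.2 fun i _ => ?_
  rw [lintegral_enorm_sq_eq (hx i)]
  exact ENNReal.ofReal_lt_top

/-- The interpolated Euler scheme solves the equation with its step process in the coefficients. -/
theorem isApproxSolution_euler [IsProbabilityMeasure P] (hW : IsBrownianWrt P 𝓕 W)
    (F G : Matrix (Fin n) (Fin n) ℝ) {ξ : Ω → Fin n → ℝ} (hξ : IsInitialState P 𝓕 ξ) {h : ℝ≥0}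
    (hh : 0 < h) :
    IsApproxSolution P 𝓕 W F G ξ (eulerInterp W F G ξ h) (eulerStep W F G ξ h) where
  meas t := by
    have h1 : Measurable (euler W F G ξ h (meshIndex h t)) :=
      ((euler_measurable hW F G hξ h (meshIndex h t)).mono (𝓕.le _)).measurable
    have h2 : ∀ s, Measurable (W s) := fun s => ((hW.adapted s).mono (𝓕.le s)).measurable
    have h3 : ∀ M : Matrix (Fin n) (Fin n) ℝ, Measurable fun ω =>
        M *ᵥ euler W F G ξ h (meshIndex h t) ω := fun M =>
      (Continuous.matrix_mulVec continuous_const continuous_id).measurable.comp h1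
    exact ((h1.add ((h3 F).const_smul ((t : ℝ) - meshIndex h t * h))).add
      (((h2 t).sub (h2 (meshIndex h t * h))).smul (h3 G))).aemeasurable
  measY := isMeasurableProcess_of_progressive (eulerStep_progressive hW F G hξ hh)
  sq T := by
    rw [lintegral_esq_swap
      (isMeasurableProcess_of_progressive (eulerStep_progressive hW F G hξ hh))]
    calc _ ≤ ∫⁻ _ in Set.Ioc (0 : ℝ) T, ∑ j ∈ Finset.range (meshIndex h T + 1),
          ∫⁻ ω, esq (euler W F G ξ h j ω) ∂P := by
          refine setLIntegral_mono' measurableSet_Ioc fun s hs => ?_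
          refine Finset.single_le_sum (f := fun j => ∫⁻ ω, esq (euler W F G ξ h j ω) ∂P)
            (fun _ _ => zero_le) (Finset.mem_range.2 (Nat.lt_succ_of_le (meshIndex_mono ?_)))
          exact Real.toNNReal_le_iff_le_coe.2 hs.2
      _ < ∞ := by
          rw [setLIntegral_const]
          refine ENNReal.mul_lt_top (ENNReal.sum_lt_top.2 fun j _ =>
            lintegral_esq_lt_top (euler_memLp hW F G hξ h j)) (by simp)
  equation t i := by
    have hI : (fun ω => eulerInterp W F G ξ h t ω i - ξ ω i - ∫ s in (0 : ℝ)..t,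
        (F *ᵥ eulerStep W F G ξ h s.toNNReal ω) i) =
        (eulerSimple hW F G hξ hh t i).integral W :=
      funext fun ω => eulerSimple_integral hW F G hξ hh t i ω
    rw [hI]
    refine ⟨(eulerSimple hW F G hξ hh t i).memLp_integral hW,
      fun _ => eulerSimple hW F G hξ hh t i, fun _ => min_le_right _ _, ?_, ?_⟩
    · refine tendsto_const_nhds.congr fun _ => ?_
      symm
      rw [lintegral_eq_zero_of_ae_eq_zero]
      refine Eventually.of_forall fun ω => ?_
      simp only [Pi.zero_apply]
      rw [setLIntegral_congr_fun measurableSet_Ioc (g := fun _ => 0), lintegral_zero]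
      intro s hs
      simp only
      rw [eulerSimple_value hW F G hξ hh (Real.toNNReal_pos.2 hs.1)
        (Real.toNNReal_le_iff_le_coe.2 hs.2), sub_self]
      simp
    · simp

end Euler

/-! ### The Lyapunov operator and the moments of the Euler scheme -/

/-- The topology of the Frobenius norm. It is the product topology, but not reducibly so; as a local
instance it makes the topology of matrices agree with their norm, so that the operators on spaces of
matrices form a normed algebra. -/
noncomputable abbrev frobTop (k l : ℕ) : TopologicalSpace (Matrix (Fin k) (Fin l) ℝ) :=
  (Matrix.frobeniusNormedAddCommGroup :
    NormedAddCommGroup (Matrix (Fin k) (Fin l) ℝ)).toMetricSpace.toPseudoMetricSpace.toUniformSpace.toTopologicalSpace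

section Lyap

attribute [local instance] frobTop

/-- The generator `M ↦ F M + M Fᵀ + G M Gᵀ` of the second moments of `dX = F X dt + G X dW`. -/
noncomputable def lyap {n : ℕ} (F G : Matrix (Fin n) (Fin n) ℝ) :
    Matrix (Fin n) (Fin n) ℝ →L[ℝ] Matrix (Fin n) (Fin n) ℝ :=
  LinearMap.toContinuousLinearMap
    { toFun := fun M => F * M + M * Fᵀ + G * M * Gᵀ
      map_add' := fun M N => by noncomm_ring
      map_smul' := fun c M => by simp [smul_add] }

/-- The congruence `M ↦ F M Fᵀ`. -/
noncomputable def congruence {n : ℕ} (F : Matrix (Fin n) (Fin n) ℝ) :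
    Matrix (Fin n) (Fin n) ℝ →L[ℝ] Matrix (Fin n) (Fin n) ℝ :=
  LinearMap.toContinuousLinearMap
    { toFun := fun M => F * M * Fᵀ
      map_add' := fun M N => by noncomm_ring
      map_smul' := fun c M => by simp }

theorem lyap_apply {n : ℕ} (F G M : Matrix (Fin n) (Fin n) ℝ) :
    lyap F G M = F * M + M * Fᵀ + G * M * Gᵀ := rfl

theorem congruence_apply {n : ℕ} (F M : Matrix (Fin n) (Fin n) ℝ) :
    congruence F M = F * M * Fᵀ := rfl

theorem pow_sub_pow_eq_sum {R : Type*} [Ring R] (a b : R) (k : ℕ) :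
    a ^ k - b ^ k = ∑ j ∈ Finset.range k, a ^ j * (a - b) * b ^ (k - 1 - j) := by
  induction k with
  | zero => simp
  | succ k ih =>
    have h : ∑ j ∈ Finset.range k, a ^ j * (a - b) * b ^ (k + 1 - 1 - j) = (a ^ k - b ^ k) * b := by
      rw [ih, Finset.sum_mul]
      refine Finset.sum_congr rfl fun j hj => ?_
      have := Finset.mem_range.1 hj
      rw [mul_assoc (a ^ j * (a - b)), ← pow_succ]
      congr 2
      omega
    rw [Finset.sum_range_succ, h, Nat.add_sub_cancel, Nat.sub_self, pow_zero, mul_one, pow_succ,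
      pow_succ]
    noncomm_ring

theorem exp_smul_pow {E : Type*} [NormedAddCommGroup E] [NormedSpace ℝ E] [CompleteSpace E]
    (L : E →L[ℝ] E) (s : ℝ) (j : ℕ) :
    NormedSpace.exp (s • L) ^ j = NormedSpace.exp ((j * s) • L) := by
  let _ : NormedAlgebra ℚ (E →L[ℝ] E) := NormedAlgebra.restrictScalars ℚ ℝ _
  rw [← NormedSpace.exp_nsmul, ← Nat.cast_smul_eq_nsmul ℝ, smul_smul]

theorem exp_add_smul {E : Type*} [NormedAddCommGroup E] [NormedSpace ℝ E] [CompleteSpace E]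
    (L : E →L[ℝ] E) (s t : ℝ) :
    NormedSpace.exp ((s + t) • L) = NormedSpace.exp (s • L) * NormedSpace.exp (t • L) := by
  let _ : NormedAlgebra ℚ (E →L[ℝ] E) := NormedAlgebra.restrictScalars ℚ ℝ _
  rw [add_smul, NormedSpace.exp_add_of_commute
    (((Commute.refl L).smul_left s).smul_right t)]

/-- Powers of one-step approximations of second order converge to the exponential. -/
theorem tendsto_step_pow {E : Type*} [NormedAddCommGroup E] [NormedSpace ℝ E] [CompleteSpace E]
    (L R : E →L[ℝ] E) {t : ℝ} (ht : 0 ≤ t) :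
    Tendsto (fun N : ℕ => (1 + (t / N) • L + (t / N) ^ 2 • R) ^ N) atTop
      (𝓝 (NormedSpace.exp (t • L))) := by
  set a : ℕ → E →L[ℝ] E := fun N => 1 + (t / N) • L + (t / N) ^ 2 • R with ha
  set b : ℕ → E →L[ℝ] E := fun N => NormedSpace.exp ((t / N) • L) with hb
  have hbpow : ∀ N j : ℕ, b N ^ j = NormedSpace.exp ((j * (t / N)) • L) :=
    fun N j => exp_smul_pow L _ j
  have hbN : ∀ᶠ N : ℕ in atTop, b N ^ N = NormedSpace.exp (t • L) := by
    filter_upwards [eventually_gt_atTop 0] with N hN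
    rw [hbpow]
    congr 2
    field_simp
  -- the powers of both are bounded
  obtain ⟨B, hB⟩ : ∃ B, ∀ s ∈ Set.Icc (0 : ℝ) t, ‖NormedSpace.exp (s • L)‖ ≤ B := by
    have hc : Continuous fun s : ℝ => NormedSpace.exp (s • L) :=
      (differentiable_exp_smul_const ℝ L).continuous
    exact isCompact_Icc.exists_bound_of_continuousOn hc.continuousOn
  set c : ℝ := t * ‖L‖ + t ^ 2 * ‖R‖ with hc
  have hc0 : 0 ≤ c := by positivity
  have hA : ∀ N j : ℕ, 0 < N → j ≤ N → ‖a N ^ j‖ ≤ Real.exp c := by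
    intro N j hN hj
    have hN' : (1 : ℝ) ≤ N := by exact_mod_cast hN
    have h1 : ‖a N‖ ≤ Real.exp (c / N) := by
      have e1 : ‖(1 : E →L[ℝ] E)‖ ≤ 1 := ContinuousLinearMap.norm_id_le
      calc ‖a N‖ ≤ ‖(1 : E →L[ℝ] E)‖ + ‖(t / N) • L‖ + ‖(t / N) ^ 2 • R‖ := norm_add₃_le
        _ ≤ 1 + (t / N) * ‖L‖ + (t ^ 2 / N) * ‖R‖ := by
            rw [norm_smul, norm_smul, Real.norm_of_nonneg (by positivity),
              Real.norm_of_nonneg (by positivity), div_pow]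
            gcongr
            nlinarith
        _ = c / N + 1 := by rw [hc]; ring
        _ ≤ _ := Real.add_one_le_exp _
    have h2 : ∀ j : ℕ, ‖a N ^ j‖ ≤ Real.exp (c / N) ^ j := by
      intro j
      induction j with
      | zero =>
        rw [pow_zero, pow_zero]
        exact ContinuousLinearMap.norm_id_le
      | succ j ih =>
        rw [pow_succ, pow_succ]
        exact (norm_mul_le _ _).trans (mul_le_mul ih h1 (norm_nonneg _) (by positivity))
    refine (h2 j).trans ?_
    rw [← Real.exp_nat_mul]
    refine Real.exp_le_exp.2 ?_
    have : (j : ℝ) ≤ N := by exact_mod_cast hj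
    calc (j : ℝ) * (c / N) ≤ N * (c / N) := by gcongr
      _ = c := by field_simp
  -- the error of one step is of smaller order than `1 / N`
  have herr : Tendsto (fun N : ℕ => (N : ℝ) * ‖a N - b N‖) atTop (𝓝 0) := by
    have hd : HasDerivAt (fun s : ℝ => NormedSpace.exp (s • L)) L 0 := by
      simpa using hasDerivAt_exp_smul_const (𝕂 := ℝ) L 0
    have h0 : HasDerivAt (fun s : ℝ => 1 + s • L + s ^ 2 • R - NormedSpace.exp (s • L)) 0 0 := by
      have h1 : HasDerivAt (fun s : ℝ => 1 + s • L + s ^ 2 • R)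
          (((1 : ℝ) • L) + ((2 : ℕ) * (0 : ℝ) ^ (2 - 1)) • R) 0 :=
        (((hasDerivAt_id (0 : ℝ)).smul_const L).const_add 1).add
          ((hasDerivAt_pow 2 (0 : ℝ)).smul_const R)
      have := h1.fun_sub hd
      simpa using this
    have hlim : Tendsto (fun N : ℕ => t / (N : ℝ)) atTop (𝓝 0) :=
      tendsto_const_div_atTop_nhds_zero_nat t
    have ho := (hasDerivAt_iff_isLittleO.1 h0).comp_tendsto hlim
    simp only [Function.comp_def, zero_smul, smul_zero, sub_zero, NormedSpace.exp_zero, add_zero,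
      ne_eq, OfNat.ofNat_ne_zero, not_false_eq_true, zero_pow, sub_self] at ho
    have ho2 := (ho.trans_isBigO (Asymptotics.isBigO_const_mul_self t (fun N : ℕ => ((N : ℝ))⁻¹)
      atTop)).norm_left
    rw [Asymptotics.isLittleO_iff_tendsto'] at ho2
    · refine ho2.congr fun N => ?_
      rw [div_inv_eq_mul, mul_comm]
    · filter_upwards [eventually_gt_atTop 0] with N hN h
      exact absurd (inv_eq_zero.1 h) (by positivity)
  have hdiff : Tendsto (fun N : ℕ => a N ^ N - b N ^ N) atTop (𝓝 0) := by
    refine squeeze_zero_norm' (a := fun N : ℕ => Real.exp c * B * ((N : ℝ) * ‖a N - b N‖)) ?_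
      (by simpa using herr.const_mul (Real.exp c * B))
    filter_upwards [eventually_gt_atTop 0] with N hN
    rw [pow_sub_pow_eq_sum]
    refine (norm_sum_le _ _).trans ?_
    have hterm : ∀ j ∈ Finset.range N, ‖a N ^ j * (a N - b N) * b N ^ (N - 1 - j)‖ ≤
        Real.exp c * ‖a N - b N‖ * B := by
      intro j hj
      have hj' := Finset.mem_range.1 hj
      refine (norm_mul_le _ _).trans (mul_le_mul ((norm_mul_le _ _).trans
        (mul_le_mul_of_nonneg_right (hA N j hN hj'.le) (norm_nonneg _))) ?_ (norm_nonneg _)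
        (by positivity))
      rw [hbpow]
      refine hB _ ⟨by positivity, ?_⟩
      have h1 : ((N - 1 - j : ℕ) : ℝ) ≤ N := by exact_mod_cast (by omega : N - 1 - j ≤ N)
      calc ((N - 1 - j : ℕ) : ℝ) * (t / N) ≤ N * (t / N) := by gcongr
        _ = t := by field_simp
    refine (Finset.sum_le_sum hterm).trans (le_of_eq ?_)
    rw [Finset.sum_const, Finset.card_range, nsmul_eq_mul]
    ring
  have := hdiff.add (tendsto_const_nhds.congr' (hbN.mono fun N h => h.symm))
  simpa using this

variable {Ω : Type*} {mΩ : MeasurableSpace Ω} {P : Measure Ω} {𝓕 : Filtration ℝ≥0 mΩ}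
  {W : ℝ≥0 → Ω → ℝ} {n : ℕ}

/-- The matrix `E[x yᵀ]` of mixed second moments. -/
noncomputable def crossMoment (P : Measure Ω) (x y : Ω → Fin n → ℝ) : Matrix (Fin n) (Fin n) ℝ :=
  Matrix.of fun i j => ∫ ω, x ω i * y ω j ∂P

theorem crossMoment_apply (x y : Ω → Fin n → ℝ) (i j : Fin n) :
    crossMoment P x y i j = ∫ ω, x ω i * y ω j ∂P := rfl

theorem crossMoment_mulVec {x y : Ω → Fin n → ℝ} (hx : ∀ i, MemLp (fun ω => x ω i) 2 P)
    (hy : ∀ i, MemLp (fun ω => y ω i) 2 P) (A B : Matrix (Fin n) (Fin n) ℝ) :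
    crossMoment P (fun ω => A *ᵥ x ω) (fun ω => B *ᵥ y ω) = A * crossMoment P x y * Bᵀ := by
  ext i j
  have hi : ∀ k l, Integrable (fun ω => A i k * x ω k * (B j l * y ω l)) P := fun k l =>
    ((hx k).const_mul (A i k)).integrable_mul ((hy l).const_mul (B j l))
  have e : ∀ ω, (A *ᵥ x ω) i * (B *ᵥ y ω) j =
      ∑ k, ∑ l, A i k * x ω k * (B j l * y ω l) := fun ω => by
    simp only [Matrix.mulVec, dotProduct, Finset.sum_mul_sum]
  rw [crossMoment_apply, Matrix.mul_apply, integral_congr_ae (Eventually.of_forall e)]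
  simp only [Matrix.mul_apply, Matrix.transpose_apply, crossMoment_apply, Finset.sum_mul]
  rw [integral_finsetSum _ fun k _ => integrable_finsetSum _ fun l _ => hi k l, Finset.sum_comm]
  refine Finset.sum_congr rfl fun k _ => ?_
  rw [integral_finsetSum _ fun l _ => hi k l]
  refine Finset.sum_congr rfl fun l _ => ?_
  rw [← integral_const_mul, ← integral_mul_const]
  exact integral_congr_ae (Eventually.of_forall fun ω => by ring)

theorem integral_add_four {α : Type*} {m : MeasurableSpace α} {μ : Measure α} {f g h k : α → ℝ}
    (hf : Integrable f μ) (hg : Integrable g μ) (hh : Integrable h μ) (hk : Integrable k μ) :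
    ∫ x, (f x + g x + h x + k x) ∂μ =
      ∫ x, f x ∂μ + ∫ x, g x ∂μ + ∫ x, h x ∂μ + ∫ x, k x ∂μ := by
  rw [integral_add (f := fun x => f x + g x + h x) ((hf.add hg).add hh) hk,
    integral_add (f := fun x => f x + g x) (hf.add hg) hh, integral_add hf hg]

/-- One Euler step acts on the mixed second moments by `1 + h ℒ + h² (F · Fᵀ)`: the terms that are
linear in the Brownian increment have mean zero, and its square has mean `h`. -/
theorem crossMoment_euler_succ (hW : IsBrownianWrt P 𝓕 W) (F G : Matrix (Fin n) (Fin n) ℝ)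
    {ξ η : Ω → Fin n → ℝ} (hξ : IsInitialState P 𝓕 ξ) (hη : IsInitialState P 𝓕 η) (h : ℝ≥0)
    (k : ℕ) :
    crossMoment P (euler W F G ξ h (k + 1)) (euler W F G η h (k + 1)) =
      (1 + (h : ℝ) • lyap F G + (h : ℝ) ^ 2 • congruence F)
        (crossMoment P (euler W F G ξ h k) (euler W F G η h k)) := by
  have hx := euler_memLp hW F G hξ h k
  have hy := euler_memLp hW F G hη h k
  have mx := euler_measurable hW F G hξ h k
  have my := euler_measurable hW F G hη h k
  set x := euler W F G ξ h k
  set y := euler W F G η h k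
  set M := crossMoment P x y with hM
  have hle := grid_le h k
  have hstep : crossMoment P (euler W F G ξ h (k + 1)) (euler W F G η h (k + 1)) =
      crossMoment P (fun ω => (1 + (h : ℝ) • F) *ᵥ x ω) (fun ω => (1 + (h : ℝ) • F) *ᵥ y ω) +
        (h : ℝ) • crossMoment P (fun ω => G *ᵥ x ω) (fun ω => G *ᵥ y ω) := by
    ext i j
    set A := (1 + (h : ℝ) • F) with hA
    have a1 := memLp_mulVec hx A i
    have a2 := memLp_mulVec hy A j
    have m1 := stronglyMeasurable_mulVec mx A i
    have m2 := stronglyMeasurable_mulVec my A j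
    have g1 := stronglyMeasurable_mulVec mx G i
    have g2 := stronglyMeasurable_mulVec my G j
    have l1 := memLp_mulVec hx G i
    have l2 := memLp_mulVec hy G j
    have d1 := hW.memLp_mul_inc hle g1 l1
    have d2 := hW.memLp_mul_inc hle g2 l2
    have e : ∀ (z : Ω → Fin n → ℝ) (ω : Ω) (i : Fin n),
        (z ω + (h : ℝ) • (F *ᵥ z ω)) i = (A *ᵥ z ω) i := by
      intro z ω i
      rw [hA, Matrix.add_mulVec, Matrix.one_mulVec, Matrix.smul_mulVec]
    simp only [crossMoment_apply, Matrix.add_apply, Matrix.smul_apply, smul_eq_mul]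
    calc _ = ∫ ω, ((A *ᵥ x ω) i * (A *ᵥ y ω) j +
          (A *ᵥ x ω) i * ((G *ᵥ y ω) j * (W ((k + 1 : ℕ) * h) ω - W (k * h) ω)) +
          (G *ᵥ x ω) i * (W ((k + 1 : ℕ) * h) ω - W (k * h) ω) * (A *ᵥ y ω) j +
          (G *ᵥ x ω) i * (W ((k + 1 : ℕ) * h) ω - W (k * h) ω) *
            ((G *ᵥ y ω) j * (W ((k + 1 : ℕ) * h) ω - W (k * h) ω))) ∂P := by
          refine integral_congr_ae (Eventually.of_forall fun ω => ?_)
          have ex := e x ω i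
          have ey := e y ω j
          simp only [Pi.add_apply, Pi.smul_apply, smul_eq_mul] at ex ey
          simp only [euler, Pi.add_apply, Pi.smul_apply, smul_eq_mul]
          change (x ω i + h * (F *ᵥ x ω) i + _ * (G *ᵥ x ω) i) *
            (y ω j + h * (F *ᵥ y ω) j + _ * (G *ᵥ y ω) j) = _
          rw [ex, ey]
          ring
      _ = _ := by
          have z1 : ∫ ω, (A *ᵥ x ω) i * ((G *ᵥ y ω) j *
              (W ((k + 1 : ℕ) * h) ω - W (k * h) ω)) ∂P = 0 := by
            rw [← hW.integral_mul_inc hle (Z := fun ω => (A *ᵥ x ω) i * (G *ᵥ y ω) j) (m1.mul g2)]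
            exact integral_congr_ae (Eventually.of_forall fun ω => by ring)
          have z2 : ∫ ω, (G *ᵥ x ω) i * (W ((k + 1 : ℕ) * h) ω - W (k * h) ω) *
              (A *ᵥ y ω) j ∂P = 0 := by
            rw [← hW.integral_mul_inc hle (Z := fun ω => (G *ᵥ x ω) i * (A *ᵥ y ω) j) (g1.mul m2)]
            exact integral_congr_ae (Eventually.of_forall fun ω => by ring)
          have i1 : Integrable (fun ω => (A *ᵥ x ω) i * (A *ᵥ y ω) j) P := a1.integrable_mul a2
          have i2 : Integrable (fun ω => (A *ᵥ x ω) i * ((G *ᵥ y ω) j *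
              (W ((k + 1 : ℕ) * h) ω - W (k * h) ω))) P := a1.integrable_mul d2
          have i3 : Integrable (fun ω => (G *ᵥ x ω) i * (W ((k + 1 : ℕ) * h) ω - W (k * h) ω) *
              (A *ᵥ y ω) j) P := d1.integrable_mul a2
          have i4 : Integrable (fun ω => (G *ᵥ x ω) i * (W ((k + 1 : ℕ) * h) ω - W (k * h) ω) *
              ((G *ᵥ y ω) j * (W ((k + 1 : ℕ) * h) ω - W (k * h) ω))) P := d1.integrable_mul d2
          rw [integral_add_four i1 i2 i3 i4, z1, z2,
            hW.integral_mul_inc_mul_inc_same hle hle g1 l1 g2 l2, min_self, grid_sub]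
          ring
  rw [hstep, crossMoment_mulVec hx hy, crossMoment_mulVec hx hy]
  simp only [_root_.add_apply, _root_.smul_apply,
    one_apply_eq_self, lyap_apply, congruence_apply, Matrix.transpose_add,
    Matrix.transpose_one, Matrix.transpose_smul]
  simp only [add_mul, mul_add, one_mul, mul_one, smul_mul_assoc, mul_smul_comm, smul_add,
    smul_smul, sq]
  abel

theorem crossMoment_euler (hW : IsBrownianWrt P 𝓕 W) (F G : Matrix (Fin n) (Fin n) ℝ)
    {ξ η : Ω → Fin n → ℝ} (hξ : IsInitialState P 𝓕 ξ) (hη : IsInitialState P 𝓕 η) (h : ℝ≥0)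
    (k : ℕ) :
    crossMoment P (euler W F G ξ h k) (euler W F G η h k) =
      ((1 + (h : ℝ) • lyap F G + (h : ℝ) ^ 2 • congruence F) ^ k) (crossMoment P ξ η) := by
  induction k with
  | zero => simp [euler]
  | succ k ih =>
    rw [crossMoment_euler_succ hW F G hξ hη, ih,
      pow_succ' (1 + (h : ℝ) • lyap F G + (h : ℝ) ^ 2 • congruence F)]
    rfl

theorem abs_apply_le_norm {k l : ℕ} (M : Matrix (Fin k) (Fin l) ℝ) (i : Fin k) (j : Fin l) :
    |M i j| ≤ ‖M‖ := by
  refine abs_le_of_sq_le_sq ?_ (norm_nonneg _)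
  rw [frobenius_norm_sq]
  exact (Finset.single_le_sum (f := fun j => M i j ^ 2) (fun j _ => sq_nonneg _)
    (Finset.mem_univ j)).trans (Finset.single_le_sum (f := fun i => ∑ j, M i j ^ 2)
      (fun i _ => Finset.sum_nonneg fun j _ => sq_nonneg _) (Finset.mem_univ i))

theorem lintegral_esq_eq_trace {x : Ω → Fin n → ℝ} (hx : ∀ i, MemLp (fun ω => x ω i) 2 P) :
    ∫⁻ ω, esq (x ω) ∂P = ENNReal.ofReal (crossMoment P x x).trace := by
  unfold esq
  rw [lintegral_finsetSum' _ fun i _ => (hx i).1.enorm.pow_const 2, Matrix.trace,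
    ENNReal.ofReal_sum_of_nonneg]
  · refine Finset.sum_congr rfl fun i _ => ?_
    rw [lintegral_enorm_sq_eq (hx i)]
    simp [crossMoment_apply, sq]
  · intro i _
    exact integral_nonneg fun ω => mul_self_nonneg _

/-- The Euler schemes of mesh at most `1` are bounded in mean square on bounded time intervals. -/
theorem exists_euler_bound (hW : IsBrownianWrt P 𝓕 W) (F G : Matrix (Fin n) (Fin n) ℝ)
    {ξ : Ω → Fin n → ℝ} (hξ : IsInitialState P 𝓕 ξ) (T : ℝ≥0) :
    ∃ C : ℝ≥0, ∀ (h : ℝ≥0) (k : ℕ), h ≤ 1 → k * h ≤ T →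
      ∫⁻ ω, esq (euler W F G ξ h k ω) ∂P ≤ C := by
  set c : ℝ := ‖lyap F G‖ + ‖congruence F‖ with hc
  refine ⟨(n * (Real.exp (T * c) * ‖crossMoment P ξ ξ‖)).toNNReal, fun h k hh hk => ?_⟩
  rw [lintegral_esq_eq_trace (euler_memLp hW F G hξ h k)]
  refine ENNReal.ofReal_le_ofReal ?_
  set S := (1 + (h : ℝ) • lyap F G + (h : ℝ) ^ 2 • congruence F) with hS
  have h1 : ‖S‖ ≤ Real.exp (h * c) := by
    have e1 : ‖(1 : Matrix (Fin n) (Fin n) ℝ →L[ℝ] Matrix (Fin n) (Fin n) ℝ)‖ ≤ 1 :=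
      ContinuousLinearMap.norm_id_le
    have hh' : (h : ℝ) ≤ 1 := hh
    calc ‖S‖ ≤ ‖(1 : Matrix (Fin n) (Fin n) ℝ →L[ℝ] Matrix (Fin n) (Fin n) ℝ)‖ +
          ‖(h : ℝ) • lyap F G‖ + ‖(h : ℝ) ^ 2 • congruence F‖ := norm_add₃_le
      _ ≤ 1 + h * ‖lyap F G‖ + h * ‖congruence F‖ := by
          rw [norm_smul, norm_smul, Real.norm_of_nonneg (by positivity),
            Real.norm_of_nonneg (by positivity)]
          gcongr
          nlinarith [h.coe_nonneg]
      _ = h * c + 1 := by rw [hc]; ring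
      _ ≤ _ := Real.add_one_le_exp _
  have h2 : ‖(S ^ k) (crossMoment P ξ ξ)‖ ≤ Real.exp (T * c) * ‖crossMoment P ξ ξ‖ := by
    have : ∀ k : ℕ, ‖(S ^ k) (crossMoment P ξ ξ)‖ ≤
        Real.exp (h * c) ^ k * ‖crossMoment P ξ ξ‖ := by
      intro k
      induction k with
      | zero => simp
      | succ k ih =>
        rw [pow_succ' S, pow_succ' (Real.exp _)]
        calc _ ≤ ‖S‖ * ‖(S ^ k) (crossMoment P ξ ξ)‖ := S.le_opNorm _
          _ ≤ Real.exp (h * c) * (Real.exp (h * c) ^ k * ‖crossMoment P ξ ξ‖) := by gcongr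
          _ = _ := by ring
    refine (this k).trans ?_
    rw [← Real.exp_nat_mul, ← mul_assoc]
    have hk' : (k : ℝ) * h ≤ T := by exact_mod_cast hk
    gcongr
  rw [crossMoment_euler hW F G hξ hξ]
  calc _ ≤ ∑ _i : Fin n, ‖(S ^ k) (crossMoment P ξ ξ)‖ :=
        Finset.sum_le_sum fun i _ => (le_abs_self _).trans (abs_apply_le_norm _ i i)
    _ = n * ‖(S ^ k) (crossMoment P ξ ξ)‖ := by simp
    _ ≤ _ := by gcongr

/-- The interpolated Euler scheme differs from the step process by `O(√h)` in mean square. -/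
theorem exists_eulerInterp_sub_le (hW : IsBrownianWrt P 𝓕 W) (F G : Matrix (Fin n) (Fin n) ℝ)
    {ξ : Ω → Fin n → ℝ} (hξ : IsInitialState P 𝓕 ξ) (T : ℝ≥0) :
    ∃ C : ℝ≥0, ∀ h : ℝ≥0, 0 < h → h ≤ 1 → ∀ s ≤ T,
      ∫⁻ ω, esq (eulerInterp W F G ξ h s ω - eulerStep W F G ξ h s ω) ∂P ≤ C * h := by
  obtain ⟨C, hC⟩ := exists_euler_bound hW F G hξ T
  refine ⟨n * (2 * ((‖F‖₊ ^ 2 + ‖G‖₊ ^ 2) * C)), fun h hh hh1 s hs => ?_⟩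
  set k := meshIndex h s with hk
  have hks : (k : ℝ≥0) * h ≤ s := meshIndex_mul_le hh s
  have hx := euler_memLp hW F G hξ h k
  have mx := euler_measurable hW F G hξ h k
  have hb := hC h k hh1 (hks.trans hs)
  have hle : (s : ℝ) - k * h ≤ h := by
    have := le_meshIndex_succ_mul hh s
    rw [← hk] at this
    have h' : (s : ℝ) ≤ (k + 1 : ℕ) * h := by exact_mod_cast this
    push_cast at h'
    linarith
  have hge : 0 ≤ (s : ℝ) - k * h := by
    have h' : ((k : ℝ≥0) * h : ℝ) ≤ s := by exact_mod_cast hks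
    simpa using h'
  have hsq : ∀ (M : Matrix (Fin n) (Fin n) ℝ) (i : Fin n),
      ∫⁻ ω, ‖(M *ᵥ euler W F G ξ h k ω) i‖ₑ ^ 2 ∂P ≤ ENNReal.ofReal (‖M‖ ^ 2) * C := by
    intro M i
    calc _ ≤ ∫⁻ ω, ENNReal.ofReal (‖M‖ ^ 2) * esq (euler W F G ξ h k ω) ∂P :=
          lintegral_mono fun ω => enorm_mulVec_sq_le M _ i
      _ ≤ _ := by
          rw [lintegral_const_mul' _ _ ENNReal.ofReal_ne_top]
          gcongr
  have hcoord : ∀ i, ∫⁻ ω, ‖(eulerInterp W F G ξ h s ω - eulerStep W F G ξ h s ω) i‖ₑ ^ 2 ∂P ≤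
      2 * ((ENNReal.ofReal (‖F‖ ^ 2) + ENNReal.ofReal (‖G‖ ^ 2)) * C) * h := by
    intro i
    have l1 := memLp_mulVec hx F i
    have l2 := memLp_mulVec hx G i
    have g2 := stronglyMeasurable_mulVec mx G i
    have d2 := hW.memLp_mul_inc hks g2 l2
    have hdrift : ∫⁻ ω, ‖((s : ℝ) - k * h) * (F *ᵥ euler W F G ξ h k ω) i‖ₑ ^ 2 ∂P ≤
        h * (ENNReal.ofReal (‖F‖ ^ 2) * C) := by
      calc _ ≤ ∫⁻ ω, h * ‖(F *ᵥ euler W F G ξ h k ω) i‖ₑ ^ 2 ∂P := by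
            refine lintegral_mono fun ω => ?_
            rw [enorm_mul, mul_pow]
            gcongr
            rw [enorm_sq_eq_ofReal, ← ENNReal.ofReal_coe_nnreal]
            refine ENNReal.ofReal_le_ofReal ?_
            have : (h : ℝ) ≤ 1 := hh1
            nlinarith
        _ ≤ _ := by
            rw [lintegral_const_mul' _ _ (by simp)]
            gcongr
            exact hsq F i
    have hnoise : ∫⁻ ω, ‖(G *ᵥ euler W F G ξ h k ω) i * (W s ω - W (k * h) ω)‖ₑ ^ 2 ∂P ≤
        h * (ENNReal.ofReal (‖G‖ ^ 2) * C) := by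
      have e : ∫ ω, ((G *ᵥ euler W F G ξ h k ω) i * (W s ω - W (k * h) ω)) ^ 2 ∂P =
          ((s : ℝ) - k * h) * ∫ ω, ((G *ᵥ euler W F G ξ h k ω) i) ^ 2 ∂P := by
        have := hW.integral_mul_inc_mul_inc_same hks hks g2 l2 g2 l2
        simp only [← sq, min_self] at this
        rw [this, mul_comm]
        push_cast
        rfl
      rw [lintegral_enorm_sq_eq d2, e, ENNReal.ofReal_mul hge, ← lintegral_enorm_sq_eq l2]
      gcongr
      · rw [← ENNReal.ofReal_coe_nnreal]
        exact ENNReal.ofReal_le_ofReal hle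
      · exact hsq G i
    have m1 : AEMeasurable
        (fun ω => ‖((s : ℝ) - k * h) * (F *ᵥ euler W F G ξ h k ω) i‖ₑ ^ 2) P :=
      (l1.1.const_mul _).enorm.pow_const 2
    calc _ ≤ ∫⁻ ω, 2 * (‖((s : ℝ) - k * h) * (F *ᵥ euler W F G ξ h k ω) i‖ₑ ^ 2 +
          ‖(G *ᵥ euler W F G ξ h k ω) i * (W s ω - W (k * h) ω)‖ₑ ^ 2) ∂P := by
          refine lintegral_mono fun ω => ?_
          refine le_trans (le_of_eq ?_) (enorm_add_sq_le_two _ _)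
          congr 2
          simp only [eulerInterp, eulerStep, Pi.sub_apply, Pi.add_apply, Pi.smul_apply,
            smul_eq_mul]
          ring
      _ ≤ 2 * (h * (ENNReal.ofReal (‖F‖ ^ 2) * C) + h * (ENNReal.ofReal (‖G‖ ^ 2) * C)) := by
          rw [lintegral_const_mul' _ _ (by simp), lintegral_add_left' m1]
          gcongr
      _ = _ := by ring
  have hm : ∀ i, AEMeasurable
      (fun ω => ‖(eulerInterp W F G ξ h s ω - eulerStep W F G ξ h s ω) i‖ₑ ^ 2) P := by
    intro i
    have : (fun ω => (eulerInterp W F G ξ h s ω - eulerStep W F G ξ h s ω) i) = fun ω =>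
        ((s : ℝ) - k * h) * (F *ᵥ euler W F G ξ h k ω) i +
          (G *ᵥ euler W F G ξ h k ω) i * (W s ω - W (k * h) ω) := by
      funext ω
      simp only [eulerInterp, eulerStep, Pi.sub_apply, Pi.add_apply, Pi.smul_apply, smul_eq_mul]
      ring
    have hmm : AEStronglyMeasurable
        (fun ω => (eulerInterp W F G ξ h s ω - eulerStep W F G ξ h s ω) i) P := by
      rw [this]
      exact ((memLp_mulVec hx F i).1.const_mul _).add (hW.memLp_mul_inc hks
        (stronglyMeasurable_mulVec mx G i) (memLp_mulVec hx G i)).1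
    exact hmm.enorm.pow_const 2
  simp only [esq]
  rw [lintegral_finsetSum' _ fun i _ => hm i]
  refine (Finset.sum_le_sum fun i _ => hcoord i).trans (le_of_eq ?_)
  rw [Finset.sum_const, Finset.card_univ, Fintype.card_fin, nsmul_eq_mul]
  push_cast
  rw [ENNReal.ofReal_pow (norm_nonneg _), ENNReal.ofReal_pow (norm_nonneg _), ofReal_norm,
    ofReal_norm]
  simp only [enorm_eq_nnnorm]
  ring

end Lyap

section Solutions

attribute [local instance] frobTop

variable {Ω : Type*} {mΩ : MeasurableSpace Ω} {P : Measure Ω} {𝓕 : Filtration ℝ≥0 mΩ}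
  {W : ℝ≥0 → Ω → ℝ} {n : ℕ}

/-! ### Existence of solutions -/

/-- The step processes of two Euler schemes are close. -/
theorem exists_eulerStep_sub_le [IsProbabilityMeasure P] (hW : IsBrownianWrt P 𝓕 W)
    (F G : Matrix (Fin n) (Fin n) ℝ) {ξ : Ω → Fin n → ℝ} (hξ : IsInitialState P 𝓕 ξ) (T : ℝ≥0) :
    ∃ C : ℝ≥0, ∀ h h' : ℝ≥0, 0 < h → h ≤ 1 → 0 < h' → h' ≤ 1 → ∀ s ≤ T,
      ∫⁻ ω, esq (eulerStep W F G ξ h s ω - eulerStep W F G ξ h' s ω) ∂P ≤ C * (h + h') := by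
  obtain ⟨C, hC⟩ := exists_eulerInterp_sub_le hW F G hξ T
  obtain ⟨K, hK⟩ := exists_isApproxSolution_bound hW F G T
  refine ⟨3 * (C + K * C), fun h h' hh hh1 hh' hh1' s hs => ?_⟩
  have a := isApproxSolution_euler hW F G hξ hh
  have a' := isApproxSolution_euler hW F G hξ hh'
  have h1 := hK ξ _ _ _ _ _ _ a a' (hC h hh hh1) (hC h' hh' hh1') s hs
  have m1 : AEMeasurable (fun ω => esq (eulerStep W F G ξ h s ω - eulerInterp W F G ξ h s ω)) P :=
    measurable_esq.comp_aemeasurable ((a.measY.measurable_eval s).aemeasurable.sub (a.meas s))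
  have m2 : AEMeasurable
      (fun ω => esq (eulerInterp W F G ξ h s ω - eulerInterp W F G ξ h' s ω)) P :=
    measurable_esq.comp_aemeasurable ((a.meas s).sub (a'.meas s))
  calc _ ≤ ∫⁻ ω, 3 * (esq (eulerStep W F G ξ h s ω - eulerInterp W F G ξ h s ω) +
        esq (eulerInterp W F G ξ h s ω - eulerInterp W F G ξ h' s ω) +
        esq (eulerInterp W F G ξ h' s ω - eulerStep W F G ξ h' s ω)) ∂P :=
        lintegral_mono fun ω => esq_sub_le_three _ _ _ _
    _ ≤ 3 * (C * h + K * (C * h + C * h') + C * h') := by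
        rw [lintegral_const_mul' _ _ (by simp), lintegral_add_three m1 m2]
        gcongr
        · simp_rw [esq_sub_comm (eulerStep W F G ξ h s _)]
          exact hC h hh hh1 s hs
        · exact hC h' hh' hh1' s hs
    _ = _ := by
        push_cast
        ring

/-- The meshes along which the Euler schemes converge almost surely. -/
noncomputable def mesh (k : ℕ) : ℝ≥0 := (1 / 4) ^ k

theorem mesh_pos (k : ℕ) : 0 < mesh k := by unfold mesh; positivity

theorem mesh_le_one (k : ℕ) : mesh k ≤ 1 := pow_le_one₀ (by positivity) (by
  rw [div_le_one (by norm_num)]; norm_num)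

theorem mesh_anti {k l : ℕ} (h : k ≤ l) : mesh l ≤ mesh k :=
  pow_le_pow_of_le_one (by positivity) (by rw [div_le_one (by norm_num)]; norm_num) h

theorem tendsto_mesh : Tendsto (fun k => (mesh k : ℝ≥0∞)) atTop (𝓝 0) := by
  rw [← ENNReal.coe_zero, ENNReal.tendsto_coe]
  exact tendsto_pow_atTop_nhds_zero_of_lt_one (by positivity)
    (by rw [div_lt_one (by norm_num)]; norm_num)

theorem memLp_two_of_lintegral_sq_lt_top {f : Ω → ℝ} (hf : AEStronglyMeasurable f P)
    (h : ∫⁻ ω, ‖f ω‖ₑ ^ 2 ∂P < ∞) : MemLp f 2 P := by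
  refine ⟨hf, ?_⟩
  rw [eLpNorm_lt_top_iff_lintegral_rpow_enorm_lt_top (by simp) (by simp)]
  simpa using h

/-- The pointwise limit of the Euler step processes along the meshes `4⁻ᵏ`, with a junk value where
there is none. Being a pointwise limit it is progressive without completeness of the filtration. -/
noncomputable def eulerLimit (W : ℝ≥0 → Ω → ℝ) (F G : Matrix (Fin n) (Fin n) ℝ)
    (ξ : Ω → Fin n → ℝ) (t : ℝ≥0) (ω : Ω) : Fin n → ℝ :=
  limUnder atTop fun k => eulerStep W F G ξ (mesh k) t ω

theorem stronglyMeasurable_limUnder {α : Type*} {m : MeasurableSpace α} {f : ℕ → α → Fin n → ℝ}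
    (hf : ∀ k, StronglyMeasurable (f k)) :
    StronglyMeasurable fun a => limUnder atTop fun k => f k a :=
  StronglyMeasurable.limUnder hf

theorem eulerLimit_progressive (hW : IsBrownianWrt P 𝓕 W) (F G : Matrix (Fin n) (Fin n) ℝ)
    {ξ : Ω → Fin n → ℝ} (hξ : IsInitialState P 𝓕 ξ) :
    IsStronglyProgressive 𝓕 (eulerLimit W F G ξ) := fun T =>
  stronglyMeasurable_limUnder fun k => eulerStep_progressive hW F G hξ (mesh_pos k) T

theorem enorm_sq_le_esq (x : Fin n → ℝ) : ‖x‖ₑ ^ 2 ≤ esq x := by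
  have h : ‖x‖ ^ 2 ≤ x ⬝ᵥ x := by
    have h0 : 0 ≤ x ⬝ᵥ x := Finset.sum_nonneg fun i _ => mul_self_nonneg (x i)
    rw [← Real.sqrt_le_sqrt_iff h0, Real.sqrt_sq (norm_nonneg _), pi_norm_le_iff_of_nonneg (Real.sqrt_nonneg _)]
    intro i
    rw [Real.norm_eq_abs]
    refine Real.abs_le_sqrt ?_
    rw [sq]
    exact Finset.single_le_sum (f := fun i => x i * x i) (fun i _ => mul_self_nonneg _)
      (Finset.mem_univ i)
  rw [esq_eq, ← ofReal_norm, ← ENNReal.ofReal_pow (norm_nonneg _)]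
  exact ENNReal.ofReal_le_ofReal h

theorem continuous_esq : Continuous (esq : (Fin n → ℝ) → ℝ≥0∞) := by
  have : (esq : (Fin n → ℝ) → ℝ≥0∞) = fun x => ENNReal.ofReal (x ⬝ᵥ x) := funext esq_eq
  rw [this]
  unfold dotProduct
  exact ENNReal.continuous_ofReal.comp (by fun_prop)

/-- The schemes along the meshes `4⁻ᵏ` are Cauchy in mean square at the geometric rate `2⁻ᵏ`, which
gives almost sure convergence. -/
theorem ae_tendsto_eulerLimit [IsProbabilityMeasure P] (hW : IsBrownianWrt P 𝓕 W)
    (F G : Matrix (Fin n) (Fin n) ℝ) {ξ : Ω → Fin n → ℝ} (hξ : IsInitialState P 𝓕 ξ) (t : ℝ≥0) :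
    ∀ᵐ ω ∂P, Tendsto (fun k => eulerStep W F G ξ (mesh k) t ω) atTop
      (𝓝 (eulerLimit W F G ξ t ω)) := by
  obtain ⟨C, hC⟩ := exists_eulerStep_sub_le hW F G hξ t
  have hmeas : ∀ k, AEStronglyMeasurable (eulerStep W F G ξ (mesh k) t) P := fun k =>
    ((euler_measurable hW F G hξ (mesh k) _).mono (𝓕.le _)).aestronglyMeasurable
  set c : ℝ≥0 := NNReal.sqrt (2 * C) + 1 with hc
  have hB : ∑' i : ℕ, ((c : ℝ≥0∞) * 2⁻¹ ^ i) ≠ ∞ := by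
    rw [ENNReal.tsum_mul_left, ENNReal.tsum_geometric]
    exact ENNReal.mul_ne_top ENNReal.coe_ne_top (by simp)
  have hcau : ∀ N k l : ℕ, N ≤ k → N ≤ l → eLpNorm (eulerStep W F G ξ (mesh k) t -
      eulerStep W F G ξ (mesh l) t) 2 P < (c : ℝ≥0∞) * 2⁻¹ ^ N := by
    intro N k l hk hl
    have h1 : eLpNorm (eulerStep W F G ξ (mesh k) t - eulerStep W F G ξ (mesh l) t) 2 P ^ 2 ≤
        ((NNReal.sqrt (2 * C) : ℝ≥0∞) * 2⁻¹ ^ N) ^ 2 := by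
      rw [eLpNorm_eq_lintegral_rpow_enorm_toReal (by simp) (by simp)]
      simp only [ENNReal.toReal_ofNat, ENNReal.rpow_two]
      rw [← ENNReal.rpow_natCast (_ ^ (1 / 2 : ℝ)), ← ENNReal.rpow_mul]
      norm_num
      calc _ ≤ ∫⁻ ω, esq (eulerStep W F G ξ (mesh k) t ω - eulerStep W F G ξ (mesh l) t ω) ∂P :=
            lintegral_mono fun ω => enorm_sq_le_esq _
        _ ≤ C * (mesh k + mesh l) := hC _ _ (mesh_pos k) (mesh_le_one k) (mesh_pos l)
            (mesh_le_one l) t le_rfl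
        _ ≤ C * (mesh N + mesh N) := by
            gcongr
            · exact_mod_cast mesh_anti hk
            · exact_mod_cast mesh_anti hl
        _ = _ := by
            have e1 : (NNReal.sqrt (2 * C) : ℝ≥0∞) ^ 2 = 2 * C := by
              rw [← ENNReal.coe_pow, NNReal.sq_sqrt]
              push_cast
              rfl
            have e2 : ((2 : ℝ≥0∞)⁻¹ ^ N) ^ 2 = mesh N := by
              rw [← pow_mul, mul_comm, pow_mul, mesh]
              have e3 : (2 : ℝ≥0∞)⁻¹ ^ 2 = ((1 / 4 : ℝ≥0) : ℝ≥0∞) := by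
                rw [← ENNReal.inv_pow, ENNReal.coe_div (by simp)]
                norm_num
              rw [e3, ENNReal.coe_pow]
            rw [mul_pow, e1, e2]
            ring
    have h2 := (ENNReal.pow_le_pow_left_iff two_ne_zero).1 h1
    refine h2.trans_lt ?_
    refine (ENNReal.mul_lt_mul_iff_left ?_ ?_).2 ?_
    · exact (ENNReal.pow_pos (by simp) N).ne'
    · exact ENNReal.pow_ne_top (by simp)
    · rw [ENNReal.coe_lt_coe, hc]
      exact lt_add_one _
  filter_upwards [Lp.ae_tendsto_of_cauchy_eLpNorm hmeas one_le_two hB hcau] with ω hω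
  exact tendsto_nhds_limUnder hω

theorem exists_eulerLimit_sub_le [IsProbabilityMeasure P] (hW : IsBrownianWrt P 𝓕 W)
    (F G : Matrix (Fin n) (Fin n) ℝ) {ξ : Ω → Fin n → ℝ} (hξ : IsInitialState P 𝓕 ξ) (T : ℝ≥0) :
    ∃ C : ℝ≥0, ∀ k, ∀ t ≤ T,
      ∫⁻ ω, esq (eulerLimit W F G ξ t ω - eulerStep W F G ξ (mesh k) t ω) ∂P ≤ C * mesh k := by
  obtain ⟨C, hC⟩ := exists_eulerStep_sub_le hW F G hξ T
  refine ⟨C * 2, fun k t ht => ?_⟩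
  have hm : ∀ k, Measurable (eulerStep W F G ξ (mesh k) t) := fun k =>
    ((euler_measurable hW F G hξ (mesh k) _).mono (𝓕.le _)).measurable
  calc _ = ∫⁻ ω, liminf (fun l => esq (eulerStep W F G ξ (mesh l) t ω -
          eulerStep W F G ξ (mesh k) t ω)) atTop ∂P := by
        refine lintegral_congr_ae ?_
        filter_upwards [ae_tendsto_eulerLimit hW F G hξ t] with ω hω
        exact ((continuous_esq.tendsto _).comp (hω.sub_const _)).liminf_eq.symm
    _ ≤ liminf (fun l => ∫⁻ ω, esq (eulerStep W F G ξ (mesh l) t ω -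
          eulerStep W F G ξ (mesh k) t ω) ∂P) atTop :=
        lintegral_liminf_le fun l => measurable_esq.comp ((hm l).sub (hm k))
    _ ≤ _ := by
        refine liminf_le_of_le (by isBoundedDefault) fun b hb => ?_
        obtain ⟨l, hl, hkl⟩ := (hb.and (eventually_ge_atTop k)).exists
        refine hl.trans ((hC _ _ (mesh_pos l) (mesh_le_one l) (mesh_pos k) (mesh_le_one k) t
          ht).trans ?_)
        have : (mesh l : ℝ≥0∞) ≤ mesh k := by exact_mod_cast mesh_anti hkl
        calc (C : ℝ≥0∞) * (mesh l + mesh k) ≤ C * (mesh k + mesh k) := by gcongr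
          _ = _ := by push_cast; ring

/-- The integrals over time of the distances to the Euler step processes. -/
theorem exists_integral_eulerLimit_sub_le [IsProbabilityMeasure P] (hW : IsBrownianWrt P 𝓕 W)
    (F G : Matrix (Fin n) (Fin n) ℝ) {ξ : Ω → Fin n → ℝ} (hξ : IsInitialState P 𝓕 ξ) (T : ℝ≥0) :
    ∃ C : ℝ≥0, ∀ k, ∫⁻ ω, (∫⁻ s in Set.Ioc (0 : ℝ) T,
      esq (eulerLimit W F G ξ s.toNNReal ω - eulerStep W F G ξ (mesh k) s.toNNReal ω)) ∂P ≤
      C * mesh k := by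
  obtain ⟨C, hC⟩ := exists_eulerLimit_sub_le hW F G hξ T
  have hD : ∀ k, IsMeasurableProcess
      (fun t ω => eulerLimit W F G ξ t ω - eulerStep W F G ξ (mesh k) t ω) := fun k =>
    (isMeasurableProcess_of_progressive (eulerLimit_progressive hW F G hξ)).sub
      (isMeasurableProcess_of_progressive (eulerStep_progressive hW F G hξ (mesh_pos k)))
  refine ⟨C * T, fun k => ?_⟩
  rw [lintegral_esq_swap (hD k)]
  calc _ ≤ ∫⁻ _ in Set.Ioc (0 : ℝ) T, (C * mesh k : ℝ≥0∞) :=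
        setLIntegral_mono' measurableSet_Ioc fun s hs =>
          hC k _ (Real.toNNReal_le_iff_le_coe.2 hs.2)
    _ = _ := by
        rw [setLIntegral_const, Real.volume_Ioc, sub_zero, ENNReal.ofReal_coe_nnreal]
        push_cast
        ring

theorem eulerLimit_sq [IsProbabilityMeasure P] (hW : IsBrownianWrt P 𝓕 W)
    (F G : Matrix (Fin n) (Fin n) ℝ) {ξ : Ω → Fin n → ℝ} (hξ : IsInitialState P 𝓕 ξ) (T : ℝ≥0) :
    ∫⁻ ω, (∫⁻ s in Set.Ioc (0 : ℝ) T, esq (eulerLimit W F G ξ s.toNNReal ω)) ∂P < ∞ := by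
  obtain ⟨C, hC⟩ := exists_integral_eulerLimit_sub_le hW F G hξ T
  have hD : IsMeasurableProcess
      (fun t ω => eulerLimit W F G ξ t ω - eulerStep W F G ξ (mesh 0) t ω) :=
    (isMeasurableProcess_of_progressive (eulerLimit_progressive hW F G hξ)).sub
      (isMeasurableProcess_of_progressive (eulerStep_progressive hW F G hξ (mesh_pos 0)))
  have m1 : Measurable fun ω => ∫⁻ s in Set.Ioc (0 : ℝ) T, esq (eulerLimit W F G ξ s.toNNReal ω -
      eulerStep W F G ξ (mesh 0) s.toNNReal ω) :=
    (measurable_esq.comp hD).lintegral_prod_left'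
  have h0 : ∀ x y : Fin n → ℝ, esq x ≤ 2 * (esq (x - y) + esq y) := fun x y => by
    have := esq_sub_le (x - y) (-y)
    have e : esq (-y) = esq y := by simp [esq]
    rwa [sub_neg_eq_add, sub_add_cancel, e] at this
  calc _ ≤ ∫⁻ ω, 2 * ((∫⁻ s in Set.Ioc (0 : ℝ) T, esq (eulerLimit W F G ξ s.toNNReal ω -
        eulerStep W F G ξ (mesh 0) s.toNNReal ω)) + ∫⁻ s in Set.Ioc (0 : ℝ) T,
        esq (eulerStep W F G ξ (mesh 0) s.toNNReal ω)) ∂P := by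
        refine lintegral_mono fun ω => ?_
        have m2 : Measurable fun s : ℝ => esq (eulerLimit W F G ξ s.toNNReal ω -
            eulerStep W F G ξ (mesh 0) s.toNNReal ω) :=
          measurable_esq.comp (hD.measurable_path ω)
        rw [← lintegral_add_left m2, ← lintegral_const_mul' _ _ (by simp)]
        exact lintegral_mono fun s => h0 _ _
    _ < ∞ := by
        rw [lintegral_const_mul' _ _ (by simp), lintegral_add_left m1]
        refine ENNReal.mul_lt_top (by simp) (ENNReal.add_lt_top.2 ⟨(hC 0).trans_lt ?_,
          (isApproxSolution_euler hW F G hξ (mesh_pos 0)).sq T⟩)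
        exact ENNReal.mul_lt_top (by simp) (by simp)

theorem ae_intervalIntegrable_eulerLimit [IsProbabilityMeasure P] (hW : IsBrownianWrt P 𝓕 W)
    (F G : Matrix (Fin n) (Fin n) ℝ) {ξ : Ω → Fin n → ℝ} (hξ : IsInitialState P 𝓕 ξ) (t : ℝ≥0)
    (i : Fin n) : ∀ᵐ ω ∂P, IntervalIntegrable
      (fun s => (F *ᵥ eulerLimit W F G ξ s.toNNReal ω) i) volume 0 t := by
  have hX := isMeasurableProcess_of_progressive (eulerLimit_progressive hW F G hξ)
  have hm : Measurable fun ω => ∫⁻ s in Set.Ioc (0 : ℝ) t, esq (eulerLimit W F G ξ s.toNNReal ω) :=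
    (measurable_esq.comp hX).lintegral_prod_left'
  filter_upwards [ae_lt_top hm (eulerLimit_sq hW F G hξ t).ne] with ω hω
  exact intervalIntegrable_mulVec_of_esq (hX.measurable_path ω) hω F i

/-- The part of the process `X` that an equation with drift `F X` equates to a stochastic
integral. -/
noncomputable def noisePart (F : Matrix (Fin n) (Fin n) ℝ) (ξ : Ω → Fin n → ℝ)
    (X Y : ℝ≥0 → Ω → Fin n → ℝ) (t : ℝ≥0) (i : Fin n) (ω : Ω) : ℝ :=
  X t ω i - ξ ω i - ∫ s in (0 : ℝ)..t, (F *ᵥ Y s.toNNReal ω) i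

theorem aestronglyMeasurable_noisePart [IsProbabilityMeasure P] (F : Matrix (Fin n) (Fin n) ℝ)
    {ξ : Ω → Fin n → ℝ} (hξ : IsInitialState P 𝓕 ξ) {X : ℝ≥0 → Ω → Fin n → ℝ}
    (hX : IsMeasurableProcess X) (t : ℝ≥0) (i : Fin n) :
    AEStronglyMeasurable (noisePart F ξ X X t i) P := by
  have h1 : Measurable fun ω => X t ω i := (measurable_pi_apply i).comp (hX.measurable_eval t)
  have h2 : StronglyMeasurable fun ω => ∫ s in (0 : ℝ)..t, (F *ᵥ X s.toNNReal ω) i := by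
    simp only [intervalIntegral.integral_of_le t.coe_nonneg]
    exact StronglyMeasurable.integral_prod_left (f := fun (s : ℝ) (ω : Ω) =>
      (F *ᵥ X s.toNNReal ω) i) (hX.mulVec F i).stronglyMeasurable
  exact (h1.aestronglyMeasurable.sub (hξ.memLp_apply i).1).sub h2.aestronglyMeasurable

theorem enorm_noisePart_sub_sq_le (F : Matrix (Fin n) (Fin n) ℝ) (ξ : Ω → Fin n → ℝ)
    {X Y Z : ℝ≥0 → Ω → Fin n → ℝ} (hX : IsMeasurableProcess X) (hZ : IsMeasurableProcess Z)
    (t : ℝ≥0) (i : Fin n) {ω : Ω}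
    (h1 : IntervalIntegrable (fun s => (F *ᵥ X s.toNNReal ω) i) volume 0 t)
    (h2 : IntervalIntegrable (fun s => (F *ᵥ Z s.toNNReal ω) i) volume 0 t) :
    ‖noisePart F ξ X X t i ω - noisePart F ξ Y Z t i ω‖ₑ ^ 2 ≤
      3 * (esq (X t ω - Z t ω) + esq (Y t ω - Z t ω) + t * (ENNReal.ofReal (‖F‖ ^ 2) *
        ∫⁻ s in Set.Ioc (0 : ℝ) t, esq (X s.toNNReal ω - Z s.toNNReal ω))) := by
  have hD : IsMeasurableProcess fun t ω => X t ω - Z t ω := hX.sub hZ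
  have hsub : ∫ s in (0 : ℝ)..t, (F *ᵥ (X s.toNNReal ω - Z s.toNNReal ω)) i =
      (∫ s in (0 : ℝ)..t, (F *ᵥ X s.toNNReal ω) i) -
      ∫ s in (0 : ℝ)..t, (F *ᵥ Z s.toNNReal ω) i := by
    simp only [Matrix.mulVec_sub, Pi.sub_apply]
    rw [intervalIntegral.integral_sub h1 h2]
  have hdr : ‖(∫ s in (0 : ℝ)..t, (F *ᵥ X s.toNNReal ω) i) -
      ∫ s in (0 : ℝ)..t, (F *ᵥ Z s.toNNReal ω) i‖ₑ ^ 2 ≤ t * (ENNReal.ofReal (‖F‖ ^ 2) *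
        ∫⁻ s in Set.Ioc (0 : ℝ) t, esq (X s.toNNReal ω - Z s.toNNReal ω)) := by
    have hm : Measurable fun s : ℝ => (F *ᵥ (X s.toNNReal ω - Z s.toNNReal ω)) i :=
      (hD.mulVec F i).measurable_path ω
    rw [← hsub, ← lintegral_const_mul' _ _ ENNReal.ofReal_ne_top]
    refine (enorm_intervalIntegral_sq_le hm).trans ?_
    gcongr with s
    exact enorm_mulVec_sq_le F (X s.toNNReal ω - Z s.toNNReal ω) i
  have hone : ∀ (x : Fin n → ℝ), ‖x i‖ₑ ^ 2 ≤ esq x := fun x =>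
    Finset.single_le_sum (f := fun i => ‖x i‖ₑ ^ 2) (fun _ _ => zero_le) (Finset.mem_univ i)
  have e1 := hone (X t ω - Z t ω)
  have e2 := hone (Y t ω - Z t ω)
  unfold noisePart
  generalize ∫ s in (0 : ℝ)..t, (F *ᵥ X s.toNNReal ω) i = p at hdr ⊢
  generalize ∫ s in (0 : ℝ)..t, (F *ᵥ Z s.toNNReal ω) i = q at hdr ⊢
  have e3 := enorm_sub_sq_le_three (X t ω i) (Z t ω i) (Y t ω i) (Y t ω i + (p - q))
  have e4 : X t ω i - ξ ω i - p - (Y t ω i - ξ ω i - q) = X t ω i - (Y t ω i + (p - q)) := by ring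
  rw [e4]
  refine e3.trans ?_
  gcongr
  · exact e1
  · rw [← enorm_neg, neg_sub]
    exact e2
  · rw [← enorm_neg]
    simpa using hdr

theorem exists_noisePart_eulerLimit_sub_le [IsProbabilityMeasure P] (hW : IsBrownianWrt P 𝓕 W)
    (F G : Matrix (Fin n) (Fin n) ℝ) {ξ : Ω → Fin n → ℝ} (hξ : IsInitialState P 𝓕 ξ) (t : ℝ≥0)
    (i : Fin n) : ∃ C : ℝ≥0, ∀ k,
      ∫⁻ ω, ‖noisePart F ξ (eulerLimit W F G ξ) (eulerLimit W F G ξ) t i ω -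
        (eulerSimple hW F G hξ (mesh_pos k) t i).integral W ω‖ₑ ^ 2 ∂P ≤ C * mesh k := by
  obtain ⟨C, hC⟩ := exists_integral_eulerLimit_sub_le hW F G hξ t
  obtain ⟨C', hC'⟩ := exists_eulerLimit_sub_le hW F G hξ t
  obtain ⟨C'', hC''⟩ := exists_eulerInterp_sub_le hW F G hξ t
  have hX := isMeasurableProcess_of_progressive (eulerLimit_progressive hW F G hξ)
  refine ⟨3 * (C' + C'' + t * ((‖F‖ ^ 2).toNNReal * C)), fun k => ?_⟩
  have hap := isApproxSolution_euler hW F G hξ (mesh_pos k)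
  have m1 : AEMeasurable (fun ω =>
      esq (eulerLimit W F G ξ t ω - eulerStep W F G ξ (mesh k) t ω)) P :=
    (measurable_esq.comp ((hX.measurable_eval t).sub (hap.measY.measurable_eval t))).aemeasurable
  have m2 : AEMeasurable (fun ω =>
      esq (eulerInterp W F G ξ (mesh k) t ω - eulerStep W F G ξ (mesh k) t ω)) P :=
    measurable_esq.comp_aemeasurable ((hap.meas t).sub
      (hap.measY.measurable_eval t).aemeasurable)
  have hpt : ∀ᵐ ω ∂P, ‖noisePart F ξ (eulerLimit W F G ξ) (eulerLimit W F G ξ) t i ω -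
        (eulerSimple hW F G hξ (mesh_pos k) t i).integral W ω‖ₑ ^ 2 ≤
      3 * (esq (eulerLimit W F G ξ t ω - eulerStep W F G ξ (mesh k) t ω) +
      esq (eulerInterp W F G ξ (mesh k) t ω - eulerStep W F G ξ (mesh k) t ω) +
      t * (ENNReal.ofReal (‖F‖ ^ 2) * ∫⁻ s in Set.Ioc (0 : ℝ) t,
        esq (eulerLimit W F G ξ s.toNNReal ω - eulerStep W F G ξ (mesh k) s.toNNReal ω))) := by
    filter_upwards [ae_intervalIntegrable_eulerLimit hW F G hξ t i, hap.integrable_path t F i]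
      with ω h1 h2
    rw [← eulerSimple_integral]
    exact enorm_noisePart_sub_sq_le F ξ hX hap.measY t i h1 h2
  refine (lintegral_mono_ae hpt).trans ?_
  rw [lintegral_const_mul' _ _ (by simp), lintegral_add_three m1 m2,
    lintegral_const_mul' _ _ (by simp), lintegral_const_mul' _ _ ENNReal.ofReal_ne_top]
  calc _ ≤ 3 * (C' * mesh k + C'' * mesh k +
        t * (ENNReal.ofReal (‖F‖ ^ 2) * (C * mesh k : ℝ≥0∞))) := by
        gcongr
        · exact hC' k t le_rfl
        · exact hC'' _ (mesh_pos k) (mesh_le_one k) t le_rfl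
        · exact hC k
    _ = _ := by
        push_cast
        rw [ENNReal.ofReal]
        ring

/-- The linear stochastic differential equation has a solution. -/
theorem isLinearSDESolution_eulerLimit [IsProbabilityMeasure P] (hW : IsBrownianWrt P 𝓕 W)
    (F G : Matrix (Fin n) (Fin n) ℝ) {ξ : Ω → Fin n → ℝ} (hξ : IsInitialState P 𝓕 ξ) :
    IsLinearSDESolution P 𝓕 W F G ξ (eulerLimit W F G ξ) := by
  have hX := isMeasurableProcess_of_progressive (eulerLimit_progressive hW F G hξ)
  refine ⟨eulerLimit_progressive hW F G hξ, fun T => by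
    simpa only [esq_eq] using eulerLimit_sq hW F G hξ T, fun t i => ?_⟩
  have hm : ∀ c : ℝ≥0, Tendsto (fun k => (c : ℝ≥0∞) * mesh k) atTop (𝓝 0) := fun c => by
    simpa using ENNReal.Tendsto.const_mul (a := (c : ℝ≥0∞)) tendsto_mesh (Or.inr (by simp))
  obtain ⟨C, hC⟩ := exists_integral_eulerLimit_sub_le hW F G hξ t
  obtain ⟨C', hdiff⟩ := exists_noisePart_eulerLimit_sub_le hW F G hξ t i
  have hIm := aestronglyMeasurable_noisePart (P := P) F hξ hX t i
  have hIL : MemLp (noisePart F ξ (eulerLimit W F G ξ) (eulerLimit W F G ξ) t i) 2 P := by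
    have hS := (eulerSimple hW F G hξ (mesh_pos 0) t i).memLp_integral hW
    have h1 := memLp_two_of_lintegral_sq_lt_top (hIm.sub hS.1)
      ((hdiff 0).trans_lt (ENNReal.mul_lt_top (by simp) (by simp)))
    refine (h1.add hS).congr_norm hIm (Eventually.of_forall fun ω => ?_)
    simp
  refine ⟨hIL, fun k => eulerSimple hW F G hξ (mesh_pos k) t i,
    fun k => min_le_right _ _, ?_, ?_⟩
  · refine tendsto_of_tendsto_of_tendsto_of_le_of_le tendsto_const_nhds
      (h := fun k => ENNReal.ofReal (‖G‖ ^ 2) * (C * mesh k)) ?_ (fun _ => zero_le) fun k => ?_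
    · have := ENNReal.Tendsto.const_mul (a := ENNReal.ofReal (‖G‖ ^ 2)) (hm C)
        (Or.inr ENNReal.ofReal_ne_top)
      rwa [mul_zero] at this
    · refine le_trans ?_ (mul_le_mul_right (hC k) (ENNReal.ofReal (‖G‖ ^ 2)))
      rw [← lintegral_const_mul' _ _ ENNReal.ofReal_ne_top]
      refine lintegral_mono fun ω => ?_
      rw [← lintegral_const_mul' _ _ ENNReal.ofReal_ne_top]
      refine setLIntegral_mono' measurableSet_Ioc fun s hs => ?_
      rw [eulerSimple_value hW F G hξ (mesh_pos k) (Real.toNNReal_pos.2 hs.1)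
        (Real.toNNReal_le_iff_le_coe.2 hs.2)]
      have := enorm_mulVec_sq_le G (eulerLimit W F G ξ s.toNNReal ω -
        eulerStep W F G ξ (mesh k) s.toNNReal ω) i
      rwa [Matrix.mulVec_sub] at this
  · exact tendsto_of_tendsto_of_tendsto_of_le_of_le tendsto_const_nhds (hm C') (fun _ => zero_le)
      hdiff

/-! ### The second moments of solutions -/

theorem tendsto_integral_mul_of_tendsto_lintegral_sq {f g : ℕ → Ω → ℝ} {f' g' : Ω → ℝ}
    (hf : ∀ k, MemLp (f k) 2 P) (hg : ∀ k, MemLp (g k) 2 P) (hf' : MemLp f' 2 P)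
    (hg' : MemLp g' 2 P)
    (h1 : Tendsto (fun k => ∫⁻ ω, ‖f k ω - f' ω‖ₑ ^ 2 ∂P) atTop (𝓝 0))
    (h2 : Tendsto (fun k => ∫⁻ ω, ‖g k ω - g' ω‖ₑ ^ 2 ∂P) atTop (𝓝 0)) :
    Tendsto (fun k => ∫ ω, f k ω * g k ω ∂P) atTop (𝓝 (∫ ω, f' ω * g' ω ∂P)) := by
  have key : ∀ {u : ℕ → Ω → ℝ} {u' : Ω → ℝ} (hu : ∀ k, MemLp (u k) 2 P) (hu' : MemLp u' 2 P),
      Tendsto (fun k => ∫⁻ ω, ‖u k ω - u' ω‖ₑ ^ 2 ∂P) atTop (𝓝 0) →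
      Tendsto (fun k => (hu k).toLp (u k)) atTop (𝓝 (hu'.toLp u')) := by
    intro u u' hu hu' h
    rw [Lp.tendsto_Lp_iff_tendsto_eLpNorm'']
    have h3 := h.ennrpow_const (1 / 2)
    rw [ENNReal.zero_rpow_of_pos (by norm_num)] at h3
    refine h3.congr fun k => ?_
    rw [eLpNorm_eq_lintegral_rpow_enorm_toReal (by simp) (by simp)]
    simp
  have hin : ∀ {u v : Ω → ℝ} (hu : MemLp u 2 P) (hv : MemLp v 2 P),
      inner ℝ (hv.toLp v) (hu.toLp u) = ∫ ω, u ω * v ω ∂P := by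
    intro u v hu hv
    rw [L2.inner_def]
    refine integral_congr_ae ?_
    filter_upwards [hu.coeFn_toLp, hv.coeFn_toLp] with ω e1 e2
    rw [e1, e2]
    simp
  have := (key hg hg' h2).inner (𝕜 := ℝ) (key hf hf' h1)
  rw [hin hf' hg'] at this
  exact this.congr fun k => hin (hf k) (hg k)

end Solutions

section Moments

attribute [local instance] frobTop

variable {Ω : Type*} {mΩ : MeasurableSpace Ω} {P : Measure Ω} {𝓕 : Filtration ℝ≥0 mΩ}
  {W : ℝ≥0 → Ω → ℝ} {n : ℕ} {F G : Matrix (Fin n) (Fin n) ℝ}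

theorem tendsto_matrix {κ : Type*} {l : Filter κ} {k m : ℕ} {M : κ → Matrix (Fin k) (Fin m) ℝ}
    {N : Matrix (Fin k) (Fin m) ℝ} (h : ∀ i j, Tendsto (fun a => M a i j) l (𝓝 (N i j))) :
    Tendsto M l (𝓝 N) := by
  have : @Tendsto κ (Fin k → Fin m → ℝ) M l (@nhds _ Pi.topologicalSpace N) :=
    tendsto_pi_nhds.2 fun i => tendsto_pi_nhds.2 fun j => h i j
  exact this

theorem tendsto_matrix_apply {κ : Type*} {l : Filter κ} {k m : ℕ}
    {M : κ → Matrix (Fin k) (Fin m) ℝ} {N : Matrix (Fin k) (Fin m) ℝ} (h : Tendsto M l (𝓝 N))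
    (i : Fin k) (j : Fin m) : Tendsto (fun a => M a i j) l (𝓝 (N i j)) := by
  have : @Tendsto κ (Fin k → Fin m → ℝ) M l (@nhds _ Pi.topologicalSpace N) := h
  exact tendsto_pi_nhds.1 (tendsto_pi_nhds.1 this i) j

theorem eulerInterp_zero (ξ : Ω → Fin n → ℝ) (h : ℝ≥0) (ω : Ω) :
    eulerInterp W F G ξ h 0 ω = ξ ω := by
  simp [eulerInterp, eulerStep, meshIndex, euler]

theorem eulerInterp_grid (ξ : Ω → Fin n → ℝ) {h : ℝ≥0} (hh : 0 < h) (k : ℕ) (ω : Ω) :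
    eulerInterp W F G ξ h ((k + 1 : ℕ) * h) ω = euler W F G ξ h (k + 1) ω := by
  have hlt : (k : ℝ≥0) * h < (k + 1 : ℕ) * h := by
    gcongr
    omega
  have hk : meshIndex h ((k + 1 : ℕ) * h) = k := meshIndex_eq hh hlt le_rfl
  rw [eulerInterp, eulerStep, hk, euler]
  congr 3
  have := grid_sub h k
  push_cast at this ⊢
  linarith

/-- A solution is the limit in mean square of the interpolated Euler schemes. -/
theorem IsLinearSDESolution.exists_sub_eulerInterp_le [IsProbabilityMeasure P]
    (hW : IsBrownianWrt P 𝓕 W) {ξ : Ω → Fin n → ℝ} (hξ : IsInitialState P 𝓕 ξ)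
    {X : ℝ≥0 → Ω → Fin n → ℝ} (hX : IsLinearSDESolution P 𝓕 W F G ξ X) (t : ℝ≥0) :
    ∃ C : ℝ≥0, ∀ h : ℝ≥0, 0 < h → h ≤ 1 →
      ∫⁻ ω, esq (eulerInterp W F G ξ h t ω - X t ω) ∂P ≤ C * h := by
  obtain ⟨C, hC⟩ := exists_eulerInterp_sub_le hW F G hξ t
  obtain ⟨K, hK⟩ := exists_isApproxSolution_bound hW F G t
  refine ⟨K * C, fun h hh hh1 => ?_⟩
  have := hK ξ _ _ _ _ (C * h) 0 (isApproxSolution_euler hW F G hξ hh) hX.isApproxSolution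
    (hC h hh hh1) (fun s _ => by simp [esq]) t le_rfl
  simpa [mul_assoc] using this

theorem IsLinearSDESolution.measurable_eval {ξ : Ω → Fin n → ℝ}
    {X : ℝ≥0 → Ω → Fin n → ℝ} (hX : IsLinearSDESolution P 𝓕 W F G ξ X) (t : ℝ≥0) :
    Measurable (X t) :=
  (isMeasurableProcess_of_progressive hX.progressive).measurable_eval t

theorem eulerInterp_memLp [IsProbabilityMeasure P] (hW : IsBrownianWrt P 𝓕 W)
    {ξ : Ω → Fin n → ℝ} (hξ : IsInitialState P 𝓕 ξ) {h : ℝ≥0} (hh : 0 < h) (hh1 : h ≤ 1)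
    (t : ℝ≥0) (i : Fin n) : MemLp (fun ω => eulerInterp W F G ξ h t ω i) 2 P := by
  obtain ⟨C, hC⟩ := exists_eulerInterp_sub_le hW F G hξ t
  have hap := isApproxSolution_euler hW F G hξ hh
  have hs := euler_memLp hW F G hξ h (meshIndex h t) i
  have hm : AEStronglyMeasurable (fun ω => eulerInterp W F G ξ h t ω i) P :=
    ((measurable_pi_apply i).comp_aemeasurable (hap.meas t)).aestronglyMeasurable
  have h1 : MemLp (fun ω => eulerInterp W F G ξ h t ω i - eulerStep W F G ξ h t ω i) 2 P := by
    refine memLp_two_of_lintegral_sq_lt_top (hm.sub hs.1) (lt_of_le_of_lt ?_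
      (lt_of_le_of_lt (hC h hh hh1 t le_rfl) (ENNReal.mul_lt_top (by simp) (by simp))))
    exact lintegral_mono fun ω => Finset.single_le_sum
      (f := fun i => ‖(eulerInterp W F G ξ h t ω - eulerStep W F G ξ h t ω) i‖ₑ ^ 2)
      (fun _ _ => zero_le) (Finset.mem_univ i)
  refine (h1.add hs).congr_norm hm (Eventually.of_forall fun ω => ?_)
  simp [eulerStep]

theorem IsLinearSDESolution.memLp [IsProbabilityMeasure P]
    (hW : IsBrownianWrt P 𝓕 W) {ξ : Ω → Fin n → ℝ} (hξ : IsInitialState P 𝓕 ξ)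
    {X : ℝ≥0 → Ω → Fin n → ℝ} (hX : IsLinearSDESolution P 𝓕 W F G ξ X) (t : ℝ≥0) (i : Fin n) :
    MemLp (fun ω => X t ω i) 2 P := by
  obtain ⟨C, hC⟩ := hX.exists_sub_eulerInterp_le hW hξ t
  have hs := eulerInterp_memLp (F := F) (G := G) hW hξ one_pos le_rfl t i
  have hm : AEStronglyMeasurable (fun ω => X t ω i) P :=
    ((measurable_pi_apply i).comp (hX.measurable_eval t)).aestronglyMeasurable
  have h1 : MemLp (fun ω => eulerInterp W F G ξ 1 t ω i - X t ω i) 2 P := by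
    refine memLp_two_of_lintegral_sq_lt_top (hs.1.sub hm) (lt_of_le_of_lt ?_
      (lt_of_le_of_lt (hC 1 one_pos le_rfl) (ENNReal.mul_lt_top (by simp) (by simp))))
    exact lintegral_mono fun ω => Finset.single_le_sum
      (f := fun i => ‖(eulerInterp W F G ξ 1 t ω - X t ω) i‖ₑ ^ 2)
      (fun _ _ => zero_le) (Finset.mem_univ i)
  refine (hs.sub h1).congr_norm hm (Eventually.of_forall fun ω => ?_)
  simp

theorem IsLinearSDESolution.tendsto_eulerInterp [IsProbabilityMeasure P]
    (hW : IsBrownianWrt P 𝓕 W) {ξ : Ω → Fin n → ℝ} (hξ : IsInitialState P 𝓕 ξ)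
    {X : ℝ≥0 → Ω → Fin n → ℝ} (hX : IsLinearSDESolution P 𝓕 W F G ξ X) (t : ℝ≥0) (i : Fin n)
    {h : ℕ → ℝ≥0} (hpos : ∀ k, 0 < h k) (hle : ∀ k, h k ≤ 1) (h0 : Tendsto h atTop (𝓝 0)) :
    Tendsto (fun k => ∫⁻ ω, ‖eulerInterp W F G ξ (h k) t ω i - X t ω i‖ₑ ^ 2 ∂P) atTop (𝓝 0) := by
  obtain ⟨C, hC⟩ := hX.exists_sub_eulerInterp_le hW hξ t
  have h1 : Tendsto (fun k => (C : ℝ≥0∞) * h k) atTop (𝓝 0) := by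
    have := (ENNReal.tendsto_coe.2 h0)
    simpa using ENNReal.Tendsto.const_mul (a := (C : ℝ≥0∞)) this (Or.inr (by simp))
  refine tendsto_of_tendsto_of_tendsto_of_le_of_le tendsto_const_nhds h1 (fun _ => zero_le)
    fun k => le_trans ?_ (hC (h k) (hpos k) (hle k))
  exact lintegral_mono fun ω => Finset.single_le_sum
    (f := fun i => ‖(eulerInterp W F G ξ (h k) t ω - X t ω) i‖ₑ ^ 2)
    (fun _ _ => zero_le) (Finset.mem_univ i)

theorem IsLinearSDESolution.tendsto_crossMoment [IsProbabilityMeasure P]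
    (hW : IsBrownianWrt P 𝓕 W) {ξ η : Ω → Fin n → ℝ} (hξ : IsInitialState P 𝓕 ξ)
    (hη : IsInitialState P 𝓕 η) {X Y : ℝ≥0 → Ω → Fin n → ℝ}
    (hX : IsLinearSDESolution P 𝓕 W F G ξ X) (hY : IsLinearSDESolution P 𝓕 W F G η Y) (t : ℝ≥0)
    {h : ℕ → ℝ≥0} (hpos : ∀ k, 0 < h k) (hle : ∀ k, h k ≤ 1) (h0 : Tendsto h atTop (𝓝 0)) :
    Tendsto (fun k => crossMoment P (eulerInterp W F G ξ (h k) t) (eulerInterp W F G η (h k) t))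
      atTop (𝓝 (crossMoment P (X t) (Y t))) := by
  refine tendsto_matrix fun i j => ?_
  exact tendsto_integral_mul_of_tendsto_lintegral_sq
    (fun k => eulerInterp_memLp hW hξ (hpos k) (hle k) t i)
    (fun k => eulerInterp_memLp hW hη (hpos k) (hle k) t j) (hX.memLp hW hξ t i)
    (hY.memLp hW hη t j) (hX.tendsto_eulerInterp hW hξ t i hpos hle h0)
    (hY.tendsto_eulerInterp hW hη t j hpos hle h0)

/-- The mixed second moments of two solutions of the same equation evolve under the semigroup
generated by `lyap F G`. -/
theorem IsLinearSDESolution.crossMoment_eq [IsProbabilityMeasure P]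
    (hW : IsBrownianWrt P 𝓕 W) {ξ η : Ω → Fin n → ℝ} (hξ : IsInitialState P 𝓕 ξ)
    (hη : IsInitialState P 𝓕 η) {X Y : ℝ≥0 → Ω → Fin n → ℝ}
    (hX : IsLinearSDESolution P 𝓕 W F G ξ X) (hY : IsLinearSDESolution P 𝓕 W F G η Y) (t : ℝ≥0) :
    crossMoment P (X t) (Y t) = NormedSpace.exp ((t : ℝ) • lyap F G) (crossMoment P ξ η) := by
  rcases eq_zero_or_pos t with rfl | ht
  · have hlim := hX.tendsto_crossMoment hW hξ hη hY 0 (h := fun k => 1 / ((k : ℝ≥0) + 1))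
      (fun k => by positivity) (fun k => by
        rw [div_le_one (by positivity)]
        exact le_add_of_nonneg_left (by positivity)) tendsto_one_div_add_atTop_nhds_zero_nat
    have e : ∀ (ζ : Ω → Fin n → ℝ) (h : ℝ≥0), eulerInterp W F G ζ h 0 = ζ := fun ζ h =>
      funext fun ω => eulerInterp_zero ζ h ω
    simp only [e] at hlim
    rw [tendsto_nhds_unique hlim tendsto_const_nhds]
    simp
  · obtain ⟨N, hN⟩ := exists_nat_ge t
    have hN1 : 0 < N := by
      rcases Nat.eq_zero_or_pos N with rfl | h
      · simp at hN
        exact absurd hN ht.ne'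
      · exact h
    set h : ℕ → ℝ≥0 := fun k => t / ((k + N : ℕ) : ℝ≥0) with hh
    have hden : ∀ k, 0 < ((k + N : ℕ) : ℝ≥0) := fun k => by
      exact_mod_cast (by omega : 0 < k + N)
    have hpos : ∀ k, 0 < h k := fun k => div_pos ht (hden k)
    have hlim := hX.tendsto_crossMoment hW hξ hη hY t (h := h) hpos
      (fun k => by
        rw [hh, div_le_one (hden k)]
        exact hN.trans (by exact_mod_cast (by omega : N ≤ k + N)))
      ((tendsto_const_div_atTop_nhds_zero_nat t).comp (tendsto_add_atTop_nat N))
    have e : ∀ (ζ : Ω → Fin n → ℝ) (k : ℕ), eulerInterp W F G ζ (h k) t =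
        euler W F G ζ (h k) (k + N) := fun ζ k => funext fun ω => by
      have h1 := eulerInterp_grid (W := W) (F := F) (G := G) ζ (hpos k) (k + N - 1) ω
      rw [Nat.sub_add_cancel (by omega)] at h1
      rwa [hh, mul_div_cancel₀ _ (hden k).ne'] at h1
    simp only [e, crossMoment_euler hW F G hξ hη] at hlim
    have h2 := ((ContinuousLinearMap.apply ℝ _ (crossMoment P ξ η)).continuous.tendsto _).comp
      ((tendsto_step_pow (lyap F G) (congruence F) t.coe_nonneg).comp (tendsto_add_atTop_nat N))
    refine tendsto_nhds_unique hlim (h2.congr fun k => ?_)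
    simp [hh]

/-! ### Stabilizers and cost in terms of the moment semigroup -/

/-- Mean-square stability of `dX = F X dt + G X dW`, in terms of the second moments. -/
def IsStable (F G : Matrix (Fin n) (Fin n) ℝ) : Prop :=
  ∀ M : Matrix (Fin n) (Fin n) ℝ,
    Tendsto (fun t : ℝ => NormedSpace.exp (t • lyap F G) M) atTop (𝓝 0)

theorem isInitialState_const [IsProbabilityMeasure P] (v : Fin n → ℝ) :
    IsInitialState P 𝓕 (fun _ => v) :=
  ⟨stronglyMeasurable_const, memLp_const v⟩

theorem crossMoment_const [IsProbabilityMeasure P] (v w : Fin n → ℝ) :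
    crossMoment P (fun _ => v) (fun _ => w) = Matrix.vecMulVec v w := by
  ext i j
  simp [crossMoment_apply, Matrix.vecMulVec_apply]

theorem IsLinearSDESolution.lintegral_esq_eq [IsProbabilityMeasure P]
    (hW : IsBrownianWrt P 𝓕 W) {ξ : Ω → Fin n → ℝ} (hξ : IsInitialState P 𝓕 ξ)
    {X : ℝ≥0 → Ω → Fin n → ℝ} (hX : IsLinearSDESolution P 𝓕 W F G ξ X) (t : ℝ≥0) :
    ∫⁻ ω, ENNReal.ofReal (X t ω ⬝ᵥ X t ω) ∂P =
      ENNReal.ofReal (NormedSpace.exp ((t : ℝ) • lyap F G) (crossMoment P ξ ξ)).trace := by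
  rw [← hX.crossMoment_eq hW hξ hξ hX, ← lintegral_esq_eq_trace (hX.memLp hW hξ t)]
  simp only [esq_eq]

theorem abs_crossMoment_le {x y : Ω → Fin n → ℝ} (hx : ∀ i, MemLp (fun ω => x ω i) 2 P)
    (hy : ∀ i, MemLp (fun ω => y ω i) 2 P) (i j : Fin n) :
    |crossMoment P x y i j| ≤ (crossMoment P x x).trace + (crossMoment P y y).trace := by
  have hsq : ∀ {z : Ω → Fin n → ℝ}, (∀ i, MemLp (fun ω => z ω i) 2 P) → ∀ i,
      ∫ ω, z ω i ^ 2 ∂P ≤ (crossMoment P z z).trace := by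
    intro z hz i
    have h0 : ∀ i, 0 ≤ crossMoment P z z i i := fun i =>
      integral_nonneg fun ω => mul_self_nonneg _
    have h1 := Finset.single_le_sum (f := fun i => crossMoment P z z i i) (fun i _ => h0 i)
      (Finset.mem_univ i)
    simpa [crossMoment_apply, Matrix.trace, sq] using h1
  have h1 := (hx i).integrable_sq
  have h2 := (hy j).integrable_sq
  calc |crossMoment P x y i j| ≤ ∫ ω, |x ω i * y ω j| ∂P := abs_integral_le_integral_abs
    _ ≤ ∫ ω, (x ω i ^ 2 + y ω j ^ 2) ∂P := by
        refine integral_mono ((hx i).integrable_mul (hy j)).abs (h1.add h2) fun ω => ?_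
        simp only [abs_mul]
        nlinarith [sq_nonneg (|x ω i| - |y ω j|), sq_abs (x ω i), sq_abs (y ω j),
          sq_nonneg (x ω i), sq_nonneg (y ω j)]
    _ = ∫ ω, x ω i ^ 2 ∂P + ∫ ω, y ω j ^ 2 ∂P := integral_add h1 h2
    _ ≤ _ := add_le_add (hsq hx i) (hsq hy j)

theorem tendsto_trace {κ : Type*} {l : Filter κ} {M : κ → Matrix (Fin n) (Fin n) ℝ}
    {N : Matrix (Fin n) (Fin n) ℝ} (h : Tendsto M l (𝓝 N)) :
    Tendsto (fun a => (M a).trace) l (𝓝 N.trace) :=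
  tendsto_finsetSum _ fun i _ => tendsto_matrix_apply h i i

/-- Convergence to zero on the rank one matrices `v vᵀ` already gives stability: the entries of the
matrix of mixed moments are controlled by the second moments of the states started at two
deterministic vectors. -/
theorem isStable_of_tendsto_trace [IsProbabilityMeasure P] (hW : IsBrownianWrt P 𝓕 W)
    (h : ∀ v : Fin n → ℝ, Tendsto (fun t : ℝ≥0 => (NormedSpace.exp ((t : ℝ) • lyap F G)
      (Matrix.vecMulVec v v)).trace) atTop (𝓝 0)) : IsStable F G := by
  have hvw : ∀ v w : Fin n → ℝ, Tendsto (fun t : ℝ≥0 => NormedSpace.exp ((t : ℝ) • lyap F G)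
      (Matrix.vecMulVec v w)) atTop (𝓝 0) := by
    intro v w
    have hv : IsInitialState P 𝓕 (fun _ => v) := isInitialState_const v
    have hw : IsInitialState P 𝓕 (fun _ => w) := isInitialState_const w
    have hX := isLinearSDESolution_eulerLimit hW F G hv
    have hY := isLinearSDESolution_eulerLimit hW F G hw
    refine tendsto_matrix fun i j => ?_
    refine squeeze_zero_norm (fun t => ?_) (by simpa using (h v).add (h w))
    have := abs_crossMoment_le (hX.memLp hW hv t) (hY.memLp hW hw t) i j
    rwa [hX.crossMoment_eq hW hv hw hY, hX.crossMoment_eq hW hv hv hX,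
      hY.crossMoment_eq hW hw hw hY, crossMoment_const, crossMoment_const,
      crossMoment_const] at this
  intro M
  have hM : Tendsto (fun t : ℝ≥0 => NormedSpace.exp ((t : ℝ) • lyap F G) M) atTop (𝓝 0) := by
    have e : M = ∑ i, ∑ j, M i j • Matrix.vecMulVec (Pi.single i 1) (Pi.single j 1) := by
      conv_lhs => rw [Matrix.matrix_eq_sum_single M]
      refine Finset.sum_congr rfl fun i _ => Finset.sum_congr rfl fun j _ => ?_
      rw [← Matrix.single_eq_single_vecMulVec_single, Matrix.smul_single, smul_eq_mul, mul_one]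
    have h0 : (0 : Matrix (Fin n) (Fin n) ℝ) = ∑ i : Fin n, ∑ j : Fin n, M i j • 0 := by simp
    rw [h0, e]
    simp only [map_sum, map_smul]
    rw [← e]
    exact tendsto_finsetSum _ fun i _ => tendsto_finsetSum _ fun j _ => (hvw _ _).const_smul _
  refine (hM.comp tendsto_real_toNNReal_atTop).congr' ?_
  filter_upwards [eventually_ge_atTop 0] with t ht
  simp [Real.coe_toNNReal t ht]

/-- The stabilizers are the feedbacks for which the semigroup of second moments vanishes at
infinity. -/
theorem mem_stabilizers_iff [IsProbabilityMeasure P] (hW : IsBrownianWrt P 𝓕 W) {m : ℕ}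
    (S : LQData n m) (K : Matrix (Fin m) (Fin n) ℝ) :
    K ∈ stabilizers P 𝓕 W S ↔ IsStable (S.A + S.B * K) (S.C + S.D * K) := by
  constructor
  · intro h
    refine isStable_of_tendsto_trace hW fun v => ?_
    have hv : IsInitialState P 𝓕 (fun _ => v) := isInitialState_const v
    have hX := isLinearSDESolution_eulerLimit hW (S.A + S.B * K) (S.C + S.D * K) hv
    have h1 := h _ _ hv hX
    simp only [hX.lintegral_esq_eq hW hv, crossMoment_const] at h1
    refine ((ENNReal.tendsto_toReal ENNReal.zero_ne_top).comp h1).congr fun t => ?_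
    rw [Function.comp_apply, ENNReal.toReal_ofReal]
    rw [← crossMoment_const (P := P), ← hX.crossMoment_eq hW hv hv hX]
    exact Finset.sum_nonneg fun i _ => integral_nonneg fun ω => mul_self_nonneg _
  · intro h ξ X hξ hX
    simp only [IsLinearSDESolution.lintegral_esq_eq hW hξ hX]
    have := ENNReal.tendsto_ofReal (tendsto_trace (h (crossMoment P ξ ξ)))
    rw [Matrix.trace_zero, ENNReal.ofReal_zero] at this
    exact this.comp (NNReal.tendsto_coe_atTop.2 tendsto_id)

theorem lintegral_quadratic_eq [SFinite P] {x : Ω → Fin n → ℝ}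
    (hx : ∀ i, MemLp (fun ω => x ω i) 2 P) {N : Matrix (Fin n) (Fin n) ℝ} (hN : N.PosSemidef) :
    ∫⁻ ω, ENNReal.ofReal (x ω ⬝ᵥ (N *ᵥ x ω)) ∂P =
      ENNReal.ofReal (N * crossMoment P x x).trace := by
  have hi : ∀ i, Integrable (fun ω => x ω i * (N *ᵥ x ω) i) P := fun i =>
    (hx i).integrable_mul (memLp_mulVec hx N i)
  have hij : ∀ i j, Integrable (fun ω => x ω i * (N i j * x ω j)) P := fun i j =>
    (hx i).integrable_mul ((hx j).const_mul _)
  rw [← ofReal_integral_eq_lintegral_ofReal]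
  · congr 1
    simp only [dotProduct]
    rw [integral_finsetSum _ fun i _ => hi i, Matrix.trace]
    refine Finset.sum_congr rfl fun i _ => ?_
    rw [Matrix.diag_apply, Matrix.mul_apply]
    simp only [Matrix.mulVec, dotProduct, Finset.mul_sum]
    rw [integral_finsetSum _ fun j _ => hij i j]
    refine Finset.sum_congr rfl fun j _ => ?_
    rw [crossMoment_apply, ← integral_const_mul]
    exact integral_congr_ae (Eventually.of_forall fun ω => by ring)
  · exact integrable_finsetSum _ fun i _ => hi i
  · refine Eventually.of_forall fun ω => ?_
    simpa using hN.dotProduct_mulVec_nonneg (x ω)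

/-- The cost is the time integral of a linear functional of the second moments. -/
theorem cost_eq_lintegral [IsProbabilityMeasure P] (hW : IsBrownianWrt P 𝓕 W) {m : ℕ}
    (S : LQData n m) {ξ : Ω → Fin n → ℝ} (hξ : IsInitialState P 𝓕 ξ)
    (K : Matrix (Fin m) (Fin n) ℝ) (hN : (S.Q + Kᵀ * S.R * K).PosSemidef) :
    cost P 𝓕 W S ξ K = ∫⁻ t in Set.Ioi (0 : ℝ), ENNReal.ofReal ((S.Q + Kᵀ * S.R * K) *
      NormedSpace.exp (t • lyap (S.A + S.B * K) (S.C + S.D * K)) (secondMoment P ξ)).trace := by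
  have key : ∀ X, IsState P 𝓕 W S ξ K X → ∫⁻ ω, (∫⁻ t in Set.Ioi (0 : ℝ), ENNReal.ofReal
      (X t.toNNReal ω ⬝ᵥ ((S.Q + Kᵀ * S.R * K) *ᵥ X t.toNNReal ω))) ∂P =
      ∫⁻ t in Set.Ioi (0 : ℝ), ENNReal.ofReal ((S.Q + Kᵀ * S.R * K) *
      NormedSpace.exp (t • lyap (S.A + S.B * K) (S.C + S.D * K)) (secondMoment P ξ)).trace := by
    intro X hX
    have hXm := isMeasurableProcess_of_progressive hX.progressive
    have hm : Measurable fun p : ℝ × Ω => ENNReal.ofReal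
        (X p.1.toNNReal p.2 ⬝ᵥ ((S.Q + Kᵀ * S.R * K) *ᵥ X p.1.toNNReal p.2)) := by
      refine ENNReal.measurable_ofReal.comp ?_
      simp only [dotProduct]
      exact Finset.measurable_sum _ fun i _ =>
        ((measurable_pi_apply i).comp hXm).mul (hXm.mulVec _ i)
    have hm' : AEMeasurable (Function.uncurry fun (ω : Ω) (t : ℝ) => ENNReal.ofReal
        (X t.toNNReal ω ⬝ᵥ ((S.Q + Kᵀ * S.R * K) *ᵥ X t.toNNReal ω)))
        (P.prod (volume.restrict (Set.Ioi (0 : ℝ)))) := (hm.comp measurable_swap).aemeasurable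
    rw [lintegral_lintegral_swap hm']
    refine setLIntegral_congr_fun measurableSet_Ioi fun t ht => ?_
    have ht' : (0 : ℝ) ≤ t := le_of_lt ht
    rw [lintegral_quadratic_eq (IsLinearSDESolution.memLp hW hξ hX _) hN,
      IsLinearSDESolution.crossMoment_eq hW hξ hξ hX hX, Real.coe_toNNReal t ht']
    rfl
  refine le_antisymm ?_ (le_iInf₂ fun X hX => (key X hX).ge)
  exact (iInf₂_le _ (isLinearSDESolution_eulerLimit hW _ _ hξ)).trans
    (key _ (isLinearSDESolution_eulerLimit hW _ _ hξ)).le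

end Moments

/-! ### Quadratic forms, eigenvalues and traces -/

section QuadraticForms

variable {k l n : ℕ}

/-- The Euclidean norm of a vector. -/
noncomputable def vnorm (x : Fin k → ℝ) : ℝ := ‖(WithLp.toLp 2 x : EuclideanSpace ℝ (Fin k))‖

theorem vnorm_nonneg (x : Fin k → ℝ) : 0 ≤ vnorm x := norm_nonneg _

theorem vnorm_sq (x : Fin k → ℝ) : vnorm x ^ 2 = x ⬝ᵥ x := by
  rw [vnorm, EuclideanSpace.norm_sq_eq]
  simp [dotProduct, sq]

theorem abs_dotProduct_le (x y : Fin k → ℝ) : |x ⬝ᵥ y| ≤ vnorm x * vnorm y := by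
  have := abs_real_inner_le_norm (WithLp.toLp 2 y : EuclideanSpace ℝ (Fin k)) (WithLp.toLp 2 x)
  rw [EuclideanSpace.inner_toLp_toLp] at this
  simpa [vnorm, mul_comm] using this

theorem vnorm_add_le (x y : Fin k → ℝ) : vnorm (x + y) ≤ vnorm x + vnorm y := by
  simpa [vnorm] using norm_add_le (WithLp.toLp 2 x : EuclideanSpace ℝ (Fin k)) (WithLp.toLp 2 y)

theorem specNorm_nonneg (M : Matrix (Fin k) (Fin l) ℝ) : 0 ≤ specNorm M := norm_nonneg _

theorem vnorm_mulVec_le_specNorm (M : Matrix (Fin k) (Fin l) ℝ) (x : Fin l → ℝ) :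
    vnorm (M *ᵥ x) ≤ specNorm M * vnorm x := by
  have := (LinearMap.toContinuousLinearMap (Matrix.toEuclideanLin M)).le_opNorm
    (WithLp.toLp 2 x : EuclideanSpace ℝ (Fin l))
  simpa [vnorm, specNorm, Matrix.toLpLin_toLp] using this

theorem vnorm_mulVec_le_norm (M : Matrix (Fin k) (Fin l) ℝ) (x : Fin l → ℝ) :
    vnorm (M *ᵥ x) ≤ ‖M‖ * vnorm x := by
  refine le_of_sq_le_sq ?_ (mul_nonneg (norm_nonneg _) (vnorm_nonneg _))
  rw [mul_pow, vnorm_sq, vnorm_sq, frobenius_norm_sq, Finset.sum_mul, dotProduct]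
  refine Finset.sum_le_sum fun i _ => ?_
  have := Finset.sum_mul_sq_le_sq_mul_sq Finset.univ (fun j => M i j) x
  simpa [Matrix.mulVec, dotProduct, sq] using this

theorem specNorm_le_norm (M : Matrix (Fin k) (Fin l) ℝ) : specNorm M ≤ ‖M‖ := by
  refine ContinuousLinearMap.opNorm_le_bound _ (norm_nonneg _) fun x => ?_
  exact vnorm_mulVec_le_norm M (WithLp.ofLp x)

theorem specNorm_pos {M : Matrix (Fin k) (Fin l) ℝ} (hM : M ≠ 0) : 0 < specNorm M := by
  refine lt_of_le_of_ne (specNorm_nonneg M) fun h => hM ?_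
  have := norm_eq_zero.1 h.symm
  simpa using this

/-- If all eigenvalues are at least `c`, then so is the quadratic form. -/
theorem le_dotProduct_mulVec {M : Matrix (Fin n) (Fin n) ℝ} (hM : M.IsHermitian) {c : ℝ}
    (hc : ∀ μ ∈ spectrum ℝ M, c ≤ μ) (x : Fin n → ℝ) : c * (x ⬝ᵥ x) ≤ x ⬝ᵥ (M *ᵥ x) := by
  have hH : (M - c • (1 : Matrix (Fin n) (Fin n) ℝ)).IsHermitian := by
    refine hM.sub ?_
    simp [Matrix.IsHermitian]
  have h : (M - c • (1 : Matrix (Fin n) (Fin n) ℝ)).PosSemidef := by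
    rw [Matrix.posSemidef_iff_isHermitian_and_spectrum_nonneg]
    refine ⟨hH, fun μ hμ => ?_⟩
    have h1 : μ + c ∈ spectrum ℝ M := by
      rw [← Algebra.algebraMap_eq_smul_one] at hμ
      rw [spectrum.add_mem_iff, neg_add_eq_sub]
      exact hμ
    have := hc _ h1
    simp only [Set.mem_ofPred_eq]
    linarith
  have := h.dotProduct_mulVec_nonneg x
  simp [Matrix.sub_mulVec, dotProduct_sub, Matrix.smul_mulVec] at this
  linarith

theorem finite_spectrum {M : Matrix (Fin n) (Fin n) ℝ} (hM : M.IsHermitian) :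
    (spectrum ℝ M).Finite := by
  rw [hM.spectrum_real_eq_range_eigenvalues]
  exact Set.finite_range _

theorem minEig_mul_le {M : Matrix (Fin n) (Fin n) ℝ} (hM : M.IsHermitian) (x : Fin n → ℝ) :
    minEig M * (x ⬝ᵥ x) ≤ x ⬝ᵥ (M *ᵥ x) :=
  le_dotProduct_mulVec hM (fun _ hμ => csInf_le (finite_spectrum hM).bddBelow hμ) x

theorem le_maxEig_mul {M : Matrix (Fin n) (Fin n) ℝ} (hM : M.IsHermitian) (x : Fin n → ℝ) :
    x ⬝ᵥ (M *ᵥ x) ≤ maxEig M * (x ⬝ᵥ x) := by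
  have h : ∀ μ ∈ spectrum ℝ (-M), -maxEig M ≤ μ := by
    intro μ hμ
    rw [← spectrum.neg_eq, Set.mem_neg] at hμ
    have := le_csSup (finite_spectrum hM).bddAbove hμ
    change -sSup _ ≤ μ
    linarith
  have := le_dotProduct_mulVec hM.neg h x
  simp only [Matrix.neg_mulVec, dotProduct_neg] at this
  linarith

theorem minEig_pos [NeZero n] {M : Matrix (Fin n) (Fin n) ℝ} (hM : M.PosDef) : 0 < minEig M := by
  have hne : (spectrum ℝ M).Nonempty := by
    rw [hM.1.spectrum_real_eq_range_eigenvalues]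
    exact Set.range_nonempty _
  have := hne.csInf_mem (finite_spectrum hM.1)
  rw [hM.1.spectrum_real_eq_range_eigenvalues] at this
  obtain ⟨i, hi⟩ := this
  unfold minEig
  rw [hM.1.spectrum_real_eq_range_eigenvalues, ← hi]
  exact hM.eigenvalues_pos i

theorem minEig_le_maxEig [NeZero n] {M : Matrix (Fin n) (Fin n) ℝ} (hM : M.IsHermitian) :
    minEig M ≤ maxEig M := by
  have hne : (spectrum ℝ M).Nonempty := by
    rw [hM.spectrum_real_eq_range_eigenvalues]
    exact Set.range_nonempty _
  exact csInf_le_csSup hne (finite_spectrum hM).bddBelow (finite_spectrum hM).bddAbove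

/-- A positive definite quadratic form is bounded below. The statement covers dimension `0`, where
`minEig` is not positive. -/
theorem exists_pos_mul_le {M : Matrix (Fin n) (Fin n) ℝ} (hM : M.PosDef) :
    ∃ c : ℝ, 0 < c ∧ ∀ x : Fin n → ℝ, c * (x ⬝ᵥ x) ≤ x ⬝ᵥ (M *ᵥ x) := by
  rcases Nat.eq_zero_or_pos n with rfl | hn
  · exact ⟨1, one_pos, fun x => by simp [dotProduct]⟩
  · have : NeZero n := ⟨hn.ne'⟩
    exact ⟨minEig M, minEig_pos hM, minEig_mul_le hM.1⟩

theorem exists_eq_sum_vecMulVec {M : Matrix (Fin n) (Fin n) ℝ} (hM : M.PosSemidef) :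
    ∃ (m : ℕ) (v : Fin m → Fin n → ℝ), M = ∑ i, Matrix.vecMulVec (v i) (v i) := by
  simpa using Matrix.posSemidef_iff_eq_sum_vecMulVec.1 hM

theorem trace_mul_vecMulVec (N : Matrix (Fin n) (Fin n) ℝ) (v : Fin n → ℝ) :
    (N * Matrix.vecMulVec v v).trace = v ⬝ᵥ (N *ᵥ v) := by
  rw [Matrix.mul_vecMulVec, Matrix.trace_vecMulVec, dotProduct_comm]

theorem trace_mul_le_trace_mul {Y Z M : Matrix (Fin n) (Fin n) ℝ} (hM : M.PosSemidef)
    (h : ∀ x : Fin n → ℝ, x ⬝ᵥ (Y *ᵥ x) ≤ x ⬝ᵥ (Z *ᵥ x)) : (Y * M).trace ≤ (Z * M).trace := by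
  obtain ⟨m, v, rfl⟩ := exists_eq_sum_vecMulVec hM
  simp only [Finset.mul_sum, Matrix.trace_sum, trace_mul_vecMulVec]
  exact Finset.sum_le_sum fun i _ => h _

theorem mul_trace_le {Z M : Matrix (Fin n) (Fin n) ℝ} (hM : M.PosSemidef) {c : ℝ}
    (h : ∀ x : Fin n → ℝ, c * (x ⬝ᵥ x) ≤ x ⬝ᵥ (Z *ᵥ x)) : c * M.trace ≤ (Z * M).trace := by
  have := trace_mul_le_trace_mul (Y := c • 1) hM fun x => by
    simpa [Matrix.smul_mulVec] using h x
  simpa using this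

theorem trace_mul_le {Z M : Matrix (Fin n) (Fin n) ℝ} (hM : M.PosSemidef) {c : ℝ}
    (h : ∀ x : Fin n → ℝ, x ⬝ᵥ (Z *ᵥ x) ≤ c * (x ⬝ᵥ x)) : (Z * M).trace ≤ c * M.trace := by
  have := trace_mul_le_trace_mul (Z := c • 1) hM fun x => by
    simpa [Matrix.smul_mulVec] using h x
  simpa using this

theorem abs_trace_mul_le {Z M : Matrix (Fin n) (Fin n) ℝ} (hM : M.PosSemidef) {c : ℝ}
    (h : ∀ x : Fin n → ℝ, |x ⬝ᵥ (Z *ᵥ x)| ≤ c * (x ⬝ᵥ x)) : |(Z * M).trace| ≤ c * M.trace := by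
  rw [abs_le]
  refine ⟨?_, trace_mul_le hM fun x => (abs_le.1 (h x)).2⟩
  have := mul_trace_le (c := -c) hM fun x => by
    rw [neg_mul]
    exact (abs_le.1 (h x)).1
  linarith

theorem trace_mul_nonneg {N M : Matrix (Fin n) (Fin n) ℝ} (hN : N.PosSemidef)
    (hM : M.PosSemidef) : 0 ≤ (N * M).trace := by
  have := mul_trace_le (Z := N) (c := 0) hM fun x => by
    simpa using hN.dotProduct_mulVec_nonneg x
  simpa using this

theorem posSemidef_of_forall {M : Matrix (Fin n) (Fin n) ℝ} (hs : Mᵀ = M)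
    (h : ∀ x : Fin n → ℝ, 0 ≤ x ⬝ᵥ (M *ᵥ x)) : M.PosSemidef :=
  Matrix.PosSemidef.of_dotProduct_mulVec_nonneg (by simpa [Matrix.IsHermitian] using hs)
    fun x => by simpa using h x

theorem transpose_eq_of_posSemidef {M : Matrix (Fin n) (Fin n) ℝ} (hM : M.PosSemidef) :
    Mᵀ = M := by simpa [Matrix.IsHermitian] using hM.1

theorem posSemidef_vecMulVec (v : Fin n → ℝ) : (Matrix.vecMulVec v v).PosSemidef := by
  simpa using Matrix.posSemidef_vecMulVec_self_star v

theorem norm_le_trace {M : Matrix (Fin n) (Fin n) ℝ} (hM : M.PosSemidef) : ‖M‖ ≤ M.trace := by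
  obtain ⟨m, v, rfl⟩ := exists_eq_sum_vecMulVec hM
  rw [Matrix.trace_sum]
  refine norm_sum_le_of_le _ fun i _ => ?_
  rw [Matrix.trace_vecMulVec]
  refine le_of_sq_le_sq ?_ (by simpa using (Matrix.posSemidef_vecMulVec_self_star (v i)).trace_nonneg)
  rw [frobenius_norm_sq, sq, dotProduct, Finset.sum_mul_sum]
  refine Finset.sum_le_sum fun a _ => Finset.sum_le_sum fun b _ => ?_
  rw [Matrix.vecMulVec_apply]
  exact le_of_eq (by ring)

theorem isClosed_posSemidef {κ : Type*} {l : Filter κ} [l.NeBot]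
    {M : κ → Matrix (Fin n) (Fin n) ℝ} {N : Matrix (Fin n) (Fin n) ℝ}
    (h : ∀ a, (M a).PosSemidef) (hlim : Tendsto M l (𝓝 N)) : N.PosSemidef := by
  refine posSemidef_of_forall ?_ fun x => ?_
  · ext i j
    refine tendsto_nhds_unique (tendsto_matrix_apply hlim j i) ?_
    refine (tendsto_matrix_apply hlim i j).congr fun a => ?_
    exact congrFun (congrFun (transpose_eq_of_posSemidef (h a)) j) i
  · have : Tendsto (fun a => x ⬝ᵥ (M a *ᵥ x)) l (𝓝 (x ⬝ᵥ (N *ᵥ x))) := by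
      simp only [Matrix.mulVec, dotProduct]
      exact tendsto_finsetSum _ fun i _ => (tendsto_finsetSum _ fun j _ =>
        (tendsto_matrix_apply hlim i j).mul_const _).const_mul _
    exact ge_of_tendsto' this fun a => by simpa using (h a).dotProduct_mulVec_nonneg x

end QuadraticForms

section Lyapunov

attribute [local instance] frobTop

variable {n : ℕ} {F G : Matrix (Fin n) (Fin n) ℝ}

/-! ### The moment semigroup -/

theorem clm_mul_apply {E : Type*} [NormedAddCommGroup E] [NormedSpace ℝ E] (S T : E →L[ℝ] E)
    (x : E) : (S * T) x = S (T x) := rfl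

theorem hasDerivAt_exp_lyap (F G M : Matrix (Fin n) (Fin n) ℝ) (t : ℝ) :
    HasDerivAt (fun t : ℝ => NormedSpace.exp (t • lyap F G) M)
      (NormedSpace.exp (t • lyap F G) (lyap F G M)) t :=
  (hasDerivAt_exp_smul_const (𝕂 := ℝ) (lyap F G) t).clm_apply (hasDerivAt_const t M) |>.congr_deriv
    (by simp)

theorem step_apply (F G M : Matrix (Fin n) (Fin n) ℝ) (h : ℝ) :
    (1 + h • lyap F G + h ^ 2 • congruence F) M =
      (1 + h • F) * M * (1 + h • F)ᵀ + h • (G * M * Gᵀ) := by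
  have : (1 + h • lyap F G + h ^ 2 • congruence F) M =
      M + h • (F * M + M * Fᵀ + G * M * Gᵀ) + h ^ 2 • (F * M * Fᵀ) := rfl
  rw [this]
  simp only [Matrix.transpose_add, Matrix.transpose_one, Matrix.transpose_smul, add_mul, mul_add,
    one_mul, mul_one, smul_add, Matrix.smul_mul, Matrix.mul_smul, smul_smul, sq]
  abel

/-- The moment semigroup preserves positivity, as do its approximations
`M ↦ (1 + h F) M (1 + h F)ᵀ + h G M Gᵀ`. -/
theorem posSemidef_exp_lyap {M : Matrix (Fin n) (Fin n) ℝ} (hM : M.PosSemidef) {t : ℝ}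
    (ht : 0 ≤ t) : (NormedSpace.exp (t • lyap F G) M).PosSemidef := by
  have h := ((ContinuousLinearMap.apply ℝ _ M).continuous.tendsto _).comp
    (tendsto_step_pow (lyap F G) (congruence F) ht)
  refine isClosed_posSemidef (fun N => ?_) h
  have hpow : ∀ k : ℕ, (((1 + (t / N) • lyap F G + (t / N) ^ 2 • congruence F) ^ k) M).PosSemidef := by
    intro k
    induction k with
    | zero => simpa using hM
    | succ k ih =>
      rw [pow_succ', clm_mul_apply, step_apply]
      refine Matrix.PosSemidef.add ?_ (Matrix.PosSemidef.smul ?_ (by positivity))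
      · rw [← Matrix.conjTranspose_eq_transpose_of_trivial]
        exact ih.mul_mul_conjTranspose_same _
      · rw [← Matrix.conjTranspose_eq_transpose_of_trivial]
        exact ih.mul_mul_conjTranspose_same _
  exact hpow N

theorem norm_clm_le (T : Matrix (Fin n) (Fin n) ℝ →L[ℝ] Matrix (Fin n) (Fin n) ℝ) :
    ‖T‖ ≤ ∑ i, ∑ j, ‖T (Matrix.single i j 1)‖ := by
  refine T.opNorm_le_bound (by positivity) fun M => ?_
  conv_lhs => rw [Matrix.matrix_eq_sum_single M]
  simp only [map_sum, Finset.sum_mul]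
  refine norm_sum_le_of_le _ fun i _ => norm_sum_le_of_le _ fun j _ => ?_
  have : Matrix.single i j (M i j) = M i j • Matrix.single i j (1 : ℝ) := by
    rw [Matrix.smul_single, smul_eq_mul, mul_one]
  rw [this, map_smul, norm_smul, mul_comm]
  gcongr
  exact abs_apply_le_norm M i j

theorem IsStable.tendsto_norm (h : IsStable F G) :
    Tendsto (fun t : ℝ => ‖NormedSpace.exp (t • lyap F G)‖) atTop (𝓝 0) := by
  refine squeeze_zero (fun t => norm_nonneg _) (fun t => norm_clm_le _) ?_
  have : Tendsto (fun t : ℝ => ∑ i, ∑ j, ‖NormedSpace.exp (t • lyap F G)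
      (Matrix.single i j (1 : ℝ))‖) atTop (𝓝 (∑ _i : Fin n, ∑ _j : Fin n, 0)) :=
    tendsto_finsetSum _ fun i _ => tendsto_finsetSum _ fun j _ =>
      tendsto_zero_iff_norm_tendsto_zero.1 (h _)
  simpa using this

/-- A semigroup that contracts at some time is stable. -/
theorem isStable_of_norm_lt_one {T : ℝ} (hT : 0 < T)
    (h : ‖NormedSpace.exp (T • lyap F G)‖ < 1) : IsStable F G := by
  set L := lyap F G with hL
  obtain ⟨c, hc⟩ := (isCompact_Icc (a := (0 : ℝ)) (b := T)).exists_bound_of_continuousOn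
    (f := fun t : ℝ => NormedSpace.exp (t • L)) (by
      intro t _
      exact (hasDerivAt_exp_smul_const (𝕂 := ℝ) L t).continuousAt.continuousWithinAt)
  intro M
  have hq : Tendsto (fun t : ℝ => ‖NormedSpace.exp (T • L)‖ ^ ⌊t / T⌋₊ * (c * ‖M‖)) atTop (𝓝 0) := by
    rw [← zero_mul (c * ‖M‖)]
    exact ((tendsto_pow_atTop_nhds_zero_of_lt_one (norm_nonneg _) h).comp
      (tendsto_nat_floor_atTop.comp (tendsto_id.atTop_div_const hT))).mul_const _
  refine squeeze_zero_norm' ?_ hq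
  filter_upwards [eventually_ge_atTop 0] with t ht
  have h1 : (⌊t / T⌋₊ : ℝ) * T ≤ t := by
    rw [← le_div_iff₀ hT]
    exact Nat.floor_le (by positivity)
  have h2 : t < (⌊t / T⌋₊ + 1) * T := by
    rw [← div_lt_iff₀ hT]
    exact Nat.lt_floor_add_one _
  have e : NormedSpace.exp (t • L) = NormedSpace.exp (T • L) ^ ⌊t / T⌋₊ *
      NormedSpace.exp ((t - ⌊t / T⌋₊ * T) • L) := by
    rw [exp_smul_pow, ← exp_add_smul]
    congr 2
    ring
  rw [e, clm_mul_apply]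
  have h3 : ‖NormedSpace.exp ((t - ⌊t / T⌋₊ * T) • L)‖ ≤ c :=
    hc _ ⟨by linarith, by linarith⟩
  calc _ ≤ ‖NormedSpace.exp (T • L) ^ ⌊t / T⌋₊‖ *
        ‖NormedSpace.exp ((t - ⌊t / T⌋₊ * T) • L) M‖ := ContinuousLinearMap.le_opNorm _ _
    _ ≤ _ := by
        gcongr
        · rcases Nat.eq_zero_or_pos ⌊t / T⌋₊ with h0 | h0
          · rw [h0, pow_zero, pow_zero]
            exact ContinuousLinearMap.norm_id_le
          · exact norm_pow_le' _ h0
        · exact (ContinuousLinearMap.le_opNorm _ _).trans (by gcongr)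

/-! ### The Lyapunov equation -/

theorem IsStable.isUnit (h : IsStable F G) : IsUnit (lyap F G) := by
  have hinj : Function.Injective (lyap F G) := by
    rw [injective_iff_map_eq_zero]
    intro M hM
    have hd : ∀ t : ℝ, HasDerivAt (fun t : ℝ => NormedSpace.exp (t • lyap F G) M) 0 t := fun t => by
      simpa [hM] using hasDerivAt_exp_lyap F G M t
    have hconst : ∀ t : ℝ, NormedSpace.exp (t • lyap F G) M = M := fun t => by
      have := is_const_of_deriv_eq_zero (fun t => (hd t).differentiableAt)
        (fun t => (hd t).deriv) t 0
      simpa using this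
    have h0 := h M
    simp only [hconst] at h0
    exact tendsto_nhds_unique tendsto_const_nhds h0
  rw [ContinuousLinearMap.isUnit_iff_bijective]
  exact ⟨hinj, (LinearMap.injective_iff_surjective (f := (lyap F G).toLinearMap)).1 hinj⟩

/-- The solution `X` of the Lyapunov equation `F X + X Fᵀ + G X Gᵀ = -M`. It is meaningful if
`lyap F G` is invertible. -/
noncomputable def lyapInv (F G M : Matrix (Fin n) (Fin n) ℝ) : Matrix (Fin n) (Fin n) ℝ :=
  -(Ring.inverse (lyap F G) M)

theorem lyap_lyapInv (h : IsUnit (lyap F G)) (M : Matrix (Fin n) (Fin n) ℝ) :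
    lyap F G (lyapInv F G M) = -M := by
  rw [lyapInv, map_neg, ← clm_mul_apply, Ring.mul_inverse_cancel _ h]
  simp

theorem eq_lyapInv (h : IsUnit (lyap F G)) {X M : Matrix (Fin n) (Fin n) ℝ}
    (hX : lyap F G X = -M) : X = lyapInv F G M := by
  have : Ring.inverse (lyap F G) (lyap F G X) = X := by
    rw [← clm_mul_apply, Ring.inverse_mul_cancel _ h]
    simp
  rw [lyapInv, ← map_neg, ← hX, this]

theorem lyap_transpose (F G M : Matrix (Fin n) (Fin n) ℝ) : lyap F G Mᵀ = (lyap F G M)ᵀ := by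
  simp only [lyap_apply, Matrix.transpose_add, Matrix.transpose_mul, Matrix.transpose_transpose,
    Matrix.mul_assoc]
  abel

theorem lyapInv_transpose (h : IsUnit (lyap F G)) (M : Matrix (Fin n) (Fin n) ℝ) :
    (lyapInv F G M)ᵀ = lyapInv F G Mᵀ := by
  refine eq_lyapInv h ?_
  rw [lyap_transpose, lyap_lyapInv h, Matrix.transpose_neg]

theorem trace_mul_lyap (F G N M : Matrix (Fin n) (Fin n) ℝ) :
    (N * lyap F G M).trace = (lyap Fᵀ Gᵀ N * M).trace := by
  simp only [lyap_apply, mul_add, add_mul, Matrix.trace_add, Matrix.transpose_transpose]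
  have e1 : (N * (M * Fᵀ)).trace = (Fᵀ * N * M).trace := by
    rw [← Matrix.mul_assoc, Matrix.trace_mul_comm, Matrix.mul_assoc]
  have e2 : (N * (G * M * Gᵀ)).trace = (Gᵀ * N * G * M).trace := by
    rw [← Matrix.mul_assoc, Matrix.trace_mul_comm]
    simp only [Matrix.mul_assoc]
  rw [e1, e2, ← Matrix.mul_assoc]
  ring

theorem isUnit_lyap_transpose (h : IsUnit (lyap F G)) : IsUnit (lyap Fᵀ Gᵀ) := by
  have hinj : Function.Injective (lyap Fᵀ Gᵀ) := by
    rw [injective_iff_map_eq_zero]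
    intro N hN
    have h0 : ∀ M, (N * M).trace = 0 := fun M => by
      have := trace_mul_lyap F G N (lyapInv F G M)
      rw [hN, lyap_lyapInv h] at this
      simpa using this
    have h1 : ‖N‖ ^ 2 = 0 := by
      rw [← h0 Nᵀ, frobenius_norm_sq]
      simp [Matrix.trace, Matrix.mul_apply, sq]
    simpa using h1
  rw [ContinuousLinearMap.isUnit_iff_bijective]
  exact ⟨hinj, (LinearMap.injective_iff_surjective (f := (lyap Fᵀ Gᵀ).toLinearMap)).1 hinj⟩

theorem trace_mul_lyapInv (h : IsUnit (lyap F G)) (N M : Matrix (Fin n) (Fin n) ℝ) :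
    (N * lyapInv F G M).trace = (lyapInv Fᵀ Gᵀ N * M).trace := by
  have h1 := trace_mul_lyap F G (lyapInv Fᵀ Gᵀ N) (lyapInv F G M)
  rw [lyap_lyapInv h, lyap_lyapInv (isUnit_lyap_transpose h)] at h1
  simp only [Matrix.mul_neg, Matrix.neg_mul, Matrix.trace_neg, neg_inj] at h1
  exact h1.symm

theorem hasDerivAt_trace_mul {f : ℝ → Matrix (Fin n) (Fin n) ℝ} {f' : Matrix (Fin n) (Fin n) ℝ}
    {t : ℝ} (hf : HasDerivAt f f' t) (N : Matrix (Fin n) (Fin n) ℝ) :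
    HasDerivAt (fun t => (N * f t).trace) (N * f').trace t :=
  (LinearMap.toContinuousLinearMap ((Matrix.traceLinearMap (Fin n) ℝ ℝ) ∘ₗ
    (LinearMap.mulLeft ℝ N))).hasFDerivAt.comp_hasDerivAt t hf

theorem continuous_trace_mul (N : Matrix (Fin n) (Fin n) ℝ) :
    Continuous fun M : Matrix (Fin n) (Fin n) ℝ => (N * M).trace :=
  (LinearMap.toContinuousLinearMap ((Matrix.traceLinearMap (Fin n) ℝ ℝ) ∘ₗ
    (LinearMap.mulLeft ℝ N))).continuous

theorem IsStable.lintegral_eq_and_nonneg (h : IsStable F G) {N M : Matrix (Fin n) (Fin n) ℝ}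
    (hN : N.PosSemidef) (hM : M.PosSemidef) :
    ∫⁻ t in Set.Ioi (0 : ℝ), ENNReal.ofReal (N * NormedSpace.exp (t • lyap F G) M).trace =
      ENNReal.ofReal (N * lyapInv F G M).trace ∧ 0 ≤ (N * lyapInv F G M).trace := by
  set g : ℝ → ℝ := fun t => -(N * NormedSpace.exp (t • lyap F G) (lyapInv F G M)).trace with hg
  have hd : ∀ t, HasDerivAt g (N * NormedSpace.exp (t • lyap F G) M).trace t := fun t => by
    have := (hasDerivAt_trace_mul (hasDerivAt_exp_lyap F G (lyapInv F G M) t) N).neg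
    refine this.congr_deriv ?_
    rw [lyap_lyapInv h.isUnit, map_neg]
    simp
  have hpos : ∀ t ∈ Set.Ioi (0 : ℝ), 0 ≤ (N * NormedSpace.exp (t • lyap F G) M).trace :=
    fun t ht => trace_mul_nonneg hN (posSemidef_exp_lyap hM (le_of_lt ht))
  have hlim : Tendsto g atTop (𝓝 0) := by
    have := (((continuous_trace_mul N).tendsto 0).comp (h (lyapInv F G M))).neg
    simpa using this
  have hint := integral_Ioi_of_hasDerivAt_of_nonneg' (a := 0) (fun t _ => hd t) hpos hlim
  have hg0 : g 0 = -(N * lyapInv F G M).trace := by simp [hg]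
  rw [hg0, zero_sub, neg_neg] at hint
  constructor
  · rw [← hint, ofReal_integral_eq_lintegral_ofReal]
    · exact integrableOn_Ioi_deriv_of_nonneg' (fun t _ => hd t) hpos hlim
    · exact (ae_restrict_iff' measurableSet_Ioi).2 (Eventually.of_forall hpos)
  · rw [← hint]
    exact setIntegral_nonneg measurableSet_Ioi hpos

theorem dotProduct_mulVec_eq_trace (M : Matrix (Fin n) (Fin n) ℝ) (x : Fin n → ℝ) :
    x ⬝ᵥ (M *ᵥ x) = (Matrix.vecMulVec x x * M).trace := by
  rw [Matrix.trace_mul_comm, trace_mul_vecMulVec]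

theorem IsStable.posSemidef_lyapInv (h : IsStable F G) {M : Matrix (Fin n) (Fin n) ℝ}
    (hM : M.PosSemidef) : (lyapInv F G M).PosSemidef := by
  refine posSemidef_of_forall ?_ fun x => ?_
  · rw [lyapInv_transpose h.isUnit, transpose_eq_of_posSemidef hM]
  · rw [dotProduct_mulVec_eq_trace]
    exact (h.lintegral_eq_and_nonneg (posSemidef_vecMulVec x) hM).2

theorem IsStable.posSemidef_lyapInv_transpose (h : IsStable F G) {N : Matrix (Fin n) (Fin n) ℝ}
    (hN : N.PosSemidef) : (lyapInv Fᵀ Gᵀ N).PosSemidef := by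
  refine posSemidef_of_forall ?_ fun x => ?_
  · rw [lyapInv_transpose (isUnit_lyap_transpose h.isUnit), transpose_eq_of_posSemidef hN]
  · rw [dotProduct_mulVec_eq_trace, Matrix.trace_mul_comm, ← trace_mul_lyapInv h.isUnit]
    exact trace_mul_nonneg hN (h.posSemidef_lyapInv (posSemidef_vecMulVec x))

/-- Finiteness of the integral of a positive definite functional of the second moments forces
stability. -/
theorem tendsto_trace_exp_of_lintegral_lt_top {N M : Matrix (Fin n) (Fin n) ℝ} (hN : N.PosDef)
    (hM : M.PosDef) (hfin : ∫⁻ t in Set.Ioi (0 : ℝ), ENNReal.ofReal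
      (N * NormedSpace.exp (t • lyap F G) M).trace < ∞) (v : Fin n → ℝ) :
    Tendsto (fun t : ℝ => (NormedSpace.exp (t • lyap F G) (Matrix.vecMulVec v v)).trace) atTop
      (𝓝 0) := by
  obtain ⟨c, hc, hcN⟩ := exists_pos_mul_le hN
  obtain ⟨d, hd, hdM⟩ := exists_pos_mul_le hM
  set f : ℝ → Matrix (Fin n) (Fin n) ℝ := fun t => NormedSpace.exp (t • lyap F G) M with hf
  have hfd : ∀ t, HasDerivAt f (NormedSpace.exp (t • lyap F G) (lyap F G M)) t :=
    hasDerivAt_exp_lyap F G M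
  have hcomm : ∀ t : ℝ, NormedSpace.exp (t • lyap F G) (lyap F G M) = lyap F G (f t) := fun t => by
    have h1 := (hasDerivAt_exp_smul_const (𝕂 := ℝ) (lyap F G) t).unique
      (hasDerivAt_exp_smul_const' (𝕂 := ℝ) (lyap F G) t)
    exact congrArg (fun T => T M) h1
  have hcont : Continuous f := continuous_iff_continuousAt.2 fun t => (hfd t).continuousAt
  have hpsd : ∀ t, 0 ≤ t → (f t).PosSemidef := fun t ht => posSemidef_exp_lyap hM.posSemidef ht
  have hint1 : IntegrableOn (fun t => (N * f t).trace) (Set.Ioi (0 : ℝ)) := by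
    refine ⟨((continuous_trace_mul N).comp hcont).aestronglyMeasurable, ?_⟩
    rw [hasFiniteIntegral_iff_ofReal]
    · exact hfin
    · exact (ae_restrict_iff' measurableSet_Ioi).2 (Eventually.of_forall fun t ht =>
        trace_mul_nonneg hN.posSemidef (hpsd t (le_of_lt ht)))
  have hint : IntegrableOn f (Set.Ioi (0 : ℝ)) := by
    refine Integrable.mono' (hint1.const_mul c⁻¹) hcont.aestronglyMeasurable
      ((ae_restrict_iff' measurableSet_Ioi).2 (Eventually.of_forall fun t ht => ?_))
    have hp := hpsd t (le_of_lt ht)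
    refine (norm_le_trace hp).trans ?_
    rw [← div_eq_inv_mul, le_div_iff₀ hc, mul_comm]
    exact mul_trace_le hp hcN
  have hint' : IntegrableOn (fun t : ℝ => NormedSpace.exp (t • lyap F G) (lyap F G M))
      (Set.Ioi (0 : ℝ)) := by
    simp only [hcomm]
    exact (lyap F G).integrable_comp hint
  have hlim : Tendsto f atTop (𝓝 0) :=
    tendsto_zero_of_hasDerivAt_of_integrableOn_Ioi (fun t _ => hfd t) hint' hint
  have htr := (tendsto_trace hlim).const_mul ((v ⬝ᵥ v) / d)
  rw [Matrix.trace_zero, mul_zero] at htr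
  -- `v vᵀ` is dominated by a multiple of `M`
  have hV : (((v ⬝ᵥ v) / d) • M - Matrix.vecMulVec v v).PosSemidef := by
    refine posSemidef_of_forall ?_ fun x => ?_
    · rw [Matrix.transpose_sub, Matrix.transpose_smul, transpose_eq_of_posSemidef hM.posSemidef,
        transpose_eq_of_posSemidef (posSemidef_vecMulVec v)]
    · have h1 : x ⬝ᵥ ((((v ⬝ᵥ v) / d) • M - Matrix.vecMulVec v v) *ᵥ x) =
          (v ⬝ᵥ v) / d * (x ⬝ᵥ (M *ᵥ x)) - (v ⬝ᵥ x) ^ 2 := by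
        rw [Matrix.sub_mulVec, dotProduct_sub, Matrix.smul_mulVec, dotProduct_smul,
          Matrix.vecMulVec_mulVec]
        simp [dotProduct_comm x v, sq]
      have h2 : (v ⬝ᵥ x) ^ 2 ≤ (v ⬝ᵥ v) * (x ⬝ᵥ x) := by
        rw [← vnorm_sq, ← vnorm_sq, ← mul_pow, ← sq_abs]
        exact pow_le_pow_left₀ (abs_nonneg _) (abs_dotProduct_le v x) 2
      have h3 : (v ⬝ᵥ v) * (x ⬝ᵥ x) ≤ (v ⬝ᵥ v) / d * (x ⬝ᵥ (M *ᵥ x)) := by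
        rw [div_mul_eq_mul_div, le_div_iff₀ hd, mul_assoc]
        refine mul_le_mul_of_nonneg_left ?_ (by rw [← vnorm_sq]; positivity)
        linarith [hdM x]
      rw [h1]
      linarith
  refine squeeze_zero' ?_ ?_ htr
  · filter_upwards [eventually_ge_atTop 0] with t ht
    exact (posSemidef_exp_lyap (posSemidef_vecMulVec v) ht).trace_nonneg
  · filter_upwards [eventually_ge_atTop 0] with t ht
    have := (posSemidef_exp_lyap (F := F) (G := G) hV ht).trace_nonneg
    rw [map_sub, map_smul, Matrix.trace_sub, Matrix.trace_smul, smul_eq_mul] at this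
    linarith

end Lyapunov

/-! ### Value matrix, state covariance and the increment of the cost -/

section Algebra

attribute [local instance] frobTop

variable {n m : ℕ} (S : LQData n m) (Sig : Matrix (Fin n) (Fin n) ℝ) (K : Matrix (Fin m) (Fin n) ℝ)

/-- The closed-loop drift `A + B K`. -/
def drift : Matrix (Fin n) (Fin n) ℝ := S.A + S.B * K

/-- The closed-loop diffusion `C + D K`. -/
def diffusion : Matrix (Fin n) (Fin n) ℝ := S.C + S.D * K

/-- The closed-loop weight `Q + Kᵀ R K`. -/
def weight : Matrix (Fin n) (Fin n) ℝ := S.Q + Kᵀ * S.R * K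

/-- The feedback `K` is mean-square stabilizing. -/
def Stabilizes : Prop := IsStable (drift S K) (diffusion S K)

/-- The accumulated second moments `Σ_K = E ∫₀^∞ X Xᵀ dt`. -/
noncomputable def stateCov : Matrix (Fin n) (Fin n) ℝ := lyapInv (drift S K) (diffusion S K) Sig

/-- The matrix `P_K` of the quadratic form giving the cost of `K` in terms of the initial state. -/
noncomputable def valueMat : Matrix (Fin n) (Fin n) ℝ :=
  lyapInv (drift S K)ᵀ (diffusion S K)ᵀ (weight S K)

/-- The residual `R K + Bᵀ P_K + Dᵀ P_K (C + D K)` of the stationarity condition. -/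
noncomputable def gainResidual : Matrix (Fin m) (Fin n) ℝ :=
  S.R * K + S.Bᵀ * valueMat S K + S.Dᵀ * valueMat S K * diffusion S K

/-- The input weight `R + Dᵀ P_K D`. -/
noncomputable def inputWeight : Matrix (Fin m) (Fin m) ℝ := S.R + S.Dᵀ * valueMat S K * S.D

/-- The cost `tr (Q + Kᵀ R K) Σ_K` of a stabilizing feedback. -/
noncomputable def lqCost : ℝ := (weight S K * stateCov S Sig K).trace

/-- The quadratic form `Δᵀ E_K + E_Kᵀ Δ + Δᵀ M_K Δ` that governs the change of the cost. -/
noncomputable def incrementForm (D : Matrix (Fin m) (Fin n) ℝ) : Matrix (Fin n) (Fin n) ℝ :=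
  Dᵀ * gainResidual S K + (gainResidual S K)ᵀ * D + Dᵀ * inputWeight S K * D

variable {S Sig K}

theorem posSemidef_transpose_mul_mul {k l : ℕ} {M : Matrix (Fin k) (Fin k) ℝ} (hM : M.PosSemidef)
    (N : Matrix (Fin k) (Fin l) ℝ) : (Nᵀ * M * N).PosSemidef := by
  rw [← Matrix.conjTranspose_eq_transpose_of_trivial]
  exact hM.conjTranspose_mul_mul_same N

theorem posDef_weight (hQ : S.Q.PosDef) (hR : S.R.PosDef) (K : Matrix (Fin m) (Fin n) ℝ) :
    (weight S K).PosDef :=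
  hQ.add_posSemidef (posSemidef_transpose_mul_mul hR.posSemidef K)

theorem Stabilizes.posSemidef_stateCov (h : Stabilizes S K) (hS : Sig.PosSemidef) :
    (stateCov S Sig K).PosSemidef := h.posSemidef_lyapInv hS

theorem Stabilizes.posSemidef_valueMat (h : Stabilizes S K) (hQ : S.Q.PosDef) (hR : S.R.PosDef) :
    (valueMat S K).PosSemidef :=
  h.posSemidef_lyapInv_transpose (posDef_weight hQ hR K).posSemidef

theorem Stabilizes.lyap_stateCov (h : Stabilizes S K) (Sig : Matrix (Fin n) (Fin n) ℝ) :
    lyap (drift S K) (diffusion S K) (stateCov S Sig K) = -Sig := lyap_lyapInv (IsStable.isUnit h) _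

theorem Stabilizes.lyap_valueMat (h : Stabilizes S K) :
    lyap (drift S K)ᵀ (diffusion S K)ᵀ (valueMat S K) = -weight S K :=
  lyap_lyapInv (isUnit_lyap_transpose (IsStable.isUnit h)) _

theorem Stabilizes.lqCost_eq (h : Stabilizes S K) :
    lqCost S Sig K = (valueMat S K * Sig).trace :=
  trace_mul_lyapInv (IsStable.isUnit h) _ _

theorem Stabilizes.posSemidef_inputWeight (h : Stabilizes S K) (hQ : S.Q.PosDef)
    (hR : S.R.PosDef) : (inputWeight S K).PosSemidef :=
  hR.posSemidef.add (posSemidef_transpose_mul_mul (h.posSemidef_valueMat hQ hR) S.D)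

/-- Completing the square in the Lyapunov equation of `P_K`. -/
theorem Stabilizes.lyap_valueMat_add (h : Stabilizes S K) (hQ : S.Q.PosDef) (hR : S.R.PosDef)
    (D : Matrix (Fin m) (Fin n) ℝ) :
    lyap (drift S (K + D))ᵀ (diffusion S (K + D))ᵀ (valueMat S K) + weight S (K + D) =
      incrementForm S K D := by
  have h1 := h.lyap_valueMat
  have hP := transpose_eq_of_posSemidef (h.posSemidef_valueMat hQ hR)
  have hRt := transpose_eq_of_posSemidef hR.posSemidef
  rw [incrementForm, gainResidual, inputWeight]
  have hd : drift S (K + D) = drift S K + S.B * D := by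
    rw [drift, drift, Matrix.mul_add, add_assoc]
  have hg : diffusion S (K + D) = diffusion S K + S.D * D := by
    rw [diffusion, diffusion, Matrix.mul_add, add_assoc]
  rw [hd, hg]
  generalize valueMat S K = P at *
  generalize drift S K = F at *
  generalize diffusion S K = G at *
  have h2 : lyap Fᵀ Gᵀ P + weight S K = 0 := by rw [h1]; simp
  rw [← sub_eq_zero, ← h2]
  simp only [weight, lyap_apply, Matrix.transpose_add, Matrix.transpose_mul,
    Matrix.transpose_transpose, Matrix.add_mul, Matrix.mul_add, Matrix.mul_assoc, hP, hRt]
  abel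

/-- The exact change of the cost between two stabilizing feedbacks. -/
theorem lqCost_add_sub (hQ : S.Q.PosDef) (hR : S.R.PosDef) {D : Matrix (Fin m) (Fin n) ℝ}
    (h : Stabilizes S K) (h' : Stabilizes S (K + D)) :
    lqCost S Sig (K + D) - lqCost S Sig K =
      (incrementForm S K D * stateCov S Sig (K + D)).trace := by
  rw [← h.lyap_valueMat_add hQ hR, add_mul, Matrix.trace_add, ← trace_mul_lyap, h'.lyap_stateCov,
    h.lqCost_eq, lqCost]
  simp
  ring

theorem dotProduct_transpose_mulVec {k l : ℕ} (M : Matrix (Fin k) (Fin l) ℝ) (x : Fin l → ℝ)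
    (y : Fin k → ℝ) : x ⬝ᵥ (Mᵀ *ᵥ y) = (M *ᵥ x) ⬝ᵥ y := by
  rw [Matrix.dotProduct_mulVec, Matrix.vecMul_transpose]

theorem dotProduct_incrementForm (D : Matrix (Fin m) (Fin n) ℝ) (x : Fin n → ℝ) :
    x ⬝ᵥ (incrementForm S K D *ᵥ x) = 2 * ((D *ᵥ x) ⬝ᵥ (gainResidual S K *ᵥ x)) +
      (D *ᵥ x) ⬝ᵥ (inputWeight S K *ᵥ (D *ᵥ x)) := by
  rw [incrementForm]
  simp only [Matrix.add_mulVec, dotProduct_add, ← Matrix.mulVec_mulVec, dotProduct_transpose_mulVec]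
  rw [dotProduct_comm (gainResidual S K *ᵥ x)]
  ring

theorem Stabilizes.dotProduct_inputWeight_ge (h : Stabilizes S K) (hQ : S.Q.PosDef)
    (hR : S.R.PosDef) (y : Fin m → ℝ) : y ⬝ᵥ (S.R *ᵥ y) ≤ y ⬝ᵥ (inputWeight S K *ᵥ y) := by
  have := (posSemidef_transpose_mul_mul (h.posSemidef_valueMat hQ hR) S.D).dotProduct_mulVec_nonneg y
  rw [inputWeight, Matrix.add_mulVec, dotProduct_add]
  simpa using this

/-- The change of the cost is bounded below by the square of the stationarity residual. -/
theorem Stabilizes.le_dotProduct_incrementForm (h : Stabilizes S K) (hQ : S.Q.PosDef)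
    (hR : S.R.PosDef) {r : ℝ} (hr : 0 < r) (hrR : ∀ y : Fin m → ℝ, r * (y ⬝ᵥ y) ≤ y ⬝ᵥ (S.R *ᵥ y))
    (D : Matrix (Fin m) (Fin n) ℝ) (x : Fin n → ℝ) :
    -(‖gainResidual S K‖ ^ 2 / r) * (x ⬝ᵥ x) ≤ x ⬝ᵥ (incrementForm S K D *ᵥ x) := by
  rw [dotProduct_incrementForm]
  set u := D *ᵥ x
  set w := gainResidual S K *ᵥ x with hw
  have h1 := (hrR u).trans (h.dotProduct_inputWeight_ge hQ hR u)
  have h2 := (abs_le.1 (abs_dotProduct_le u w)).1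
  have h3 : vnorm w ≤ ‖gainResidual S K‖ * vnorm x := vnorm_mulVec_le_norm _ _
  have h4 : vnorm w ^ 2 ≤ ‖gainResidual S K‖ ^ 2 * (x ⬝ᵥ x) := by
    rw [← vnorm_sq, ← mul_pow]
    exact pow_le_pow_left₀ (vnorm_nonneg _) h3 2
  have h5 : -(vnorm w ^ 2 / r) ≤ r * vnorm u ^ 2 - 2 * (vnorm u * vnorm w) := by
    rw [neg_le_iff_add_nonneg, ← sub_nonneg]
    have : r * vnorm u ^ 2 - 2 * (vnorm u * vnorm w) + vnorm w ^ 2 / r - 0 =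
        (r * vnorm u - vnorm w) ^ 2 / r := by
      field_simp
      ring
    rw [this]
    positivity
  have h6 : -(‖gainResidual S K‖ ^ 2 / r) * (x ⬝ᵥ x) ≤ -(vnorm w ^ 2 / r) := by
    rw [neg_mul, neg_le_neg_iff, div_mul_eq_mul_div]
    gcongr
  rw [← vnorm_sq] at h1
  linarith

/-! ### A priori bounds -/

theorem Stabilizes.mul_trace_stateCov_le (h : Stabilizes S K) (hR : S.R.PosDef)
    (hS : Sig.PosSemidef) {q : ℝ} (hq : ∀ x : Fin n → ℝ, q * (x ⬝ᵥ x) ≤ x ⬝ᵥ (S.Q *ᵥ x)) :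
    q * (stateCov S Sig K).trace ≤ lqCost S Sig K := by
  refine mul_trace_le (h.posSemidef_stateCov hS) fun x => (hq x).trans ?_
  have := (posSemidef_transpose_mul_mul hR.posSemidef K).dotProduct_mulVec_nonneg x
  rw [weight, Matrix.add_mulVec, dotProduct_add]
  simpa using this

theorem Stabilizes.mul_trace_valueMat_le (h : Stabilizes S K) (hQ : S.Q.PosDef) (hR : S.R.PosDef)
    {c : ℝ} (hc : ∀ x : Fin n → ℝ, c * (x ⬝ᵥ x) ≤ x ⬝ᵥ (Sig *ᵥ x)) :
    c * (valueMat S K).trace ≤ lqCost S Sig K := by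
  rw [h.lqCost_eq, Matrix.trace_mul_comm]
  exact mul_trace_le (h.posSemidef_valueMat hQ hR) hc

theorem Stabilizes.lqCost_nonneg (h : Stabilizes S K) (hQ : S.Q.PosDef) (hR : S.R.PosDef)
    (hS : Sig.PosSemidef) : 0 ≤ lqCost S Sig K :=
  trace_mul_nonneg (posDef_weight hQ hR K).posSemidef (h.posSemidef_stateCov hS)

/-- The Lyapunov equation of `P_K` tested with a vector. -/
theorem Stabilizes.dotProduct_weight_le (h : Stabilizes S K) (hQ : S.Q.PosDef) (hR : S.R.PosDef)
    (x : Fin n → ℝ) :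
    x ⬝ᵥ (weight S K *ᵥ x) ≤ 2 * |(valueMat S K *ᵥ x) ⬝ᵥ (drift S K *ᵥ x)| := by
  have h1 := congrArg (fun M => x ⬝ᵥ (M *ᵥ x)) h.lyap_valueMat
  have hP := h.posSemidef_valueMat hQ hR
  have hPt := transpose_eq_of_posSemidef hP
  have h2 := hP.dotProduct_mulVec_nonneg (diffusion S K *ᵥ x)
  simp only [lyap_apply, Matrix.transpose_transpose, Matrix.add_mulVec, dotProduct_add,
    ← Matrix.mulVec_mulVec, dotProduct_transpose_mulVec, Matrix.neg_mulVec, dotProduct_neg] at h1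
  have h3 : x ⬝ᵥ (valueMat S K *ᵥ (drift S K *ᵥ x)) =
      (valueMat S K *ᵥ x) ⬝ᵥ (drift S K *ᵥ x) := by
    conv_lhs => rw [← hPt]
    exact dotProduct_transpose_mulVec _ _ _
  rw [h3, dotProduct_comm (drift S K *ᵥ x)] at h1
  simp only [star_trivial] at h2
  have := neg_le_abs ((valueMat S K *ᵥ x) ⬝ᵥ (drift S K *ᵥ x))
  linarith

/-- A bound for the gain: from `r |K x|² ≤ 2 p |x| (a |x| + b |K x|)` follows
`|K x| ≤ (2 b p / r + a / b) |x|`. -/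
theorem Stabilizes.vnorm_gain_le (h : Stabilizes S K) (hQ : S.Q.PosDef) (hR : S.R.PosDef)
    {p r a b : ℝ} (hr : 0 < r) (hb : 0 < b) (ha : 0 ≤ a) (hp : 0 ≤ p)
    (hrR : ∀ y : Fin m → ℝ, r * (y ⬝ᵥ y) ≤ y ⬝ᵥ (S.R *ᵥ y))
    (hpP : ∀ x, vnorm (valueMat S K *ᵥ x) ≤ p * vnorm x)
    (haA : ∀ x, vnorm (S.A *ᵥ x) ≤ a * vnorm x) (hbB : ∀ y, vnorm (S.B *ᵥ y) ≤ b * vnorm y)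
    (x : Fin n → ℝ) : vnorm (K *ᵥ x) ≤ (2 * b * p / r + a / b) * vnorm x := by
  set k := vnorm (K *ᵥ x) with hk
  set e := vnorm x with he
  have he0 : 0 ≤ e := vnorm_nonneg _
  have hk0 : 0 ≤ k := vnorm_nonneg _
  have h1 : r * k ^ 2 ≤ x ⬝ᵥ (weight S K *ᵥ x) := by
    rw [weight, Matrix.add_mulVec, dotProduct_add, ← Matrix.mulVec_mulVec, ← Matrix.mulVec_mulVec,
      dotProduct_transpose_mulVec, hk, vnorm_sq]
    have := hQ.posSemidef.dotProduct_mulVec_nonneg x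
    simp only [star_trivial] at this
    linarith [hrR (K *ᵥ x)]
  have h2 : vnorm (drift S K *ᵥ x) ≤ a * e + b * k := by
    rw [drift, Matrix.add_mulVec, ← Matrix.mulVec_mulVec]
    exact (vnorm_add_le _ _).trans (add_le_add (haA x) (hbB _))
  have h3 : r * k ^ 2 ≤ 2 * ((p * e) * (a * e + b * k)) := by
    refine h1.trans ((h.dotProduct_weight_le hQ hR x).trans ?_)
    refine mul_le_mul_of_nonneg_left ((abs_dotProduct_le _ _).trans ?_) zero_le_two
    exact mul_le_mul (hpP x) h2 (vnorm_nonneg _) (by positivity)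
  by_contra! hlt
  have hc : (2 * b * p / r + a / b) * e * b * r = (2 * b ^ 2 * p + a * r) * e := by
    field_simp
  have h4 : (2 * b ^ 2 * p + a * r) * e < k * b * r := by
    rw [← hc]
    gcongr
  have hkpos : 0 < k := lt_of_le_of_lt (by positivity) hlt
  have h5 : (2 * b ^ 2 * p + a * r) * e * k < k * b * r * k := by gcongr
  -- `k` also dominates the first summand of the bound
  have h6 : 2 * b ^ 2 * p * e ≤ k * b * r := by nlinarith [mul_nonneg (mul_nonneg ha hr.le) he0]
  have h7 : a * e * (2 * b ^ 2 * p * e) ≤ a * e * (k * b * r) := by gcongr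
  nlinarith

/-- A lower bound for the accumulated second moments, from their Lyapunov equation tested with an
eigenvector of least eigenvalue. -/
theorem Stabilizes.le_dotProduct_stateCov (h : Stabilizes S K) (hS : Sig.PosDef) {c f : ℝ}
    (hf : 0 < f) (hc : ∀ x : Fin n → ℝ, c * (x ⬝ᵥ x) ≤ x ⬝ᵥ (Sig *ᵥ x))
    (hF : ∀ x, vnorm (drift S K *ᵥ x) ≤ f * vnorm x) (x : Fin n → ℝ) :
    c / (2 * f) * (x ⬝ᵥ x) ≤ x ⬝ᵥ (stateCov S Sig K *ᵥ x) := by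
  have hpsd := h.posSemidef_stateCov hS.posSemidef
  refine le_dotProduct_mulVec hpsd.1 (fun μ hμ => ?_) x
  have hμ0 : 0 ≤ μ := (Matrix.posSemidef_iff_isHermitian_and_spectrum_nonneg.1 hpsd).2 hμ
  rw [← Matrix.spectrum_toLin', ← Module.End.hasEigenvalue_iff_mem_spectrum] at hμ
  obtain ⟨v, hv⟩ := hμ.exists_hasEigenvector
  have hv1 : stateCov S Sig K *ᵥ v = μ • v := by simpa using hv.apply_eq_smul
  have hvpos : 0 < v ⬝ᵥ v := by
    rw [← vnorm_sq]
    have : vnorm v ≠ 0 := by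
      intro h0
      apply hv.2
      simpa [vnorm] using h0
    positivity
  have hst := transpose_eq_of_posSemidef hpsd
  have h1 := congrArg (fun M => v ⬝ᵥ (M *ᵥ v)) (h.lyap_stateCov Sig)
  have h2 := hpsd.dotProduct_mulVec_nonneg ((diffusion S K)ᵀ *ᵥ v)
  have h3 : v ⬝ᵥ (diffusion S K *ᵥ (stateCov S Sig K *ᵥ ((diffusion S K)ᵀ *ᵥ v))) =
      ((diffusion S K)ᵀ *ᵥ v) ⬝ᵥ (stateCov S Sig K *ᵥ ((diffusion S K)ᵀ *ᵥ v)) := by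
    conv_lhs => rw [← Matrix.transpose_transpose (diffusion S K)]
    rw [dotProduct_transpose_mulVec]
    simp
  have h4 : v ⬝ᵥ (stateCov S Sig K *ᵥ ((drift S K)ᵀ *ᵥ v)) = μ * (v ⬝ᵥ (drift S K *ᵥ v)) := by
    conv_lhs => rw [← hst]
    rw [dotProduct_transpose_mulVec, hv1, smul_dotProduct, smul_eq_mul, dotProduct_transpose_mulVec,
      dotProduct_comm]
  have h5 : v ⬝ᵥ (drift S K *ᵥ (stateCov S Sig K *ᵥ v)) = μ * (v ⬝ᵥ (drift S K *ᵥ v)) := by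
    rw [hv1, Matrix.mulVec_smul, dotProduct_smul, smul_eq_mul]
  simp only [lyap_apply, Matrix.add_mulVec, dotProduct_add, ← Matrix.mulVec_mulVec,
    Matrix.neg_mulVec, dotProduct_neg, h3, h4, h5] at h1
  simp only [star_trivial] at h2
  have h6 := (abs_le.1 (abs_dotProduct_le v (drift S K *ᵥ v))).1
  have h7 : vnorm v * vnorm (drift S K *ᵥ v) ≤ f * (v ⬝ᵥ v) := by
    rw [← vnorm_sq]
    have := mul_le_mul_of_nonneg_left (hF v) (vnorm_nonneg v)
    nlinarith
  have h8 : c * (v ⬝ᵥ v) ≤ 2 * f * μ * (v ⬝ᵥ v) := by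
    have h9 : -(f * (v ⬝ᵥ v)) ≤ v ⬝ᵥ (drift S K *ᵥ v) := by linarith
    have h10 := mul_le_mul_of_nonneg_left h9 hμ0
    linarith [hc v]
  rw [div_le_iff₀ (by positivity)]
  have := le_of_mul_le_mul_right h8 hvpos
  linarith

end Algebra

section Smoothness

attribute [local instance] frobTop

/-! ### Smoothness of matrix-valued functions -/

section MatrixCalculus

variable {E : Type*} [NormedAddCommGroup E] [NormedSpace ℝ E] {k l p : ℕ} {N : WithTop ℕ∞} {x : E}

theorem contDiffAt_matrix {f : E → Matrix (Fin k) (Fin l) ℝ}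
    (h : ∀ i j, ContDiffAt ℝ N (fun x => f x i j) x) : ContDiffAt ℝ N f x := by
  have e : f = fun x => ∑ i, ∑ j, f x i j • Matrix.single i j (1 : ℝ) := by
    funext y
    conv_lhs => rw [Matrix.matrix_eq_sum_single (f y)]
    simp [Matrix.smul_single]
  rw [e]
  exact ContDiffAt.sum fun i _ => ContDiffAt.sum fun j _ => (h i j).smul contDiffAt_const

theorem contDiffAt_matrix_apply {f : E → Matrix (Fin k) (Fin l) ℝ} (h : ContDiffAt ℝ N f x)
    (i : Fin k) (j : Fin l) : ContDiffAt ℝ N (fun x => f x i j) x :=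
  (LinearMap.toContinuousLinearMap
    (Matrix.entryLinearMap ℝ ℝ i j : Matrix (Fin k) (Fin l) ℝ →ₗ[ℝ] ℝ)).contDiff.contDiffAt.comp x h

theorem contDiffAt_matrix_mul {f : E → Matrix (Fin k) (Fin l) ℝ} {g : E → Matrix (Fin l) (Fin p) ℝ}
    (hf : ContDiffAt ℝ N f x) (hg : ContDiffAt ℝ N g x) :
    ContDiffAt ℝ N (fun x => f x * g x) x := by
  refine contDiffAt_matrix fun i j => ?_
  simp only [Matrix.mul_apply]
  exact ContDiffAt.sum fun a _ => (contDiffAt_matrix_apply hf i a).mul (contDiffAt_matrix_apply hg a j)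

theorem contDiffAt_matrix_transpose {f : E → Matrix (Fin k) (Fin l) ℝ} (hf : ContDiffAt ℝ N f x) :
    ContDiffAt ℝ N (fun x => (f x)ᵀ) x :=
  contDiffAt_matrix fun i j => contDiffAt_matrix_apply hf j i

theorem contDiffAt_matrix_trace {f : E → Matrix (Fin k) (Fin k) ℝ} (hf : ContDiffAt ℝ N f x) :
    ContDiffAt ℝ N (fun x => (f x).trace) x :=
  ContDiffAt.sum fun i _ => contDiffAt_matrix_apply hf i i

end MatrixCalculus

variable {n m : ℕ} {S : LQData n m} {Sig : Matrix (Fin n) (Fin n) ℝ} {K : Matrix (Fin m) (Fin n) ℝ}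

theorem contDiffAt_drift {N : WithTop ℕ∞} : ContDiffAt ℝ N (drift S) K :=
  contDiffAt_const.add (contDiffAt_matrix_mul contDiffAt_const contDiffAt_id)

theorem contDiffAt_diffusion {N : WithTop ℕ∞} : ContDiffAt ℝ N (diffusion S) K :=
  contDiffAt_const.add (contDiffAt_matrix_mul contDiffAt_const contDiffAt_id)

theorem contDiffAt_weight {N : WithTop ℕ∞} : ContDiffAt ℝ N (weight S) K :=
  contDiffAt_const.add (contDiffAt_matrix_mul (contDiffAt_matrix_mul
    (contDiffAt_matrix_transpose contDiffAt_id) contDiffAt_const) contDiffAt_id)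

theorem contDiffAt_lyap {N : WithTop ℕ∞} :
    ContDiffAt ℝ N (fun K => lyap (drift S K) (diffusion S K)) K := by
  have : ContDiff ℝ N (fun K => lyap (drift S K) (diffusion S K)) := by
    refine contDiff_clm_apply_iff.2 fun M => contDiff_iff_contDiffAt.2 fun K => ?_
    simp only [lyap_apply]
    exact ((contDiffAt_matrix_mul contDiffAt_drift contDiffAt_const).add
      (contDiffAt_matrix_mul contDiffAt_const (contDiffAt_matrix_transpose contDiffAt_drift))).add
      (contDiffAt_matrix_mul (contDiffAt_matrix_mul contDiffAt_diffusion contDiffAt_const)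
        (contDiffAt_matrix_transpose contDiffAt_diffusion))
  exact this.contDiffAt

theorem Stabilizes.contDiffAt_stateCov {N : WithTop ℕ∞} (h : Stabilizes S K) :
    ContDiffAt ℝ N (stateCov S Sig) K := by
  obtain ⟨u, hu⟩ := IsStable.isUnit h
  have h1 : ContDiffAt ℝ N (Ring.inverse : (Matrix (Fin n) (Fin n) ℝ →L[ℝ]
      Matrix (Fin n) (Fin n) ℝ) → _) (lyap (drift S K) (diffusion S K)) := by
    rw [← hu]
    exact contDiffAt_ringInverse ℝ u
  have h2 : ContDiffAt ℝ N (fun K => Ring.inverse (lyap (drift S K) (diffusion S K))) K :=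
    ContDiffAt.comp K h1 contDiffAt_lyap
  exact (h2.clm_apply contDiffAt_const).neg

theorem Stabilizes.contDiffAt_lqCost {N : WithTop ℕ∞} (h : Stabilizes S K) :
    ContDiffAt ℝ N (lqCost S Sig) K :=
  contDiffAt_matrix_trace (contDiffAt_matrix_mul contDiffAt_weight h.contDiffAt_stateCov)

/-- Stability is an open condition, because the semigroup of a stable feedback contracts at some
time. -/
theorem isOpen_stabilizes (S : LQData n m) : IsOpen {K | Stabilizes S K} := by
  rw [isOpen_iff_mem_nhds]
  intro K hK
  obtain ⟨T, hT, hT0⟩ := (((IsStable.tendsto_norm hK).eventually (gt_mem_nhds one_pos)).and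
    (eventually_gt_atTop 0)).exists
  have hc : ContinuousAt (fun K => ‖NormedSpace.exp (T • lyap (drift S K) (diffusion S K))‖) K := by
    let _ : NormedAlgebra ℚ (Matrix (Fin n) (Fin n) ℝ →L[ℝ] Matrix (Fin n) (Fin n) ℝ) :=
      NormedAlgebra.restrictScalars ℚ ℝ _
    have h1 : ContinuousAt (fun K => lyap (drift S K) (diffusion S K)) K :=
      (contDiffAt_lyap (N := 0)).continuousAt
    exact (NormedSpace.exp_continuous.continuousAt.comp (h1.const_smul T)).norm
  filter_upwards [hc.eventually (gt_mem_nhds hT)] with K' hK'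
  exact isStable_of_norm_lt_one hT0 hK'

theorem continuous_trace_weight_exp (S : LQData n m) (Sig : Matrix (Fin n) (Fin n) ℝ) (t : ℝ) :
    Continuous fun K => (weight S K *
      NormedSpace.exp (t • lyap (drift S K) (diffusion S K)) Sig).trace := by
  let _ : NormedAlgebra ℚ (Matrix (Fin n) (Fin n) ℝ →L[ℝ] Matrix (Fin n) (Fin n) ℝ) :=
    NormedAlgebra.restrictScalars ℚ ℝ _
  refine continuous_iff_continuousAt.2 fun K => ?_
  have h1 : ContinuousAt (fun K => lyap (drift S K) (diffusion S K)) K :=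
    (contDiffAt_lyap (N := 0)).continuousAt
  have h2 : ContinuousAt (fun K => NormedSpace.exp (t • lyap (drift S K) (diffusion S K)) Sig) K :=
    (NormedSpace.exp_continuous.continuousAt.comp (h1.const_smul t)).clm_apply continuousAt_const
  have h3 : ContinuousAt (weight S) K := (contDiffAt_weight (N := 0)).continuousAt
  have h4 : Continuous fun p : Matrix (Fin n) (Fin n) ℝ × Matrix (Fin n) (Fin n) ℝ =>
      (p.1 * p.2).trace :=
    (contDiff_iff_contDiffAt.2 fun p => contDiffAt_matrix_trace
      (contDiffAt_matrix_mul contDiffAt_fst contDiffAt_snd) : ContDiff ℝ 0 _).continuous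
  exact ContinuousAt.comp (f := fun K => (weight S K,
    NormedSpace.exp (t • lyap (drift S K) (diffusion S K)) Sig)) h4.continuousAt (h3.prodMk h2)

/-! ### Derivatives of the cost -/

/-- Second derivative at `0` of `c + t g(t)`. -/
theorem iteratedDeriv_two_eq {f g : ℝ → ℝ} {c : ℝ} (hg : ContDiffAt ℝ 2 g 0)
    (hf : ∀ᶠ t in 𝓝 0, f t = c + t * g t) : iteratedDeriv 2 f 0 = 2 * deriv g 0 := by
  have h1 : ∀ᶠ t in 𝓝 (0 : ℝ), HasDerivAt g (deriv g t) t := by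
    filter_upwards [hg.eventually (by simp)] with t ht
    exact (ht.differentiableAt (by simp)).hasDerivAt
  have h2 : DifferentiableAt ℝ (deriv g) 0 := by
    have : ContDiffAt ℝ 1 (deriv g) 0 := hg.derivWithin (by norm_num)
    exact this.differentiableAt (by simp)
  have h3 : deriv f =ᶠ[𝓝 0] fun t => g t + t * deriv g t := by
    filter_upwards [hf.eventually_nhds, h1] with t ht hgt
    have : HasDerivAt (fun t => c + t * g t) (g t + t * deriv g t) t := by
      simpa using ((hasDerivAt_id t).mul hgt).const_add c
    rw [← this.deriv]
    exact Filter.EventuallyEq.deriv_eq ht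
  rw [iteratedDeriv_succ, iteratedDeriv_one, h3.deriv_eq]
  have h4 := (h1.self_of_nhds.add ((hasDerivAt_id (0 : ℝ)).mul h2.hasDerivAt)).deriv
  simp only [id] at h4
  have e : (fun t => g t + t * deriv g t) = (g + (fun t => t) * deriv g) := rfl
  rw [e]
  refine h4.trans ?_
  simp
  ring

theorem Stabilizes.eventually_add_smul (h : Stabilizes S K) (D : Matrix (Fin m) (Fin n) ℝ) :
    ∀ᶠ t in 𝓝 (0 : ℝ), Stabilizes S (K + t • D) := by
  have hc : Continuous fun t : ℝ => K + t • D := by fun_prop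
  have : Tendsto (fun t : ℝ => K + t • D) (𝓝 0) (𝓝 K) := by
    have := hc.tendsto 0
    simpa using this
  exact this.eventually ((isOpen_stabilizes S).mem_nhds h)

/-- The first-order form `Dᵀ E_K + E_Kᵀ D`. -/
noncomputable def firstForm (S : LQData n m) (K D : Matrix (Fin m) (Fin n) ℝ) :
    Matrix (Fin n) (Fin n) ℝ :=
  Dᵀ * gainResidual S K + (gainResidual S K)ᵀ * D

/-- The difference quotient of the cost in direction `D`. -/
noncomputable def costQuotient (S : LQData n m) (Sig : Matrix (Fin n) (Fin n) ℝ)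
    (K D : Matrix (Fin m) (Fin n) ℝ) (t : ℝ) : ℝ :=
  ((firstForm S K D + t • (Dᵀ * inputWeight S K * D)) * stateCov S Sig (K + t • D)).trace

theorem Stabilizes.lqCost_add_smul (h : Stabilizes S K) (hQ : S.Q.PosDef) (hR : S.R.PosDef)
    (D : Matrix (Fin m) (Fin n) ℝ) : ∀ᶠ t in 𝓝 (0 : ℝ),
      lqCost S Sig (K + t • D) = lqCost S Sig K + t * costQuotient S Sig K D t := by
  filter_upwards [h.eventually_add_smul D] with t ht
  have h1 := lqCost_add_sub (Sig := Sig) hQ hR h ht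
  have h2 : incrementForm S K (t • D) =
      t • (firstForm S K D + t • (Dᵀ * inputWeight S K * D)) := by
    rw [incrementForm, firstForm]
    simp only [Matrix.transpose_smul, Matrix.smul_mul, Matrix.mul_smul, smul_add]
  rw [h2, Matrix.smul_mul, Matrix.trace_smul, smul_eq_mul] at h1
  rw [costQuotient]
  linarith

theorem Stabilizes.contDiffAt_costQuotient {N : WithTop ℕ∞} (h : Stabilizes S K)
    (D : Matrix (Fin m) (Fin n) ℝ) : ContDiffAt ℝ N (costQuotient S Sig K D) 0 := by
  have h0 : Stabilizes S (K + (0 : ℝ) • D) := by simpa using h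
  have h1 : ContDiffAt ℝ N (fun t : ℝ => K + t • D) 0 :=
    contDiffAt_const.add (contDiffAt_id.smul contDiffAt_const)
  have h2 : ContDiffAt ℝ N (fun t : ℝ => stateCov S Sig (K + t • D)) 0 :=
    ContDiffAt.comp (0 : ℝ) (f := fun t : ℝ => K + t • D) h0.contDiffAt_stateCov h1
  exact contDiffAt_matrix_trace (contDiffAt_matrix_mul
    (contDiffAt_const.add (contDiffAt_id.smul contDiffAt_const)) h2)

theorem Stabilizes.fderiv_lqCost (h : Stabilizes S K) (hQ : S.Q.PosDef) (hR : S.R.PosDef)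
    (D : Matrix (Fin m) (Fin n) ℝ) :
    fderiv ℝ (lqCost S Sig) K D = (firstForm S K D * stateCov S Sig K).trace := by
  have h1 : HasDerivAt (fun t : ℝ => lqCost S Sig (K + t • D)) (fderiv ℝ (lqCost S Sig) K D) 0 := by
    have hd := ((h.contDiffAt_lqCost (Sig := Sig) (N := 1)).differentiableAt (by simp)).hasFDerivAt
    have hl : HasDerivAt (fun t : ℝ => K + t • D) D 0 := by
      simpa using ((hasDerivAt_id (0 : ℝ)).smul_const D).const_add K
    exact hd.comp_hasDerivAt_of_eq (0 : ℝ) hl (by simp)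
  have h2 : HasDerivAt (fun t : ℝ => lqCost S Sig K + t * costQuotient S Sig K D t)
      (costQuotient S Sig K D 0) 0 := by
    have hg := ((h.contDiffAt_costQuotient (Sig := Sig) (N := 1) D).differentiableAt
      (by simp)).hasDerivAt
    simpa using ((hasDerivAt_id (0 : ℝ)).mul hg).const_add (lqCost S Sig K)
  have h3 := h2.congr_of_eventuallyEq (h.lqCost_add_smul (Sig := Sig) hQ hR D)
  rw [h1.unique h3, costQuotient]
  simp

/-- The source of the Lyapunov equation of the derivative of `t ↦ Σ_{K + t D}` at `0`, with `Y` in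
the place of `Σ_K`. -/
noncomputable def covSource (S : LQData n m) (K D : Matrix (Fin m) (Fin n) ℝ)
    (Y : Matrix (Fin n) (Fin n) ℝ) : Matrix (Fin n) (Fin n) ℝ :=
  S.B * D * Y + Y * (S.B * D)ᵀ + S.D * D * Y * (diffusion S K)ᵀ + diffusion S K * Y * (S.D * D)ᵀ

theorem lyap_add_smul (S : LQData n m) (K D : Matrix (Fin m) (Fin n) ℝ) (t : ℝ)
    (Y : Matrix (Fin n) (Fin n) ℝ) :
    lyap (drift S (K + t • D)) (diffusion S (K + t • D)) Y =
      lyap (drift S K) (diffusion S K) Y +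
        t • (covSource S K D Y + t • (S.D * D * Y * (S.D * D)ᵀ)) := by
  have hd : drift S (K + t • D) = drift S K + t • (S.B * D) := by
    rw [drift, drift, Matrix.mul_add, Matrix.mul_smul, add_assoc]
  have hg : diffusion S (K + t • D) = diffusion S K + t • (S.D * D) := by
    rw [diffusion, diffusion, Matrix.mul_add, Matrix.mul_smul, add_assoc]
  rw [hd, hg, covSource]
  simp only [lyap_apply, Matrix.transpose_add, Matrix.transpose_smul, Matrix.add_mul,
    Matrix.mul_add, Matrix.smul_mul, Matrix.mul_smul, smul_add]
  abel

theorem hasDerivAt_id_smul {E : Type*} [NormedAddCommGroup E] [NormedSpace ℝ E] {h : ℝ → E}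
    (hh : DifferentiableAt ℝ h 0) : HasDerivAt (fun t : ℝ => t • h t) (h 0) 0 := by
  exact ((hasDerivAt_id (0 : ℝ)).smul hh.hasDerivAt).congr_deriv (by simp)

theorem Stabilizes.hasDerivAt_stateCov (h : Stabilizes S K) (D : Matrix (Fin m) (Fin n) ℝ) :
    HasDerivAt (fun t : ℝ => stateCov S Sig (K + t • D))
      (lyapInv (drift S K) (diffusion S K) (covSource S K D (stateCov S Sig K))) 0 := by
  have h0 : Stabilizes S (K + (0 : ℝ) • D) := by simpa using h
  have h1 : ContDiffAt ℝ 1 (fun t : ℝ => stateCov S Sig (K + t • D)) 0 :=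
    ContDiffAt.comp (0 : ℝ) (f := fun t : ℝ => K + t • D) h0.contDiffAt_stateCov
      (contDiffAt_const.add (contDiffAt_id.smul contDiffAt_const))
  set g : ℝ → Matrix (Fin n) (Fin n) ℝ := fun t =>
    covSource S K D (stateCov S Sig (K + t • D)) +
      t • (S.D * D * stateCov S Sig (K + t • D) * (S.D * D)ᵀ) with hg
  have h2 : ContDiffAt ℝ 1 g 0 := by
    refine ((((contDiffAt_matrix_mul contDiffAt_const h1).add
      (contDiffAt_matrix_mul h1 contDiffAt_const)).add
      (contDiffAt_matrix_mul (contDiffAt_matrix_mul contDiffAt_const h1) contDiffAt_const)).add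
      (contDiffAt_matrix_mul (contDiffAt_matrix_mul contDiffAt_const h1) contDiffAt_const)).add
      (contDiffAt_id.smul (contDiffAt_matrix_mul (contDiffAt_matrix_mul contDiffAt_const h1)
        contDiffAt_const))
  -- the Lyapunov equations of `Σ_{K + t D}` and `Σ_K` differ by `t g(t)`
  have h3 : ∀ᶠ t in 𝓝 (0 : ℝ), stateCov S Sig (K + t • D) =
      stateCov S Sig K + t • lyapInv (drift S K) (diffusion S K) (g t) := by
    filter_upwards [h.eventually_add_smul D] with t ht
    have e1 := ht.lyap_stateCov Sig
    rw [lyap_add_smul] at e1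
    have e2 : stateCov S Sig (K + t • D) = lyapInv (drift S K) (diffusion S K) (Sig + t • g t) := by
      refine eq_lyapInv (IsStable.isUnit h) ?_
      rw [neg_add, ← e1, hg]
      abel
    rw [e2, stateCov, lyapInv, lyapInv, lyapInv, map_add, map_smul, neg_add, smul_neg]
  have h4 : DifferentiableAt ℝ (fun t => lyapInv (drift S K) (diffusion S K) (g t)) 0 :=
    ((Ring.inverse (lyap (drift S K) (diffusion S K))).differentiableAt.comp (0 : ℝ)
      (h2.differentiableAt (by simp))).neg
  have h5 := ((hasDerivAt_id_smul h4).const_add (stateCov S Sig K)).congr_of_eventuallyEq h3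
  simpa [hg] using h5

/-- The second derivative of the cost in direction `D`. -/
theorem Stabilizes.iteratedDeriv_lqCost (h : Stabilizes S K) (hQ : S.Q.PosDef) (hR : S.R.PosDef)
    (D : Matrix (Fin m) (Fin n) ℝ) :
    iteratedDeriv 2 (fun t : ℝ => lqCost S Sig (K + t • D)) 0 =
      2 * ((lyapInv (drift S K)ᵀ (diffusion S K)ᵀ (firstForm S K D) *
        covSource S K D (stateCov S Sig K)).trace +
        (Dᵀ * inputWeight S K * D * stateCov S Sig K).trace) := by
  rw [iteratedDeriv_two_eq (h.contDiffAt_costQuotient (Sig := Sig) D)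
    (h.lqCost_add_smul (Sig := Sig) hQ hR D)]
  congr 1
  have h1 := h.hasDerivAt_stateCov (Sig := Sig) D
  have h2 := hasDerivAt_trace_mul h1 (firstForm S K D)
  have h3 := hasDerivAt_id_smul (h := fun t : ℝ =>
    (Dᵀ * inputWeight S K * D * stateCov S Sig (K + t • D)).trace)
    (hasDerivAt_trace_mul h1 _).differentiableAt
  have h4 := h2.add h3
  rw [trace_mul_lyapInv (IsStable.isUnit h)] at h4
  have e : costQuotient S Sig K D = (fun t : ℝ => (firstForm S K D *
      stateCov S Sig (K + t • D)).trace) + fun t : ℝ => t •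
      (Dᵀ * inputWeight S K * D * stateCov S Sig (K + t • D)).trace := by
    funext t
    simp [costQuotient, add_mul, Matrix.trace_add, Matrix.trace_smul]
  rw [e]
  refine h4.deriv.trans ?_
  simp

end Smoothness

section HessianBound

attribute [local instance] frobTop

/-! ### A bound for the second derivative of the cost -/

variable {n m : ℕ} {S : LQData n m} {Sig : Matrix (Fin n) (Fin n) ℝ} {K : Matrix (Fin m) (Fin n) ℝ}

theorem dotProduct_mulVec_symm {M : Matrix (Fin n) (Fin n) ℝ} (hM : Mᵀ = M) (x y : Fin n → ℝ) :
    x ⬝ᵥ (M *ᵥ y) = (M *ᵥ x) ⬝ᵥ y := by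
  conv_lhs => rw [← hM]
  exact dotProduct_transpose_mulVec M x y

/-- A bound of a symmetric quadratic form bounds the matrix, by polarization. -/
theorem vnorm_mulVec_le_of_abs_le {M : Matrix (Fin n) (Fin n) ℝ} (hM : Mᵀ = M) {c : ℝ}
    (hc : 0 ≤ c) (h : ∀ x : Fin n → ℝ, |x ⬝ᵥ (M *ᵥ x)| ≤ c * (x ⬝ᵥ x)) (x : Fin n → ℝ) :
    vnorm (M *ᵥ x) ≤ c * vnorm x := by
  set u := vnorm x with hu
  set w := vnorm (M *ᵥ x) with hw
  have hu0 : 0 ≤ u := vnorm_nonneg _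
  have hw0 : 0 ≤ w := vnorm_nonneg _
  have huu : x ⬝ᵥ x = u ^ 2 := (vnorm_sq x).symm
  have hww : (M *ᵥ x) ⬝ᵥ (M *ᵥ x) = w ^ 2 := (vnorm_sq _).symm
  have h1 := (abs_le.1 (h (w • x + u • (M *ᵥ x)))).2
  have h2 := (abs_le.1 (h (w • x - u • (M *ᵥ x)))).1
  have e1 : x ⬝ᵥ (M *ᵥ (M *ᵥ x)) = w ^ 2 := by rw [dotProduct_mulVec_symm hM, hww]
  have e2 : x ⬝ᵥ (M *ᵥ x) = (M *ᵥ x) ⬝ᵥ x := dotProduct_comm _ _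
  simp only [Matrix.mulVec_add, Matrix.mulVec_sub, Matrix.mulVec_smul, dotProduct_add,
    add_dotProduct, dotProduct_sub, sub_dotProduct, dotProduct_smul, smul_dotProduct, smul_eq_mul,
    huu, hww, e1, e2] at h1 h2
  have h3 : u * w ^ 3 ≤ c * (u ^ 2 * w ^ 2) := by nlinarith
  rcases hw0.eq_or_lt with h0 | h0
  · rw [← h0]
    positivity
  · rcases hu0.eq_or_lt with h0' | h0'
    · have := vnorm_mulVec_le_norm M x
      rw [← hu, ← h0', mul_zero] at this
      rw [← h0', mul_zero]
      exact this
    · have h4 : w * (u * w ^ 2) ≤ (c * u) * (u * w ^ 2) := by nlinarith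
      exact le_of_mul_le_mul_right h4 (by positivity)

/-- Bounds for the data of a stabilizing feedback, from which its Hessian is estimated. -/
structure GainBounds (S : LQData n m) (K : Matrix (Fin m) (Fin n) ℝ) (q ρ p b c d κ : ℝ) : Prop where
  q_pos : 0 < q
  ρ_pos : 0 < ρ
  p_nonneg : 0 ≤ p
  b_nonneg : 0 ≤ b
  c_nonneg : 0 ≤ c
  d_nonneg : 0 ≤ d
  κ_nonneg : 0 ≤ κ
  Q_ge : ∀ x : Fin n → ℝ, q * (x ⬝ᵥ x) ≤ x ⬝ᵥ (S.Q *ᵥ x)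
  R_le : ∀ y : Fin m → ℝ, y ⬝ᵥ (S.R *ᵥ y) ≤ ρ * (y ⬝ᵥ y)
  P_le : ∀ x : Fin n → ℝ, vnorm (valueMat S K *ᵥ x) ≤ p * vnorm x
  B_le : ∀ y, vnorm (S.B *ᵥ y) ≤ b * vnorm y
  C_le : ∀ x, vnorm (S.C *ᵥ x) ≤ c * vnorm x
  D_le : ∀ y, vnorm (S.D *ᵥ y) ≤ d * vnorm y
  K_le : ∀ x, vnorm (K *ᵥ x) ≤ κ * vnorm x

variable {q ρ p b c d κ : ℝ}

theorem GainBounds.diffusion_le (hB : GainBounds S K q ρ p b c d κ) (x : Fin n → ℝ) :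
    vnorm (diffusion S K *ᵥ x) ≤ (c + d * κ) * vnorm x := by
  rw [diffusion, Matrix.add_mulVec, ← Matrix.mulVec_mulVec]
  refine (vnorm_add_le _ _).trans ?_
  have h1 := hB.C_le x
  have h2 := (hB.D_le (K *ᵥ x)).trans (mul_le_mul_of_nonneg_left (hB.K_le x) hB.d_nonneg)
  linarith

theorem dotProduct_firstForm (D : Matrix (Fin m) (Fin n) ℝ) (x : Fin n → ℝ) :
    x ⬝ᵥ (firstForm S K D *ᵥ x) = 2 * ((D *ᵥ x) ⬝ᵥ (gainResidual S K *ᵥ x)) := by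
  rw [firstForm]
  simp only [Matrix.add_mulVec, dotProduct_add, ← Matrix.mulVec_mulVec, dotProduct_transpose_mulVec]
  rw [dotProduct_comm (gainResidual S K *ᵥ x)]
  ring

/-- The part `Bᵀ P + Dᵀ P (C + D K)` of the residual, tested with a direction. -/
theorem GainBounds.abs_dotProduct_le (hB : GainBounds S K q ρ p b c d κ)
    (D : Matrix (Fin m) (Fin n) ℝ) (x : Fin n → ℝ) :
    |(D *ᵥ x) ⬝ᵥ ((S.Bᵀ * valueMat S K + S.Dᵀ * valueMat S K * diffusion S K) *ᵥ x)| ≤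
      ‖D‖ * (p * (b + d * (c + d * κ))) * vnorm x ^ 2 := by
  have hu : 0 ≤ vnorm x := vnorm_nonneg _
  have hDx := vnorm_mulVec_le_norm D x
  have hg : 0 ≤ c + d * κ := add_nonneg hB.c_nonneg (mul_nonneg hB.d_nonneg hB.κ_nonneg)
  rw [Matrix.add_mulVec, dotProduct_add]
  simp only [← Matrix.mulVec_mulVec, dotProduct_transpose_mulVec]
  have h1 : |(S.B *ᵥ (D *ᵥ x)) ⬝ᵥ (valueMat S K *ᵥ x)| ≤ (b * (‖D‖ * vnorm x)) * (p * vnorm x) :=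
    (SLQ.abs_dotProduct_le _ _).trans (mul_le_mul ((hB.B_le _).trans
      (mul_le_mul_of_nonneg_left hDx hB.b_nonneg)) (hB.P_le x) (vnorm_nonneg _)
      (mul_nonneg hB.b_nonneg (by positivity)))
  have h2 : |(S.D *ᵥ (D *ᵥ x)) ⬝ᵥ (valueMat S K *ᵥ (diffusion S K *ᵥ x))| ≤
      (d * (‖D‖ * vnorm x)) * (p * ((c + d * κ) * vnorm x)) :=
    (SLQ.abs_dotProduct_le _ _).trans (mul_le_mul ((hB.D_le _).trans
      (mul_le_mul_of_nonneg_left hDx hB.d_nonneg)) ((hB.P_le _).trans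
      (mul_le_mul_of_nonneg_left (hB.diffusion_le x) hB.p_nonneg)) (vnorm_nonneg _)
      (mul_nonneg hB.d_nonneg (by positivity)))
  refine (abs_add_le _ _).trans ((add_le_add h1 h2).trans (le_of_eq ?_))
  ring

/-- The first-order form is dominated by the weight `Q + Kᵀ R K`. The constant `θ` is the positive
root of `θ² = 2 a θ + ρ / q`. -/
theorem GainBounds.abs_firstForm_le (hB : GainBounds S K q ρ p b c d κ) (hR : S.R.PosDef)
    {a θ : ℝ} (hθ : 0 < θ) (ha : a * q = (b + d * (c + d * κ)) * p)
    (hroot : θ ^ 2 * q = 2 * a * q * θ + ρ) (D : Matrix (Fin m) (Fin n) ℝ) (x : Fin n → ℝ) :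
    |x ⬝ᵥ (firstForm S K D *ᵥ x)| ≤ θ * ‖D‖ * (x ⬝ᵥ (weight S K *ᵥ x)) := by
  rcases (norm_nonneg D).eq_or_lt with h0 | hη
  · have hD : D = 0 := norm_eq_zero.1 h0.symm
    simp [hD, firstForm]
  set u := vnorm x with hu
  set η := ‖D‖ with hηdef
  set y := D *ᵥ x with hy
  set z := K *ᵥ x with hz
  set w2 := z ⬝ᵥ (S.R *ᵥ z) with hw2
  have hRt := transpose_eq_of_posSemidef hR.posSemidef
  have hW : q * u ^ 2 + w2 ≤ x ⬝ᵥ (weight S K *ᵥ x) := by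
    rw [weight, Matrix.add_mulVec, dotProduct_add, ← Matrix.mulVec_mulVec, ← Matrix.mulVec_mulVec,
      dotProduct_transpose_mulVec, hu, vnorm_sq]
    linarith [hB.Q_ge x]
  have hyR : y ⬝ᵥ (S.R *ᵥ y) ≤ ρ * (η ^ 2 * u ^ 2) := by
    refine (hB.R_le y).trans (mul_le_mul_of_nonneg_left ?_ hB.ρ_pos.le)
    rw [← vnorm_sq, ← mul_pow]
    exact pow_le_pow_left₀ (vnorm_nonneg _) (vnorm_mulVec_le_norm D x) 2
  set s := θ * η with hs
  have hspos : 0 < s := mul_pos hθ hη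
  have hcs : 2 * s * |y ⬝ᵥ (S.R *ᵥ z)| ≤ y ⬝ᵥ (S.R *ᵥ y) + s ^ 2 * w2 := by
    have h1 := hR.posSemidef.dotProduct_mulVec_nonneg (y + s • z)
    have h2 := hR.posSemidef.dotProduct_mulVec_nonneg (y - s • z)
    have e : z ⬝ᵥ (S.R *ᵥ y) = y ⬝ᵥ (S.R *ᵥ z) := by
      rw [dotProduct_mulVec_symm hRt, dotProduct_comm]
    simp only [star_trivial, Matrix.mulVec_add, Matrix.mulVec_sub, Matrix.mulVec_smul,
      dotProduct_add, add_dotProduct, dotProduct_sub, sub_dotProduct, dotProduct_smul,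
      smul_dotProduct, smul_eq_mul, e, ← hw2] at h1 h2
    rcases abs_cases (y ⬝ᵥ (S.R *ᵥ z)) with ⟨h, _⟩ | ⟨h, _⟩ <;> rw [h] <;> nlinarith
  have hlow := hB.abs_dotProduct_le D x
  have hsplit : y ⬝ᵥ (gainResidual S K *ᵥ x) = y ⬝ᵥ (S.R *ᵥ z) +
      y ⬝ᵥ ((S.Bᵀ * valueMat S K + S.Dᵀ * valueMat S K * diffusion S K) *ᵥ x) := by
    rw [gainResidual, add_assoc, Matrix.add_mulVec, dotProduct_add, ← Matrix.mulVec_mulVec]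
  rw [dotProduct_firstForm, hsplit, abs_mul, abs_two]
  have h3 := abs_add_le (y ⬝ᵥ (S.R *ᵥ z))
    (y ⬝ᵥ ((S.Bᵀ * valueMat S K + S.Dᵀ * valueMat S K * diffusion S K) *ᵥ x))
  have h4 : s * (2 * |y ⬝ᵥ (S.R *ᵥ z)| + 2 * (η * (p * (b + d * (c + d * κ))) * u ^ 2)) ≤
      s * (s * (q * u ^ 2 + w2)) := by
    have e1 : s * (s * (q * u ^ 2 + w2)) = (θ ^ 2 * q) * (η ^ 2 * u ^ 2) + s ^ 2 * w2 := by
      rw [hs]; ring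
    have e2 : s * (2 * (η * (p * (b + d * (c + d * κ))) * u ^ 2)) =
        2 * (a * q) * θ * (η ^ 2 * u ^ 2) := by
      rw [ha, hs]; ring
    rw [e1, hroot, mul_add, e2]
    linarith
  have h5 := le_of_mul_le_mul_left h4 hspos
  have h6 := mul_le_mul_of_nonneg_left hW hspos.le
  linarith

theorem trace_mul_covSource (Y M : Matrix (Fin n) (Fin n) ℝ) (D : Matrix (Fin m) (Fin n) ℝ) :
    (Y * covSource S K D M).trace = ((Y * (S.B * D) + (S.B * D)ᵀ * Y +
      (diffusion S K)ᵀ * Y * (S.D * D) + (S.D * D)ᵀ * Y * diffusion S K) * M).trace := by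
  rw [covSource]
  simp only [mul_add, add_mul, Matrix.trace_add]
  generalize S.B * D = U
  generalize S.D * D = V
  generalize diffusion S K = G
  have e1 : (Y * (M * Uᵀ)).trace = (Uᵀ * Y * M).trace := by
    rw [← Matrix.mul_assoc, Matrix.trace_mul_comm, Matrix.mul_assoc]
  have e2 : ∀ A B : Matrix (Fin n) (Fin n) ℝ, (Y * (A * M * Bᵀ)).trace = (Bᵀ * Y * A * M).trace := by
    intro A B
    rw [← Matrix.mul_assoc, Matrix.trace_mul_comm]
    simp only [Matrix.mul_assoc]
  rw [e1, e2, e2, Matrix.mul_assoc Y]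

/-- The bound of the Hessian of the cost. The derivative `Y` of `P_K` in the direction `D` solves the
Lyapunov equation with right-hand side `firstForm S K D`. The latter is dominated by a multiple of the
weight `Q + Kᵀ R K`, so `Y` is dominated by the same multiple of `P_K`. -/
theorem GainBounds.abs_iteratedDeriv_le (hB : GainBounds S K q ρ p b c d κ) (h : Stabilizes S K)
    (hQ : S.Q.PosDef) (hR : S.R.PosDef) (hS : Sig.PosSemidef) {a θ τ : ℝ} (hθ : 0 < θ)
    (ha : a * q = (b + d * (c + d * κ)) * p) (hroot : θ ^ 2 * q = 2 * a * q * θ + ρ)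
    (hτ : (stateCov S Sig K).trace ≤ τ) (D : Matrix (Fin m) (Fin n) ℝ) :
    |iteratedDeriv 2 (fun t : ℝ => lqCost S Sig (K + t • D)) 0| ≤
      2 * τ * (ρ + p * d ^ 2 + 2 * (b + d * (c + d * κ)) * (p * θ)) * ‖D‖ ^ 2 := by
  set u := b + d * (c + d * κ) with hu
  have hp := hB.p_nonneg
  have hd := hB.d_nonneg
  have hb := hB.b_nonneg
  have hg : 0 ≤ c + d * κ := add_nonneg hB.c_nonneg (mul_nonneg hd hB.κ_nonneg)
  have hu0 : 0 ≤ u := add_nonneg hb (mul_nonneg hd hg)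
  have hX := h.posSemidef_stateCov hS
  have hunit := isUnit_lyap_transpose (IsStable.isUnit h)
  set Y := lyapInv (drift S K)ᵀ (diffusion S K)ᵀ (firstForm S K D) with hY
  have hNt : (firstForm S K D)ᵀ = firstForm S K D := by
    rw [firstForm, Matrix.transpose_add, Matrix.transpose_mul, Matrix.transpose_mul,
      Matrix.transpose_transpose, Matrix.transpose_transpose, add_comm]
  have hYt : Yᵀ = Y := by rw [hY, lyapInv_transpose hunit, hNt]
  have hW := posDef_weight hQ hR K
  have hWt := transpose_eq_of_posSemidef hW.posSemidef
  set s := θ * ‖D‖ with hs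
  have hs0 : 0 ≤ s := by positivity
  -- `± N ≤ s (Q + Kᵀ R K)` gives `± Y ≤ s P`
  have hsgn : ∀ σ : ℝ, |σ| = 1 → ∀ x : Fin n → ℝ,
      0 ≤ s * (x ⬝ᵥ (valueMat S K *ᵥ x)) + σ * (x ⬝ᵥ (Y *ᵥ x)) := by
    intro σ hσ x
    have hpsd : (s • weight S K + σ • firstForm S K D).PosSemidef := by
      refine posSemidef_of_forall ?_ fun x => ?_
      · rw [Matrix.transpose_add, Matrix.transpose_smul, Matrix.transpose_smul, hWt, hNt]
      · have h1 := hB.abs_firstForm_le hR hθ ha hroot D x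
        have h2 : |σ * (x ⬝ᵥ (firstForm S K D *ᵥ x))| ≤ s * (x ⬝ᵥ (weight S K *ᵥ x)) := by
          rw [abs_mul, hσ, one_mul]
          exact h1
        simp only [Matrix.add_mulVec, dotProduct_add, Matrix.smul_mulVec, dotProduct_smul,
          smul_eq_mul]
        linarith [(abs_le.1 h2).1]
    have h3 := (IsStable.posSemidef_lyapInv_transpose h hpsd).dotProduct_mulVec_nonneg x
    have e : lyapInv (drift S K)ᵀ (diffusion S K)ᵀ (s • weight S K + σ • firstForm S K D) =
        s • valueMat S K + σ • Y := by
      rw [hY, valueMat, lyapInv, lyapInv, lyapInv, map_add, map_smul, map_smul, neg_add, smul_neg,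
        smul_neg]
    rw [e] at h3
    simpa [Matrix.add_mulVec, Matrix.smul_mulVec, dotProduct_add, dotProduct_smul] using h3
  have hYabs : ∀ x : Fin n → ℝ, |x ⬝ᵥ (Y *ᵥ x)| ≤ s * p * (x ⬝ᵥ x) := by
    intro x
    have h1 := hsgn 1 (by simp) x
    have h2 := hsgn (-1) (by simp) x
    have h3 : x ⬝ᵥ (valueMat S K *ᵥ x) ≤ p * (x ⬝ᵥ x) := by
      have h4 := (abs_le.1 (SLQ.abs_dotProduct_le x (valueMat S K *ᵥ x))).2
      have h5 := mul_le_mul_of_nonneg_left (hB.P_le x) (vnorm_nonneg x)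
      rw [← vnorm_sq]
      linarith
    have h6 := mul_le_mul_of_nonneg_left h3 hs0
    rw [abs_le]
    constructor <;> linarith
  have hYn : ∀ x : Fin n → ℝ, vnorm (Y *ᵥ x) ≤ s * p * vnorm x :=
    vnorm_mulVec_le_of_abs_le hYt (by positivity) hYabs
  have hτ0 : 0 ≤ τ := hX.trace_nonneg.trans hτ
  have hT1 : |(Y * covSource S K D (stateCov S Sig K)).trace| ≤ 2 * (s * p * ‖D‖ * u) * τ := by
    rw [trace_mul_covSource]
    refine (abs_trace_mul_le (c := 2 * (s * p * ‖D‖ * u)) hX fun x => ?_).trans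
      (mul_le_mul_of_nonneg_left hτ (by positivity))
    have hDx := vnorm_mulVec_le_norm D x
    have hx0 := vnorm_nonneg x
    have e : x ⬝ᵥ ((Y * (S.B * D) + (S.B * D)ᵀ * Y + (diffusion S K)ᵀ * Y * (S.D * D) +
        (S.D * D)ᵀ * Y * diffusion S K) *ᵥ x) = 2 * ((Y *ᵥ x) ⬝ᵥ (S.B *ᵥ (D *ᵥ x))) +
        2 * ((Y *ᵥ (diffusion S K *ᵥ x)) ⬝ᵥ (S.D *ᵥ (D *ᵥ x))) := by
      simp only [Matrix.add_mulVec, dotProduct_add, ← Matrix.mulVec_mulVec,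
        dotProduct_transpose_mulVec, Matrix.transpose_mul]
      rw [dotProduct_mulVec_symm hYt x, dotProduct_comm (S.B *ᵥ (D *ᵥ x)),
        dotProduct_mulVec_symm hYt (diffusion S K *ᵥ x), dotProduct_comm (S.D *ᵥ (D *ᵥ x))]
      ring
    have h1 : |(Y *ᵥ x) ⬝ᵥ (S.B *ᵥ (D *ᵥ x))| ≤ (s * p * vnorm x) * (b * (‖D‖ * vnorm x)) :=
      (SLQ.abs_dotProduct_le _ _).trans (mul_le_mul (hYn x) ((hB.B_le _).trans
        (mul_le_mul_of_nonneg_left hDx hb)) (vnorm_nonneg _) (by positivity))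
    have h2 : |(Y *ᵥ (diffusion S K *ᵥ x)) ⬝ᵥ (S.D *ᵥ (D *ᵥ x))| ≤
        (s * p * ((c + d * κ) * vnorm x)) * (d * (‖D‖ * vnorm x)) :=
      (SLQ.abs_dotProduct_le _ _).trans (mul_le_mul ((hYn _).trans
        (mul_le_mul_of_nonneg_left (hB.diffusion_le x) (by positivity))) ((hB.D_le _).trans
        (mul_le_mul_of_nonneg_left hDx hd)) (vnorm_nonneg _) (by positivity))
    rw [e, ← vnorm_sq]
    refine (abs_add_le _ _).trans ?_
    rw [abs_mul, abs_mul, abs_two, hu]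
    linarith
  have hT2 : |(Dᵀ * inputWeight S K * D * stateCov S Sig K).trace| ≤
      (ρ + p * d ^ 2) * ‖D‖ ^ 2 * τ := by
    refine (abs_trace_mul_le (c := (ρ + p * d ^ 2) * ‖D‖ ^ 2) hX fun x => ?_).trans
      (mul_le_mul_of_nonneg_left hτ (by have := hB.ρ_pos; positivity))
    have hpos := (h.posSemidef_inputWeight hQ hR).dotProduct_mulVec_nonneg (D *ᵥ x)
    simp only [star_trivial] at hpos
    simp only [← Matrix.mulVec_mulVec, dotProduct_transpose_mulVec]
    rw [abs_of_nonneg hpos]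
    set y := D *ᵥ x with hy
    have h1 : y ⬝ᵥ (inputWeight S K *ᵥ y) = y ⬝ᵥ (S.R *ᵥ y) +
        (S.D *ᵥ y) ⬝ᵥ (valueMat S K *ᵥ (S.D *ᵥ y)) := by
      rw [inputWeight, Matrix.add_mulVec, dotProduct_add]
      simp only [← Matrix.mulVec_mulVec, dotProduct_transpose_mulVec]
    have h2 : (S.D *ᵥ y) ⬝ᵥ (valueMat S K *ᵥ (S.D *ᵥ y)) ≤
        (d * vnorm y) * (p * (d * vnorm y)) :=
      ((abs_le.1 (SLQ.abs_dotProduct_le _ _)).2).trans (mul_le_mul (hB.D_le y) ((hB.P_le _).trans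
        (mul_le_mul_of_nonneg_left (hB.D_le y) hp)) (vnorm_nonneg _)
        (mul_nonneg hd (vnorm_nonneg _)))
    have h3 : vnorm y ^ 2 ≤ ‖D‖ ^ 2 * (x ⬝ᵥ x) := by
      rw [← vnorm_sq, ← mul_pow]
      exact pow_le_pow_left₀ (vnorm_nonneg _) (vnorm_mulVec_le_norm D x) 2
    have h4 := hB.R_le y
    rw [← vnorm_sq] at h4
    have h5 := mul_le_mul_of_nonneg_left h3
      (add_nonneg hB.ρ_pos.le (mul_nonneg hp (sq_nonneg d)))
    rw [h1]
    nlinarith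
  rw [h.iteratedDeriv_lqCost hQ hR, abs_mul, abs_two]
  refine (mul_le_mul_of_nonneg_left (abs_add_le _ _) zero_le_two).trans ?_
  have : s * p * ‖D‖ * u = u * (p * θ) * ‖D‖ ^ 2 := by rw [hs]; ring
  rw [this] at hT1
  nlinarith

end HessianBound

section Landscape

attribute [local instance] frobTop

/-! ### Gradient domination and quadratic growth -/

variable {n m : ℕ} {S : LQData n m} {Sig : Matrix (Fin n) (Fin n) ℝ} {K : Matrix (Fin m) (Fin n) ℝ}

theorem trace_transpose_mul_self {k l : ℕ} (M : Matrix (Fin k) (Fin l) ℝ) :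
    (Mᵀ * M).trace = ‖M‖ ^ 2 := by
  rw [frobenius_norm_sq, Finset.sum_comm]
  simp [Matrix.trace, Matrix.mul_apply, sq]

theorem le_vnorm_mulVec {M : Matrix (Fin n) (Fin n) ℝ} {σ : ℝ}
    (h : ∀ x : Fin n → ℝ, σ * (x ⬝ᵥ x) ≤ x ⬝ᵥ (M *ᵥ x)) (x : Fin n → ℝ) :
    σ * vnorm x ≤ vnorm (M *ᵥ x) := by
  rcases (vnorm_nonneg x).eq_or_lt with h0 | h0
  · rw [← h0, mul_zero]
    exact vnorm_nonneg _
  · have h1 := (h x).trans (abs_le.1 (abs_dotProduct_le x (M *ᵥ x))).2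
    rw [← vnorm_sq] at h1
    refine le_of_mul_le_mul_right ?_ h0
    linarith

theorem norm_sq_eq_sum_vnorm {k l : ℕ} (M : Matrix (Fin k) (Fin l) ℝ) :
    ‖M‖ ^ 2 = ∑ i, vnorm (M i) ^ 2 := by
  rw [frobenius_norm_sq]
  refine Finset.sum_congr rfl fun i _ => ?_
  rw [vnorm_sq]
  simp [dotProduct, sq]

theorem mul_norm_le_norm_mul {M : Matrix (Fin n) (Fin n) ℝ} (hM : Mᵀ = M) {σ : ℝ} (hσ : 0 ≤ σ)
    (h : ∀ x : Fin n → ℝ, σ * (x ⬝ᵥ x) ≤ x ⬝ᵥ (M *ᵥ x)) (E : Matrix (Fin m) (Fin n) ℝ) :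
    σ * ‖E‖ ≤ ‖E * M‖ := by
  refine le_of_sq_le_sq ?_ (norm_nonneg _)
  rw [mul_pow, norm_sq_eq_sum_vnorm, norm_sq_eq_sum_vnorm, Finset.mul_sum]
  refine Finset.sum_le_sum fun i _ => ?_
  have e : (E * M) i = M *ᵥ E i := by
    rw [Matrix.mul_apply_eq_vecMul]
    conv_lhs => rw [← hM]
    rw [Matrix.vecMul_transpose]
  rw [e, ← mul_pow]
  exact pow_le_pow_left₀ (mul_nonneg hσ (vnorm_nonneg _)) (le_vnorm_mulVec h _) 2

theorem trace_firstForm_mul (D : Matrix (Fin m) (Fin n) ℝ) {M : Matrix (Fin n) (Fin n) ℝ}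
    (hM : Mᵀ = M) : (firstForm S K D * M).trace = 2 * (Dᵀ * (gainResidual S K * M)).trace := by
  have e : ((gainResidual S K)ᵀ * D * M).trace = (Dᵀ * (gainResidual S K * M)).trace := by
    rw [← Matrix.trace_transpose, Matrix.transpose_mul, Matrix.transpose_mul, hM,
      Matrix.transpose_transpose, Matrix.trace_mul_comm, Matrix.mul_assoc]
  rw [firstForm, add_mul, Matrix.trace_add, e, Matrix.mul_assoc]
  ring

theorem trace_single_transpose_mul (i : Fin m) (j : Fin n) (M : Matrix (Fin m) (Fin n) ℝ) :
    ((Matrix.single i j (1 : ℝ))ᵀ * M).trace = M i j := by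
  rw [Matrix.transpose_single, Matrix.trace_single_mul]
  simp

/-- Uniform bounds on a sublevel set of the cost. -/
theorem exists_sublevel_bounds (hQ : S.Q.PosDef) (hR : S.R.PosDef) (hS : Sig.PosDef) (j : ℝ)
    (hj : 0 ≤ j) : ∃ r σ τ κ : ℝ, 0 < r ∧ 0 < σ ∧ 0 < τ ∧
      (∀ y : Fin m → ℝ, r * (y ⬝ᵥ y) ≤ y ⬝ᵥ (S.R *ᵥ y)) ∧
      ∀ K, Stabilizes S K → lqCost S Sig K ≤ j →
        (∀ x : Fin n → ℝ, σ * (x ⬝ᵥ x) ≤ x ⬝ᵥ (stateCov S Sig K *ᵥ x)) ∧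
        (stateCov S Sig K).trace ≤ τ ∧ ‖K‖ ≤ κ := by
  obtain ⟨r, hr, hrR⟩ := exists_pos_mul_le hR
  obtain ⟨q, hq, hqQ⟩ := exists_pos_mul_le hQ
  obtain ⟨c, hc, hcS⟩ := exists_pos_mul_le hS
  set b := ‖S.B‖ + 1 with hb
  have hb0 : 0 < b := by positivity
  set p := j / c with hp
  have hp0 : 0 ≤ p := by positivity
  set κ := 2 * b * p / r + ‖S.A‖ / b with hκ
  have hκ0 : 0 ≤ κ := by positivity
  set f := ‖S.A‖ + b * κ + 1 with hf
  have hf0 : 0 < f := by positivity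
  refine ⟨r, c / (2 * f), j / q + 1, √(m * n * κ ^ 2), hr, by positivity, by positivity, hrR,
    fun K hK hKj => ?_⟩
  have hP := hK.posSemidef_valueMat hQ hR
  have hPp : (valueMat S K).trace ≤ p := by
    rw [hp, le_div_iff₀ hc, mul_comm]
    exact (hK.mul_trace_valueMat_le hQ hR hcS).trans hKj
  have hBb : ∀ y, vnorm (S.B *ᵥ y) ≤ b * vnorm y := fun y =>
    (vnorm_mulVec_le_norm _ _).trans (mul_le_mul_of_nonneg_right (by linarith) (vnorm_nonneg _))
  have hgain := hK.vnorm_gain_le hQ hR hr hb0 (norm_nonneg S.A) hp0 hrR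
    (fun x => (vnorm_mulVec_le_norm _ _).trans (mul_le_mul_of_nonneg_right
      ((norm_le_trace hP).trans hPp) (vnorm_nonneg _))) (vnorm_mulVec_le_norm S.A) hBb
  refine ⟨hK.le_dotProduct_stateCov hS hf0 hcS fun x => ?_, ?_, ?_⟩
  · rw [drift, Matrix.add_mulVec, ← Matrix.mulVec_mulVec]
    have h1 := vnorm_add_le (S.A *ᵥ x) (S.B *ᵥ (K *ᵥ x))
    have h2 := vnorm_mulVec_le_norm S.A x
    have h3 := (hBb (K *ᵥ x)).trans (mul_le_mul_of_nonneg_left (hgain x) hb0.le)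
    have h4 := vnorm_nonneg x
    rw [hf]
    linarith
  · have := (hK.mul_trace_stateCov_le hR hS.posSemidef hqQ).trans hKj
    have h2 : (stateCov S Sig K).trace ≤ j / q := by
      rw [le_div_iff₀ hq, mul_comm]
      exact this
    linarith
  · refine Real.le_sqrt_of_sq_le ?_
    rw [frobenius_norm_sq]
    have hent : ∀ a b, K a b ^ 2 ≤ κ ^ 2 := by
      intro a b
      have h1 := hgain (Pi.single b 1)
      have h2 : vnorm (Pi.single b (1 : ℝ) : Fin n → ℝ) = 1 := by
        have := vnorm_sq (Pi.single b (1 : ℝ) : Fin n → ℝ)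
        simp only [dotProduct_single, Pi.single_eq_same, mul_one] at this
        exact (pow_eq_one_iff_of_nonneg (vnorm_nonneg _) two_ne_zero).1 this
      have h3 : K a b ^ 2 ≤ vnorm (K *ᵥ Pi.single b 1) ^ 2 := by
        rw [vnorm_sq, Matrix.mulVec_single_one, dotProduct]
        have := Finset.single_le_sum (f := fun i => K.col b i * K.col b i)
          (fun i _ => mul_self_nonneg _) (Finset.mem_univ a)
        simpa [sq] using this
      rw [h2, mul_one] at h1
      exact h3.trans (pow_le_pow_left₀ (vnorm_nonneg _) h1 2)
    calc ∑ a, ∑ b, K a b ^ 2 ≤ ∑ _a : Fin m, ∑ _b : Fin n, κ ^ 2 :=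
          Finset.sum_le_sum fun a _ => Finset.sum_le_sum fun b _ => hent a b
      _ = _ := by simp; ring

/-- Gradient domination: the excess cost of `K` over any stabilizing feedback is controlled by the
residual of `K`. -/
theorem lqCost_sub_le (hQ : S.Q.PosDef) (hR : S.R.PosDef) (hS : Sig.PosSemidef)
    {K' : Matrix (Fin m) (Fin n) ℝ} (h : Stabilizes S K) (h' : Stabilizes S K') {r σ τ : ℝ}
    (hr : 0 < r) (hσ : 0 < σ) (hrR : ∀ y : Fin m → ℝ, r * (y ⬝ᵥ y) ≤ y ⬝ᵥ (S.R *ᵥ y))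
    (hσK : ∀ x : Fin n → ℝ, σ * (x ⬝ᵥ x) ≤ x ⬝ᵥ (stateCov S Sig K *ᵥ x))
    (hτ : (stateCov S Sig K').trace ≤ τ) :
    lqCost S Sig K - lqCost S Sig K' ≤
      τ / (4 * r * σ ^ 2) * ‖(2 : ℝ) • (gainResidual S K * stateCov S Sig K)‖ ^ 2 := by
  have e : K + (K' - K) = K' := by abel
  have h1 := lqCost_add_sub (Sig := Sig) (D := K' - K) hQ hR h (by rwa [e])
  rw [e] at h1
  have hX := h'.posSemidef_stateCov hS
  have h2 := mul_trace_le hX (h.le_dotProduct_incrementForm hQ hR hr hrR (K' - K))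
  have h3 := mul_norm_le_norm_mul (transpose_eq_of_posSemidef (h.posSemidef_stateCov hS)) hσ.le hσK
    (gainResidual S K)
  have h4 : ‖gainResidual S K‖ ^ 2 ≤ ‖gainResidual S K * stateCov S Sig K‖ ^ 2 / σ ^ 2 := by
    rw [le_div_iff₀ (by positivity), mul_comm, ← mul_pow]
    exact pow_le_pow_left₀ (by positivity) h3 2
  have h5 : lqCost S Sig K - lqCost S Sig K' ≤ ‖gainResidual S K‖ ^ 2 / r * τ := by
    have : ‖gainResidual S K‖ ^ 2 / r * (stateCov S Sig K').trace ≤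
        ‖gainResidual S K‖ ^ 2 / r * τ := by gcongr
    linarith
  have hτ0 : 0 ≤ τ := hX.trace_nonneg.trans hτ
  refine h5.trans ?_
  rw [norm_smul, mul_pow]
  calc _ ≤ ‖gainResidual S K * stateCov S Sig K‖ ^ 2 / σ ^ 2 / r * τ := by gcongr
    _ = _ := by
      rw [Real.norm_two]
      field_simp
      ring

/-- Quadratic growth of the cost around a feedback with vanishing residual. -/
theorem mul_norm_sq_le_lqCost_sub (hQ : S.Q.PosDef) (hR : S.R.PosDef)
    {K' : Matrix (Fin m) (Fin n) ℝ} (h : Stabilizes S K) (h' : Stabilizes S K')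
    (h0 : gainResidual S K' = 0) {r σ : ℝ} (hσ : 0 < σ)
    (hrR : ∀ y : Fin m → ℝ, r * (y ⬝ᵥ y) ≤ y ⬝ᵥ (S.R *ᵥ y))
    (hσK : ∀ x : Fin n → ℝ, σ * (x ⬝ᵥ x) ≤ x ⬝ᵥ (stateCov S Sig K *ᵥ x)) :
    σ * (r * ‖K - K'‖ ^ 2) ≤ lqCost S Sig K - lqCost S Sig K' := by
  have e : K' + (K - K') = K := by abel
  have h1 := lqCost_add_sub (Sig := Sig) (D := K - K') hQ hR h' (by rwa [e])
  rw [e, incrementForm, h0] at h1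
  simp only [Matrix.mul_zero, Matrix.transpose_zero, Matrix.zero_mul, zero_add] at h1
  set Z := (K - K')ᵀ * inputWeight S K' * (K - K') with hZ
  have hM := h'.posSemidef_inputWeight hQ hR
  have hZp : Z.PosSemidef := posSemidef_transpose_mul_mul hM _
  have h2 := mul_trace_le hZp hσK
  have h3 : r * ‖K - K'‖ ^ 2 ≤ Z.trace := by
    have hpsd : ((K - K') * (K - K')ᵀ).PosSemidef := by
      rw [← Matrix.conjTranspose_eq_transpose_of_trivial]
      exact Matrix.posSemidef_self_mul_conjTranspose _
    have := mul_trace_le hpsd fun y => (hrR y).trans (h'.dotProduct_inputWeight_ge hQ hR y)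
    rw [Matrix.trace_mul_comm (K - K'), trace_transpose_mul_self] at this
    rw [hZ, Matrix.mul_assoc, Matrix.trace_mul_comm, Matrix.mul_assoc]
    exact this
  rw [h1, Matrix.trace_mul_comm]
  exact (mul_le_mul_of_nonneg_left h3 hσ.le).trans h2

/-! ### Descent -/

/-- A Taylor bound from an upper bound of the second derivative. -/
theorem taylor_le {φ φ' φ'' : ℝ → ℝ} {x c : ℝ} (hx : 0 ≤ x)
    (h1 : ∀ r ∈ Set.Icc 0 x, HasDerivAt φ (φ' r) r)
    (h2 : ∀ r ∈ Set.Icc 0 x, HasDerivAt φ' (φ'' r) r) (h3 : ∀ r ∈ Set.Icc 0 x, φ'' r ≤ c) :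
    φ x ≤ φ 0 + x * φ' 0 + c * x ^ 2 / 2 := by
  have hd : ∀ y ∈ Set.Icc 0 x, φ' y ≤ φ' 0 + c * y := by
    intro y hy
    have hanti : AntitoneOn (fun r => φ' r - c * r) (Set.Icc 0 x) := by
      refine antitoneOn_of_deriv_nonpos (convex_Icc 0 x) ?_ ?_ ?_
      · exact fun r hr => ((h2 r hr).continuousAt.sub (by fun_prop)).continuousWithinAt
      · exact fun r hr => ((h2 r (interior_subset hr)).sub
          ((hasDerivAt_id r).const_mul c)).differentiableAt.differentiableWithinAt
      · intro r hr
        have := (h2 r (interior_subset hr)).sub ((hasDerivAt_id r).const_mul c)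
        refine (this.deriv).le.trans ?_
        simpa using h3 r (interior_subset hr)
    have := hanti ⟨le_rfl, hx⟩ hy hy.1
    simp only [mul_zero, sub_zero] at this
    linarith
  have hanti : AntitoneOn (fun r => φ r - (r * φ' 0 + c * r ^ 2 / 2)) (Set.Icc 0 x) := by
    have hd2 : ∀ r ∈ Set.Icc 0 x, HasDerivAt (fun r => φ r - (r * φ' 0 + c * r ^ 2 / 2))
        (φ' r - (φ' 0 + c * r)) r := fun r hr => by
      have e := (((hasDerivAt_id r).mul_const (φ' 0)).add
        (((hasDerivAt_pow 2 r).const_mul c).div_const 2))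
      refine ((h1 r hr).sub e).congr_deriv ?_
      simp
      ring
    refine antitoneOn_of_deriv_nonpos (convex_Icc 0 x) ?_ ?_ ?_
    · exact fun r hr => (hd2 r hr).continuousAt.continuousWithinAt
    · exact fun r hr => (hd2 r (interior_subset hr)).differentiableAt.differentiableWithinAt
    · intro r hr
      rw [(hd2 r (interior_subset hr)).deriv]
      linarith [hd r (interior_subset hr)]
  have := hanti ⟨le_rfl, hx⟩ ⟨hx, le_rfl⟩ hx
  simp only at this
  linarith

/-- The descent inequality along `-G`, as long as the segment stays in a set on which `f` is smooth
with second derivatives at most `L`. -/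
theorem descent_segment {E : Type*} [NormedAddCommGroup E] [NormedSpace ℝ E] {f : E → ℝ} {x G : E}
    {g L s : ℝ} (hs : 0 ≤ s)
    (hsm : ∀ t ∈ Set.Icc 0 s, ContDiffAt ℝ 2 f (x + t • -G))
    (hL : ∀ t ∈ Set.Icc 0 s, iteratedDeriv 2 (fun r : ℝ => f (x + t • -G + r • -G)) 0 ≤ L * g)
    (hg : fderiv ℝ f x (-G) = -g) :
    f (x + s • -G) ≤ f x - s * (1 - L * s / 2) * g := by
  set φ : ℝ → ℝ := fun t => f (x + t • -G) with hφ
  have hc : ∀ t ∈ Set.Icc 0 s, ContDiffAt ℝ 2 φ t := fun t ht =>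
    ContDiffAt.comp t (f := fun t : ℝ => x + t • -G) (hsm t ht)
      (contDiffAt_const.add (contDiffAt_id.smul contDiffAt_const))
  have h1 : ∀ t ∈ Set.Icc 0 s, HasDerivAt φ (deriv φ t) t := fun t ht =>
    ((hc t ht).differentiableAt (by simp)).hasDerivAt
  have h2 : ∀ t ∈ Set.Icc 0 s, HasDerivAt (deriv φ) (iteratedDeriv 2 φ t) t := fun t ht => by
    have : ContDiffAt ℝ 1 (deriv φ) t := (hc t ht).derivWithin (by norm_num)
    rw [iteratedDeriv_succ, iteratedDeriv_one]
    exact (this.differentiableAt (by simp)).hasDerivAt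
  have h3 : ∀ t ∈ Set.Icc 0 s, iteratedDeriv 2 φ t ≤ L * g := fun t ht => by
    refine le_trans (le_of_eq ?_) (hL t ht)
    have e : (fun r : ℝ => f (x + t • -G + r • -G)) = fun r => φ (t + r) := by
      funext r
      simp only [hφ, add_smul, add_assoc]
    rw [e, iteratedDeriv_comp_const_add]
    simp
  have h0 : deriv φ 0 = -g := by
    have hx0 : x + (0 : ℝ) • -G = x := by simp
    have hd : HasFDerivAt f (fderiv ℝ f x) x := by
      have := hsm 0 ⟨le_rfl, hs⟩
      rw [hx0] at this
      exact (this.differentiableAt (by simp)).hasFDerivAt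
    have hl : HasDerivAt (fun t : ℝ => x + t • -G) (-G) 0 := by
      have := ((hasDerivAt_id (0 : ℝ)).smul_const (-G)).const_add x
      exact this.congr_deriv (by simp)
    rw [← hg]
    exact (hd.comp_hasDerivAt_of_eq (0 : ℝ) hl hx0.symm).deriv
  have := taylor_le hs h1 h2 h3
  rw [h0] at this
  have e0 : φ 0 = f x := by simp [hφ]
  rw [e0] at this
  change φ s ≤ _
  linarith

end Landscape

section Problem

attribute [local instance] frobTop

/-! ### The cost functional of the stochastic problem -/

variable {Ω : Type*} {mΩ : MeasurableSpace Ω} {P : Measure Ω} [IsProbabilityMeasure P]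
  {𝓕 : Filtration ℝ≥0 mΩ} {W : ℝ≥0 → Ω → ℝ} {n m : ℕ} {S : LQData n m} {ξ : Ω → Fin n → ℝ}
  {K K₀ : Matrix (Fin m) (Fin n) ℝ}

theorem mem_stabilizers (hW : IsBrownianWrt P 𝓕 W) :
    K ∈ stabilizers P 𝓕 W S ↔ Stabilizes S K := mem_stabilizers_iff hW S K

theorem cost_eq (hW : IsBrownianWrt P 𝓕 W) (hQ : S.Q.PosDef) (hR : S.R.PosDef)
    (hξ : IsInitialState P 𝓕 ξ) (K : Matrix (Fin m) (Fin n) ℝ) :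
    cost P 𝓕 W S ξ K = ∫⁻ t in Set.Ioi (0 : ℝ), ENNReal.ofReal (weight S K *
      NormedSpace.exp (t • lyap (drift S K) (diffusion S K)) (secondMoment P ξ)).trace :=
  cost_eq_lintegral hW S hξ K (posDef_weight hQ hR K).posSemidef

theorem cost_eq_ofReal (hW : IsBrownianWrt P 𝓕 W) (hQ : S.Q.PosDef) (hR : S.R.PosDef)
    (hξ : IsInitialState P 𝓕 ξ) (hSig : (secondMoment P ξ).PosDef) (h : Stabilizes S K) :
    cost P 𝓕 W S ξ K = ENNReal.ofReal (lqCost S (secondMoment P ξ) K) := by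
  rw [cost_eq hW hQ hR hξ]
  exact (IsStable.lintegral_eq_and_nonneg h (posDef_weight hQ hR K).posSemidef
    hSig.posSemidef).1

/-- A feedback of finite cost stabilizes, because `Q` and the initial second moments are positive
definite. -/
theorem stabilizes_of_cost_lt_top (hW : IsBrownianWrt P 𝓕 W) (hQ : S.Q.PosDef) (hR : S.R.PosDef)
    (hξ : IsInitialState P 𝓕 ξ) (hSig : (secondMoment P ξ).PosDef)
    (h : cost P 𝓕 W S ξ K < ∞) : Stabilizes S K := by
  rw [cost_eq hW hQ hR hξ] at h
  exact isStable_of_tendsto_trace hW fun v =>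
    (tendsto_trace_exp_of_lintegral_lt_top (posDef_weight hQ hR K) hSig h v).comp
      (NNReal.tendsto_coe_atTop.2 tendsto_id)

theorem J_eq (hW : IsBrownianWrt P 𝓕 W) (hQ : S.Q.PosDef) (hR : S.R.PosDef)
    (hξ : IsInitialState P 𝓕 ξ) (hSig : (secondMoment P ξ).PosDef) (h : Stabilizes S K) :
    J P 𝓕 W S ξ K = lqCost S (secondMoment P ξ) K := by
  rw [J, cost_eq_ofReal hW hQ hR hξ hSig h,
    ENNReal.toReal_ofReal (h.lqCost_nonneg hQ hR hSig.posSemidef)]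

theorem J_eventuallyEq (hW : IsBrownianWrt P 𝓕 W) (hQ : S.Q.PosDef) (hR : S.R.PosDef)
    (hξ : IsInitialState P 𝓕 ξ) (hSig : (secondMoment P ξ).PosDef) (h : Stabilizes S K) :
    J P 𝓕 W S ξ =ᶠ[𝓝 K] lqCost S (secondMoment P ξ) := by
  filter_upwards [(isOpen_stabilizes S).mem_nhds h] with K' hK'
  exact J_eq hW hQ hR hξ hSig hK'

/-- Infinite costs play no role in the sublevel set, which lies inside the set of stabilizers. -/
theorem mem_sublevel (hW : IsBrownianWrt P 𝓕 W) (hQ : S.Q.PosDef) (hR : S.R.PosDef)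
    (hξ : IsInitialState P 𝓕 ξ) (hSig : (secondMoment P ξ).PosDef) (h₀ : Stabilizes S K₀) :
    K ∈ sublevel P 𝓕 W S ξ K₀ ↔ Stabilizes S K ∧
      lqCost S (secondMoment P ξ) K ≤ lqCost S (secondMoment P ξ) K₀ := by
  have h0 := cost_eq_ofReal hW hQ hR hξ hSig h₀
  constructor
  · intro h
    have hK : Stabilizes S K := stabilizes_of_cost_lt_top hW hQ hR hξ hSig
      (lt_of_le_of_lt h (by rw [h0]; exact ENNReal.ofReal_lt_top))
    refine ⟨hK, ?_⟩
    have h' : cost P 𝓕 W S ξ K ≤ cost P 𝓕 W S ξ K₀ := h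
    rw [cost_eq_ofReal hW hQ hR hξ hSig hK, h0] at h'
    exact (ENNReal.ofReal_le_ofReal_iff (h₀.lqCost_nonneg hQ hR hSig.posSemidef)).1 h'
  · rintro ⟨hK, h⟩
    change cost P 𝓕 W S ξ K ≤ cost P 𝓕 W S ξ K₀
    rw [cost_eq_ofReal hW hQ hR hξ hSig hK, h0]
    exact ENNReal.ofReal_le_ofReal h

/-- Sublevel sets are closed because the cost is lower semicontinuous, by Fatou's lemma. -/
theorem isClosed_sublevel (hW : IsBrownianWrt P 𝓕 W) (hQ : S.Q.PosDef) (hR : S.R.PosDef)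
    (hξ : IsInitialState P 𝓕 ξ) (K₀ : Matrix (Fin m) (Fin n) ℝ) :
    IsClosed (sublevel P 𝓕 W S ξ K₀) := by
  refine IsSeqClosed.isClosed fun Kseq K hmem hlim => ?_
  set F : Matrix (Fin m) (Fin n) ℝ → ℝ → ℝ≥0∞ := fun K t => ENNReal.ofReal (weight S K *
      NormedSpace.exp (t • lyap (drift S K) (diffusion S K)) (secondMoment P ξ)).trace with hF
  have hmeas : ∀ K, Measurable (F K) := fun K => by
    have hc : Continuous fun t : ℝ =>
        NormedSpace.exp (t • lyap (drift S K) (diffusion S K)) (secondMoment P ξ) :=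
      continuous_iff_continuousAt.2 fun t => (hasDerivAt_exp_lyap _ _ _ t).continuousAt
    exact (ENNReal.continuous_ofReal.comp ((continuous_trace_mul (weight S K)).comp hc)).measurable
  change cost P 𝓕 W S ξ K ≤ cost P 𝓕 W S ξ K₀
  calc cost P 𝓕 W S ξ K = ∫⁻ t in Set.Ioi (0 : ℝ), liminf (fun k => F (Kseq k) t) atTop := by
        rw [cost_eq hW hQ hR hξ]
        refine lintegral_congr fun t => ?_
        have h1 : Tendsto (fun k => F (Kseq k) t) atTop (𝓝 (F K t)) :=
          ((ENNReal.continuous_ofReal.comp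
            (continuous_trace_weight_exp S (secondMoment P ξ) t)).tendsto K).comp hlim
        exact h1.liminf_eq.symm
    _ ≤ liminf (fun k => ∫⁻ t in Set.Ioi (0 : ℝ), F (Kseq k) t) atTop :=
        lintegral_liminf_le fun k => hmeas _
    _ ≤ cost P 𝓕 W S ξ K₀ := by
        refine liminf_le_of_le (by isBoundedDefault) fun b hb => ?_
        obtain ⟨k, hk⟩ := hb.exists
        refine hk.trans ?_
        rw [hF, ← cost_eq hW hQ hR hξ]
        exact hmem k

theorem isCompact_sublevel (hW : IsBrownianWrt P 𝓕 W) (hQ : S.Q.PosDef) (hR : S.R.PosDef)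
    (hξ : IsInitialState P 𝓕 ξ) (hSig : (secondMoment P ξ).PosDef) (h₀ : Stabilizes S K₀) :
    IsCompact (sublevel P 𝓕 W S ξ K₀) := by
  have : ProperSpace (Matrix (Fin m) (Fin n) ℝ) := FiniteDimensional.proper_real _
  refine Metric.isCompact_of_isClosed_isBounded (isClosed_sublevel hW hQ hR hξ K₀) ?_
  obtain ⟨r, σ, τ, κ, -, -, -, -, hb⟩ := exists_sublevel_bounds hQ hR hSig
    (lqCost S (secondMoment P ξ) K₀) (h₀.lqCost_nonneg hQ hR hSig.posSemidef)
  refine isBounded_iff_forall_norm_le.2 ⟨κ, fun K hK => ?_⟩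
  have := (mem_sublevel hW hQ hR hξ hSig h₀).1 hK
  exact (hb K this.1 this.2).2.2

/-- The gradient of the cost is `2 E_K Σ_K`. -/
theorem gradJ_eq (hW : IsBrownianWrt P 𝓕 W) (hQ : S.Q.PosDef) (hR : S.R.PosDef)
    (hξ : IsInitialState P 𝓕 ξ) (hSig : (secondMoment P ξ).PosDef) (h : Stabilizes S K) :
    gradJ P 𝓕 W S ξ K = (2 : ℝ) • (gainResidual S K * stateCov S (secondMoment P ξ) K) := by
  have hX := transpose_eq_of_posSemidef (h.posSemidef_stateCov hSig.posSemidef)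
  ext i j
  rw [gradJ, Matrix.of_apply]
  have e := (J_eventuallyEq hW hQ hR hξ hSig h).fderiv_eq (𝕜 := ℝ)
  have e2 : fderiv ℝ (J P 𝓕 W S ξ) K (Matrix.single i j 1) =
      fderiv ℝ (lqCost S (secondMoment P ξ)) K (Matrix.single i j 1) := by rw [e]
  refine e2.trans ?_
  rw [h.fderiv_lqCost hQ hR, trace_firstForm_mul _ hX, trace_single_transpose_mul]
  simp

theorem fderiv_lqCost_eq (hW : IsBrownianWrt P 𝓕 W) (hQ : S.Q.PosDef) (hR : S.R.PosDef)
    (hξ : IsInitialState P 𝓕 ξ) (hSig : (secondMoment P ξ).PosDef) (h : Stabilizes S K)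
    (D : Matrix (Fin m) (Fin n) ℝ) :
    fderiv ℝ (lqCost S (secondMoment P ξ)) K D = (Dᵀ * gradJ P 𝓕 W S ξ K).trace := by
  have hX := transpose_eq_of_posSemidef (h.posSemidef_stateCov hSig.posSemidef)
  rw [h.fderiv_lqCost hQ hR, trace_firstForm_mul _ hX, gradJ_eq hW hQ hR hξ hSig h,
    Matrix.mul_smul, Matrix.trace_smul, smul_eq_mul]

theorem hessJ_eq (hW : IsBrownianWrt P 𝓕 W) (hQ : S.Q.PosDef) (hR : S.R.PosDef)
    (hξ : IsInitialState P 𝓕 ξ) (hSig : (secondMoment P ξ).PosDef) (h : Stabilizes S K)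
    (D : Matrix (Fin m) (Fin n) ℝ) : hessJ P 𝓕 W S ξ K D =
      iteratedDeriv 2 (fun t : ℝ => lqCost S (secondMoment P ξ) (K + t • D)) 0 := by
  refine Filter.EventuallyEq.iteratedDeriv_eq 2 ?_
  filter_upwards [h.eventually_add_smul D] with t ht
  exact J_eq hW hQ hR hξ hSig ht

/-! ### The explicit smoothness constant -/

/-- The bound of the Hessian with spectral data inserted. With `p = J(K₀) / λ₁(Σ₀)` as bound of `P_K`
and `tr Σ_K ≤ J(K₀) / λ₁(Q)` on the sublevel set, the resulting constant is at most the explicit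
one, which has Frobenius norms of `C` and `D` and a factor `√n` in addition. -/
theorem isSmoothnessConstant_explicitL (hW : IsBrownianWrt P 𝓕 W) (hQ : S.Q.PosDef)
    (hR : S.R.PosDef) (hξ : IsInitialState P 𝓕 ξ) (hSig : (secondMoment P ξ).PosDef)
    (h₀ : Stabilizes S K₀) (hB : S.B ≠ 0) :
    IsSmoothnessConstant P 𝓕 W S ξ K₀
      (explicitL S (secondMoment P ξ) (J P 𝓕 W S ξ K₀)) := by
  have hn : NeZero n := ⟨by rintro rfl; exact hB (by ext i; exact i.elim0)⟩
  have hm : NeZero m := ⟨by rintro rfl; exact hB (by ext i j; exact j.elim0)⟩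
  rw [J_eq hW hQ hR hξ hSig h₀]
  set Sig := secondMoment P ξ with hSigdef
  set j := lqCost S Sig K₀ with hj
  have hq := minEig_pos hQ
  have hr := minEig_pos hR
  have hc := minEig_pos hSig
  have hρ : 0 < maxEig S.R := hr.trans_le (minEig_le_maxEig hR.1)
  have hb := specNorm_pos hB
  -- the cost is positive because `Σ_K ≠ 0`
  have hjpos : 0 < j := by
    have h1 := h₀.mul_trace_stateCov_le hR hSig.posSemidef (minEig_mul_le hQ.1)
    have hX := h₀.posSemidef_stateCov hSig.posSemidef
    have h2 : 0 < (stateCov S Sig K₀).trace := by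
      refine lt_of_le_of_ne hX.trace_nonneg fun h0 => ?_
      have h3 := h₀.lyap_stateCov Sig
      rw [hX.trace_eq_zero_iff.1 h0.symm, map_zero] at h3
      have h4 := mul_trace_le (Z := Sig) (Matrix.PosSemidef.one (n := Fin n)) (minEig_mul_le hSig.1)
      have h5 : Sig = 0 := by simpa using h3.symm
      rw [h5] at h4
      simp at h4
      have hn0 : (0 : ℝ) < n := by exact_mod_cast Nat.pos_of_ne_zero hn.out
      have : 0 < minEig (0 : Matrix (Fin n) (Fin n) ℝ) * n := by
        rw [← h5]
        positivity
      linarith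
    exact (mul_pos hq h2).trans_le h1
  set p := j / minEig Sig with hp
  have hp0 : 0 < p := by positivity
  set b := specNorm S.B with hbdef
  set c := specNorm S.C with hcdef
  set d := specNorm S.D with hddef
  have hd0 : 0 ≤ d := specNorm_nonneg _
  have hc0 : 0 ≤ c := specNorm_nonneg _
  set κ := gainBound S Sig j with hκ
  have hκeq : κ = 2 * b * p / minEig S.R + specNorm S.A / b := by
    rw [hκ, gainBound, hp, ← hbdef]
    congr 1
    field_simp
  have hκ0 : 0 ≤ κ := by
    rw [hκeq]
    have := specNorm_nonneg S.A
    positivity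
  set u := b + d * (c + d * κ) with hu
  have hu0 : 0 ≤ u := by positivity
  set a := u * p / minEig S.Q with ha
  have ha0 : 0 ≤ a := by positivity
  set θ := a + √(a ^ 2 + maxEig S.R / minEig S.Q) with hθ
  have hrad : 0 < a ^ 2 + maxEig S.R / minEig S.Q := by positivity
  have hsqrt := Real.sqrt_pos.2 hrad
  have hθ0 : 0 < θ := by positivity
  have hroot : θ ^ 2 * minEig S.Q = 2 * a * minEig S.Q * θ + maxEig S.R := by
    have h1 : θ ^ 2 = 2 * a * θ + maxEig S.R / minEig S.Q := by
      have := Real.sq_sqrt hrad.le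
      rw [hθ]
      linear_combination this
    rw [h1, add_mul, div_mul_cancel₀ _ hq.ne']
    ring
  -- comparison with the constants of the statement
  have hmu : u ≤ muTilde S Sig j := by
    rw [hu, muTilde, ← hκ, ← hbdef, ← hddef]
    have := mul_le_mul_of_nonneg_left (specNorm_le_norm S.C) hd0
    linarith
  have hξ1 : p * θ ≤ xiConst S Sig j := by
    have hsq : 1 ≤ √(n : ℝ) := Real.one_le_sqrt.2 (by
      exact_mod_cast Nat.pos_of_ne_zero hn.out)
    have haa : a ≤ muTilde S Sig j * j / (minEig Sig * minEig S.Q) := by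
      have : a ≤ muTilde S Sig j * p / minEig S.Q := by rw [ha]; gcongr
      refine this.trans (le_of_eq ?_)
      rw [hp]
      field_simp
    rw [xiConst]
    calc p * θ ≤ (√(n : ℝ) * p) * θ := by
          refine mul_le_mul_of_nonneg_right ?_ hθ0.le
          exact le_mul_of_one_le_left hp0.le hsq
      _ ≤ _ := by
          rw [hp, mul_div_assoc, hθ]
          gcongr
  have hcoef : u ≤ b + c * d + ‖S.D‖ ^ 2 * κ := by
    have h1 := pow_le_pow_left₀ hd0 (specNorm_le_norm S.D) 2
    have h2 := mul_le_mul_of_nonneg_right h1 hκ0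
    rw [hu]
    linarith
  have hp' : 0 ≤ p * θ := by positivity
  constructor
  · rw [explicitL]
    have h1 : 0 ≤ xiConst S Sig j := hp'.trans hξ1
    have h2 : 0 ≤ b + c * d + ‖S.D‖ ^ 2 * κ := hu0.trans hcoef
    positivity
  · intro K hK E
    obtain ⟨hKs, hKj⟩ := (mem_sublevel hW hQ hR hξ hSig h₀).1 hK
    rw [hessJ_eq hW hQ hR hξ hSig hKs]
    have hP := hKs.posSemidef_valueMat hQ hR
    have hPp : (valueMat S K).trace ≤ p := by
      rw [hp, le_div_iff₀ hc, mul_comm]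
      exact (hKs.mul_trace_valueMat_le hQ hR (minEig_mul_le hSig.1)).trans hKj
    have hPv : ∀ x, vnorm (valueMat S K *ᵥ x) ≤ p * vnorm x := fun x =>
      (vnorm_mulVec_le_norm _ _).trans (mul_le_mul_of_nonneg_right
        ((norm_le_trace hP).trans hPp) (vnorm_nonneg _))
    have hGB : GainBounds S K (minEig S.Q) (maxEig S.R) p b c d κ :=
      ⟨hq, hρ, hp0.le, hb.le, hc0, hd0, hκ0, minEig_mul_le hQ.1, le_maxEig_mul hR.1, hPv,
        vnorm_mulVec_le_specNorm _, vnorm_mulVec_le_specNorm _, vnorm_mulVec_le_specNorm _, by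
          rw [hκeq]
          exact hKs.vnorm_gain_le hQ hR hr hb (specNorm_nonneg _) hp0.le (minEig_mul_le hR.1) hPv
            (vnorm_mulVec_le_specNorm _) (vnorm_mulVec_le_specNorm _)⟩
    have hτ : (stateCov S Sig K).trace ≤ j / minEig S.Q := by
      rw [le_div_iff₀ hq, mul_comm]
      exact (hKs.mul_trace_stateCov_le hR hSig.posSemidef (minEig_mul_le hQ.1)).trans hKj
    refine (hGB.abs_iteratedDeriv_le hKs hQ hR hSig.posSemidef hθ0
      (div_mul_cancel₀ _ hq.ne') hroot hτ E).trans ?_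
    refine mul_le_mul_of_nonneg_right ?_ (sq_nonneg _)
    rw [explicitL, ← hκ, ← hbdef, ← hcdef, ← hddef, mul_div_assoc]
    refine mul_le_mul_of_nonneg_left ?_ (by positivity)
    have h1 : p * d ^ 2 = j * d ^ 2 / minEig Sig := by rw [hp]; ring
    have h2 := mul_le_mul hcoef hξ1 hp' (hu0.trans hcoef)
    rw [h1]
    linarith

/-! ### The minimizer -/

theorem exists_isOptimal (hW : IsBrownianWrt P 𝓕 W) (hQ : S.Q.PosDef)
    (hR : S.R.PosDef) (hξ : IsInitialState P 𝓕 ξ) (hSig : (secondMoment P ξ).PosDef)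
    (h₀ : Stabilizes S K₀) : ∃ Kstar, IsOptimal P 𝓕 W S ξ Kstar := by
  have hcont : ContinuousOn (lqCost S (secondMoment P ξ)) (sublevel P 𝓕 W S ξ K₀) := fun K hK =>
    (((mem_sublevel hW hQ hR hξ hSig h₀).1 hK).1.contDiffAt_lqCost
      (N := 0)).continuousAt.continuousWithinAt
  obtain ⟨Ks, hKs, hmin⟩ := (isCompact_sublevel hW hQ hR hξ hSig h₀).exists_isMinOn
    ⟨K₀, le_refl (cost P 𝓕 W S ξ K₀)⟩ hcont
  have hs := (mem_sublevel hW hQ hR hξ hSig h₀).1 hKs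
  refine ⟨Ks, (mem_stabilizers hW).2 hs.1, fun K' hK' => ?_⟩
  have hst := (mem_stabilizers hW).1 hK'
  by_cases h : K' ∈ sublevel P 𝓕 W S ξ K₀
  · rw [cost_eq_ofReal hW hQ hR hξ hSig hs.1, cost_eq_ofReal hW hQ hR hξ hSig hst]
    exact ENNReal.ofReal_le_ofReal (hmin h)
  · exact le_trans hKs (le_of_not_ge h)

theorem IsOptimal.stabilizes (hW : IsBrownianWrt P 𝓕 W) (h : IsOptimal P 𝓕 W S ξ K) :
    Stabilizes S K := (mem_stabilizers hW).1 h.1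

theorem IsOptimal.lqCost_le (hW : IsBrownianWrt P 𝓕 W) (hQ : S.Q.PosDef)
    (hR : S.R.PosDef) (hξ : IsInitialState P 𝓕 ξ) (hSig : (secondMoment P ξ).PosDef)
    (h : IsOptimal P 𝓕 W S ξ K) {K' : Matrix (Fin m) (Fin n) ℝ} (h' : Stabilizes S K') :
    lqCost S (secondMoment P ξ) K ≤ lqCost S (secondMoment P ξ) K' := by
  have := h.2 K' ((mem_stabilizers hW).2 h')
  rw [cost_eq_ofReal hW hQ hR hξ hSig (h.stabilizes hW), cost_eq_ofReal hW hQ hR hξ hSig h'] at this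
  exact (ENNReal.ofReal_le_ofReal_iff (h'.lqCost_nonneg hQ hR hSig.posSemidef)).1 this

/-- The residual of a minimizer vanishes: the gradient `2 E_K Σ_K` does, and `Σ_K` is positive
definite. -/
theorem IsOptimal.gainResidual_eq_zero (hW : IsBrownianWrt P 𝓕 W) (hQ : S.Q.PosDef)
    (hR : S.R.PosDef) (hξ : IsInitialState P 𝓕 ξ) (hSig : (secondMoment P ξ).PosDef)
    (h : IsOptimal P 𝓕 W S ξ K) : gainResidual S K = 0 := by
  have hs := h.stabilizes hW
  have hmin : IsLocalMin (lqCost S (secondMoment P ξ)) K := by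
    filter_upwards [(isOpen_stabilizes S).mem_nhds hs] with K' hK'
    exact h.lqCost_le hW hQ hR hξ hSig hK'
  have hgrad : gradJ P 𝓕 W S ξ K = 0 := by
    have h1 := fderiv_lqCost_eq hW hQ hR hξ hSig hs (gradJ P 𝓕 W S ξ K)
    rw [hmin.fderiv_eq_zero, trace_transpose_mul_self] at h1
    simpa using h1.symm
  obtain ⟨r, σ, τ, κ, -, hσ, -, -, hb⟩ := exists_sublevel_bounds hQ hR hSig
    (lqCost S (secondMoment P ξ) K) (hs.lqCost_nonneg hQ hR hSig.posSemidef)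
  have h2 := mul_norm_le_norm_mul (transpose_eq_of_posSemidef
    (hs.posSemidef_stateCov hSig.posSemidef)) hσ.le (hb K hs le_rfl).1 (gainResidual S K)
  have h3 : gainResidual S K * stateCov S (secondMoment P ξ) K = 0 := by
    have := gradJ_eq hW hQ hR hξ hSig hs
    rw [hgrad] at this
    simpa using this.symm
  rw [h3, norm_zero] at h2
  exact norm_eq_zero.1 (le_antisymm (nonpos_of_mul_nonpos_right h2 hσ) (norm_nonneg _))

theorem IsOptimal.eq (hW : IsBrownianWrt P 𝓕 W) (hQ : S.Q.PosDef)
    (hR : S.R.PosDef) (hξ : IsInitialState P 𝓕 ξ) (hSig : (secondMoment P ξ).PosDef)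
    {K' : Matrix (Fin m) (Fin n) ℝ} (h : IsOptimal P 𝓕 W S ξ K) (h' : IsOptimal P 𝓕 W S ξ K') :
    K = K' := by
  have hs := h.stabilizes hW
  obtain ⟨r, σ, τ, κ, hr, hσ, -, hrR, hb⟩ := exists_sublevel_bounds hQ hR hSig
    (lqCost S (secondMoment P ξ) K) (hs.lqCost_nonneg hQ hR hSig.posSemidef)
  have h1 := mul_norm_sq_le_lqCost_sub hQ hR hs (h'.stabilizes hW)
    (h'.gainResidual_eq_zero hW hQ hR hξ hSig) hσ hrR (hb K hs le_rfl).1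
  have h2 := h.lqCost_le hW hQ hR hξ hSig (h'.stabilizes hW)
  have h3 : σ * (r * ‖K - K'‖ ^ 2) ≤ 0 := by linarith
  rw [← mul_assoc] at h3
  have h4 := nonpos_of_mul_nonpos_right h3 (mul_pos hσ hr)
  have h5 : ‖K - K'‖ = 0 := by nlinarith [norm_nonneg (K - K')]
  exact sub_eq_zero.1 (norm_eq_zero.1 h5)

/-! ### Gradient descent -/

/-- One gradient step with step size at most `2 / L` stays in the sublevel set and decreases the
cost. The descent inequality on a segment inside the sublevel set keeps the endpoint strictly below
the initial level, so that the segment can be continued up to length `2 / L`. -/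
theorem gradient_step (hW : IsBrownianWrt P 𝓕 W) (hQ : S.Q.PosDef)
    (hR : S.R.PosDef) (hξ : IsInitialState P 𝓕 ξ) (hSig : (secondMoment P ξ).PosDef)
    (h₀ : Stabilizes S K₀) {L : ℝ} (hL : IsSmoothnessConstant P 𝓕 W S ξ K₀ L)
    (hK : K ∈ sublevel P 𝓕 W S ξ K₀) {α : ℝ} (hα : 0 < α) (hαL : α ≤ 2 / L) :
    K - α • gradJ P 𝓕 W S ξ K ∈ sublevel P 𝓕 W S ξ K₀ ∧
      lqCost S (secondMoment P ξ) (K - α • gradJ P 𝓕 W S ξ K) ≤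
        lqCost S (secondMoment P ξ) K - α * (1 - L * α / 2) * ‖gradJ P 𝓕 W S ξ K‖ ^ 2 := by
  set G := gradJ P 𝓕 W S ξ K with hG
  set f := lqCost S (secondMoment P ξ) with hf
  have hiff := fun K' => mem_sublevel (K := K') hW hQ hR hξ hSig h₀
  have hKs := (hiff K).1 hK
  have esub : ∀ t : ℝ, K - t • G = K + t • -G := fun t => by rw [smul_neg, sub_eq_add_neg]
  have hgrad : fderiv ℝ f K (-G) = -‖G‖ ^ 2 := by
    rw [fderiv_lqCost_eq hW hQ hR hξ hSig hKs.1, ← hG, Matrix.transpose_neg, Matrix.neg_mul,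
      Matrix.trace_neg, trace_transpose_mul_self]
  have hdesc : ∀ s, 0 ≤ s → (∀ t ∈ Set.Icc 0 s, K + t • -G ∈ sublevel P 𝓕 W S ξ K₀) →
      f (K + s • -G) ≤ f K - s * (1 - L * s / 2) * ‖G‖ ^ 2 := by
    intro s hs hseg
    refine descent_segment hs (fun t ht => ((hiff _).1 (hseg t ht)).1.contDiffAt_lqCost)
      (fun t ht => ?_) hgrad
    have h1 := hL.2 _ (hseg t ht) (-G)
    rw [hessJ_eq hW hQ hR hξ hSig ((hiff _).1 (hseg t ht)).1, norm_neg] at h1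
    exact (abs_le.1 h1).2
  have hαL' : L * α ≤ 2 := by
    rw [le_div_iff₀ hL.1] at hαL
    linarith
  rcases eq_or_ne G 0 with hG0 | hG0
  · have e : K - α • G = K := by simp [hG0]
    rw [e]
    refine ⟨hK, ?_⟩
    simp [hG0]
  have hGpos : 0 < ‖G‖ ^ 2 := by positivity
  set A : Set ℝ := {s | ∀ t ∈ Set.Icc 0 s, K + t • -G ∈ sublevel P 𝓕 W S ξ K₀} with hA
  have hline : Continuous fun t : ℝ => K + t • -G := by fun_prop
  have hclosed : IsClosed (A ∩ Set.Icc 0 α) := by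
    refine IsClosed.inter (IsSeqClosed.isClosed fun u s hu hlim => ?_) isClosed_Icc
    intro t ht
    rcases ht.2.eq_or_lt with rfl | hlt
    · by_cases hev : ∃ k, t ≤ u k
      · obtain ⟨k, hk⟩ := hev
        exact hu k t ⟨ht.1, hk⟩
      · push Not at hev
        rcases ht.1.eq_or_lt with h0 | h0
        · rw [← h0]
          simpa using hK
        · refine (isClosed_sublevel hW hQ hR hξ K₀).mem_of_tendsto
            ((hline.tendsto t).comp hlim) ?_
          filter_upwards [hlim.eventually (lt_mem_nhds h0)] with k hk
          exact hu k (u k) ⟨hk.le, le_rfl⟩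
    · obtain ⟨k, hk⟩ := (hlim.eventually (lt_mem_nhds hlt)).exists
      exact hu k t ⟨ht.1, hk.le⟩
  have h0A : (0 : ℝ) ∈ A := by
    intro t ht
    have : t = 0 := le_antisymm ht.2 ht.1
    rw [this]
    simpa using hK
  have hsub : Set.Icc 0 α ⊆ A := by
    refine hclosed.Icc_subset_of_forall_exists_gt h0A fun x hx y hy => ?_
    obtain ⟨hxA, hx0, hxα⟩ := hx
    have hxs := (hiff _).1 (hxA x ⟨hx0, le_rfl⟩)
    -- to the right of `x` the cost stays below its level at `K`
    have hev : ∀ᶠ t in 𝓝[>] x, K + t • -G ∈ sublevel P 𝓕 W S ξ K₀ := by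
      have hst : ∀ᶠ t in 𝓝[>] x, Stabilizes S (K + t • -G) :=
        ((hline.tendsto x).eventually ((isOpen_stabilizes S).mem_nhds hxs.1)).filter_mono
          nhdsWithin_le_nhds
      have hlt : ∀ᶠ t in 𝓝[>] x, f (K + t • -G) < f K := by
        rcases hx0.eq_or_lt with h0 | h0
        · subst h0
          have hd : HasDerivAt (fun t : ℝ => f (K + t • -G)) (-‖G‖ ^ 2) 0 := by
            have h1 := ((hKs.1.contDiffAt_lqCost (Sig := secondMoment P ξ)
              (N := 1)).differentiableAt (by simp)).hasFDerivAt
            have h2 : HasDerivAt (fun t : ℝ => K + t • -G) (-G) 0 := by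
              have := ((hasDerivAt_id (0 : ℝ)).smul_const (-G)).const_add K
              exact this.congr_deriv (by simp)
            rw [← hgrad]
            exact h1.comp_hasDerivAt_of_eq (0 : ℝ) h2 (by simp)
          have h3 := (hasDerivAt_iff_tendsto_slope.1 hd).mono_left
            (nhdsWithin_mono (0 : ℝ) fun t (ht : t ∈ Set.Ioi (0 : ℝ)) => (ne_of_gt ht : t ≠ 0))
          filter_upwards [h3.eventually (gt_mem_nhds (neg_lt_zero.2 hGpos)),
            self_mem_nhdsWithin] with t ht ht0
          rw [slope_def_field, zero_smul, add_zero, sub_zero] at ht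
          have := (div_neg_iff.1 ht).resolve_left fun h => absurd h.2 (not_lt.2 (le_of_lt ht0))
          linarith [this.1]
        · have h1 := hdesc x hx0 hxA
          have h2 : f (K + x • -G) < f K := by
            have : 0 < x * (1 - L * x / 2) * ‖G‖ ^ 2 := by
              have : L * x < L * α := mul_lt_mul_of_pos_left hxα hL.1
              have h3 : 0 < 1 - L * x / 2 := by linarith
              positivity
            linarith
          have hc : ContinuousAt (fun t : ℝ => f (K + t • -G)) x :=
            ContinuousAt.comp (f := fun t : ℝ => K + t • -G)
              (hxs.1.contDiffAt_lqCost (N := 0)).continuousAt hline.continuousAt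
          exact (hc.eventually (gt_mem_nhds h2)).filter_mono nhdsWithin_le_nhds
      filter_upwards [hst, hlt] with t h1 h2
      exact (hiff _).2 ⟨h1, h2.le.trans hKs.2⟩
    obtain ⟨z, hz, hzs⟩ := (mem_nhdsGT_iff_exists_Ioo_subset' hy).1 hev
    refine ⟨min y ((x + z) / 2), fun t ht => ?_, ?_, min_le_left _ _⟩
    · rcases le_or_gt t x with htx | htx
      · exact hxA t ⟨ht.1, htx⟩
      · refine hzs ⟨htx, ?_⟩
        have h1 := ht.2.trans (min_le_right _ _)
        have h2 : x < z := hz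
        linarith
    · refine lt_min hy ?_
      have h2 : x < z := hz
      linarith
  have hseg := hsub ⟨hα.le, le_rfl⟩
  rw [esub]
  exact ⟨hseg α ⟨hα.le, le_rfl⟩, hdesc α hα.le hseg⟩

end Problem

/-! ### Convergence of gradient descent -/

/-- Linear decay from a sufficient decrease condition and a gradient domination inequality. -/
theorem le_pow_mul_of_decrease {a g : ℕ → ℝ} {c C : ℝ} (hc : 0 < c) (hC : 0 < C)
    (ha : ∀ k, 0 ≤ a k) (hdec : ∀ k, a (k + 1) ≤ a k - c * g k) (hdom : ∀ k, a k ≤ C * g k)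
    (k : ℕ) : a k ≤ max 0 (1 - c / C) ^ k * a 0 := by
  induction k with
  | zero => simp
  | succ k ih =>
    have h1 : c / C * a k ≤ c * g k := by
      calc c / C * a k ≤ c / C * (C * g k) := by gcongr; exact hdom k
        _ = c * g k := by field_simp
    calc a (k + 1) ≤ (1 - c / C) * a k := by linarith [hdec k]
      _ ≤ max 0 (1 - c / C) * a k := mul_le_mul_of_nonneg_right (le_max_right _ _) (ha k)
      _ ≤ max 0 (1 - c / C) * (max 0 (1 - c / C) ^ k * a 0) := by gcongr
      _ = _ := by rw [pow_succ']; ring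

theorem inf'_le_div_of_decrease {a g : ℕ → ℝ} {c : ℝ} (hc : 0 < c) (ha : ∀ k, 0 ≤ a k)
    (hdec : ∀ k, a (k + 1) ≤ a k - c * g k) (k : ℕ) :
    (Finset.range (k + 1)).inf' Finset.nonempty_range_add_one g ≤ a 0 / (c * (k + 1)) := by
  have hsum : ∀ N, c * ∑ i ∈ Finset.range N, g i ≤ a 0 - a N := by
    intro N
    induction N with
    | zero => simp
    | succ N ih => rw [Finset.sum_range_succ, mul_add]; linarith [hdec N]
  set v := (Finset.range (k + 1)).inf' Finset.nonempty_range_add_one g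
  have hv : ((k + 1 : ℕ) : ℝ) * v ≤ ∑ i ∈ Finset.range (k + 1), g i := by
    have := Finset.card_nsmul_le_sum (Finset.range (k + 1)) g v fun i hi => Finset.inf'_le _ hi
    simpa using this
  rw [le_div_iff₀ (by positivity)]
  have h1 := mul_le_mul_of_nonneg_left hv hc.le
  push_cast at h1
  linarith [hsum (k + 1), ha (k + 1)]

section Descent

attribute [local instance] frobTop

variable {Ω : Type*} {mΩ : MeasurableSpace Ω} {P : Measure Ω} [IsProbabilityMeasure P]
  {𝓕 : Filtration ℝ≥0 mΩ} {W : ℝ≥0 → Ω → ℝ} {n m : ℕ} {S : LQData n m} {ξ : Ω → Fin n → ℝ}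
  {K₀ : Matrix (Fin m) (Fin n) ℝ}

theorem IsGradientDescent.mem_sublevel (hW : IsBrownianWrt P 𝓕 W) (hQ : S.Q.PosDef)
    (hR : S.R.PosDef) (hξ : IsInitialState P 𝓕 ξ) (hSig : (secondMoment P ξ).PosDef)
    (h₀ : Stabilizes S K₀) {L : ℝ} (hL : IsSmoothnessConstant P 𝓕 W S ξ K₀ L) {α : ℕ → ℝ}
    {K : ℕ → Matrix (Fin m) (Fin n) ℝ} (hK : IsGradientDescent P 𝓕 W S ξ K₀ α K)
    (hα : ∀ k, 0 < α k ∧ α k ≤ 2 / L) (k : ℕ) : K k ∈ sublevel P 𝓕 W S ξ K₀ := by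
  induction k with
  | zero => rw [hK.1]; exact le_refl (cost P 𝓕 W S ξ K₀)
  | succ k ih =>
    rw [hK.2 k]
    exact (gradient_step hW hQ hR hξ hSig h₀ hL ih (hα k).1 (hα k).2).1

theorem IsGradientDescent.lqCost_succ_le (hW : IsBrownianWrt P 𝓕 W) (hQ : S.Q.PosDef)
    (hR : S.R.PosDef) (hξ : IsInitialState P 𝓕 ξ) (hSig : (secondMoment P ξ).PosDef)
    (h₀ : Stabilizes S K₀) {L : ℝ} (hL : IsSmoothnessConstant P 𝓕 W S ξ K₀ L) {α : ℕ → ℝ}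
    {K : ℕ → Matrix (Fin m) (Fin n) ℝ} (hK : IsGradientDescent P 𝓕 W S ξ K₀ α K)
    (hα : ∀ k, 0 < α k ∧ α k ≤ 2 / L) (k : ℕ) :
    lqCost S (secondMoment P ξ) (K (k + 1)) ≤ lqCost S (secondMoment P ξ) (K k) -
      α k * (1 - L * α k / 2) * ‖gradJ P 𝓕 W S ξ (K k)‖ ^ 2 := by
  rw [hK.2 k]
  exact (gradient_step hW hQ hR hξ hSig h₀ hL
    (hK.mem_sublevel hW hQ hR hξ hSig h₀ hL hα k) (hα k).1 (hα k).2).2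

/-- Linear convergence of gradient descent. With `a k = J(K_k) - J(K_*)` the step size condition
gives `a (k + 1) ≤ a k - C₀ ‖∇J(K_k)‖²`, while `a k ≤ C ‖∇J(K_k)‖²` by gradient domination, with
`C` depending only on the sublevel set; hence `q = max 0 (1 - C₀ / C)`. -/
theorem exists_linear_convergence (hW : IsBrownianWrt P 𝓕 W) (hQ : S.Q.PosDef)
    (hR : S.R.PosDef) (hξ : IsInitialState P 𝓕 ξ) (hSig : (secondMoment P ξ).PosDef)
    (h₀ : Stabilizes S K₀) {L : ℝ} (hL : IsSmoothnessConstant P 𝓕 W S ξ K₀ L)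
    {Kstar : Matrix (Fin m) (Fin n) ℝ} (hopt : IsOptimal P 𝓕 W S ξ Kstar) {ε₁ ε₂ : ℝ}
    (h₁ : 0 < ε₁) (h₂ : 0 < ε₂) : ∃ q c : ℝ, 0 ≤ q ∧ q < 1 ∧
      ∀ (α : ℕ → ℝ) (K : ℕ → Matrix (Fin m) (Fin n) ℝ),
        IsGradientDescent P 𝓕 W S ξ K₀ α K → (∀ k, ε₁ ≤ α k ∧ α k ≤ 2 / L - ε₂) →
        Tendsto (fun k => gradJ P 𝓕 W S ξ (K k)) atTop (𝓝 0) ∧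
        (∀ k : ℕ, (Finset.range (k + 1)).inf' Finset.nonempty_range_add_one
            (fun j => ‖gradJ P 𝓕 W S ξ (K j)‖ ^ 2) ≤
          J P 𝓕 W S ξ K₀ / ((ε₁ * ε₂ * L / 2) * (k + 1))) ∧
        (∀ k : ℕ, J P 𝓕 W S ξ (K k) - J P 𝓕 W S ξ Kstar ≤
          q ^ k * (J P 𝓕 W S ξ K₀ - J P 𝓕 W S ξ Kstar)) ∧
        (∀ k : ℕ, ‖K k - Kstar‖ ^ 2 ≤ c * q ^ k) := by
  set f := lqCost S (secondMoment P ξ) with hf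
  have hs := hopt.stabilizes hW
  have hle := fun {K'} => hopt.lqCost_le hW hQ hR hξ hSig (K' := K')
  obtain ⟨r, σ, τ, κ, hr, hσ, hτ, hrR, hb⟩ := exists_sublevel_bounds hQ hR hSig
    (f K₀) (h₀.lqCost_nonneg hQ hR hSig.posSemidef)
  set C := τ / (4 * r * σ ^ 2) with hCdef
  have hC : 0 < C := by positivity
  have hL0 := hL.1
  set c := ε₁ * ε₂ * L / 2 with hcdef
  have hc : 0 < c := by positivity
  have hq0 : 0 ≤ max 0 (1 - c / C) := le_max_left _ _
  have hq1 : max 0 (1 - c / C) < 1 := max_lt one_pos (sub_lt_self _ (by positivity))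
  set q := max 0 (1 - c / C) with hq
  refine ⟨q, (f K₀ - f Kstar) / (σ * r), hq0, hq1, fun α K hK hα => ?_⟩
  have hα' : ∀ k, 0 < α k ∧ α k ≤ 2 / L := fun k =>
    ⟨h₁.trans_le (hα k).1, (hα k).2.trans (sub_le_self _ h₂.le)⟩
  have hmem := fun k => (SLQ.mem_sublevel hW hQ hR hξ hSig h₀).1
    (hK.mem_sublevel hW hQ hR hξ hSig h₀ hL hα' k)
  set g : ℕ → ℝ := fun k => ‖gradJ P 𝓕 W S ξ (K k)‖ ^ 2 with hg
  have hg0 : ∀ k, 0 ≤ g k := fun k => sq_nonneg _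
  have hdec : ∀ k, f (K (k + 1)) ≤ f (K k) - c * g k := fun k => by
    have h3 := hK.lqCost_succ_le hW hQ hR hξ hSig h₀ hL hα' k
    have h4 : c ≤ α k * (1 - L * α k / 2) := by
      have h5 : L * α k ≤ 2 - L * ε₂ := by
        have := mul_le_mul_of_nonneg_left (hα k).2 hL0.le
        rwa [mul_sub, mul_div_cancel₀ _ hL0.ne'] at this
      calc c = ε₁ * (L * ε₂ / 2) := by rw [hcdef]; ring
        _ ≤ α k * (1 - L * α k / 2) :=
          mul_le_mul (hα k).1 (by linarith) (by positivity) (hα' k).1.le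
    have h6 := mul_le_mul_of_nonneg_right h4 (hg0 k)
    exact h3.trans (by linarith)
  have ha : ∀ k, 0 ≤ f (K k) - f Kstar := fun k => sub_nonneg.2 (hle (hmem k).1)
  have hdom : ∀ k, f (K k) - f Kstar ≤ C * g k := fun k => by
    rw [hg]
    simp only
    rw [gradJ_eq hW hQ hR hξ hSig (hmem k).1]
    exact lqCost_sub_le hQ hR hSig.posSemidef (hmem k).1 hs hr hσ hrR
      (hb _ (hmem k).1 (hmem k).2).1 (hb _ hs (hle h₀)).2.1
  have hdec' : ∀ k, f (K (k + 1)) - f Kstar ≤ f (K k) - f Kstar - c * g k := fun k => by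
    linarith [hdec k]
  have hlin := le_pow_mul_of_decrease (a := fun k => f (K k) - f Kstar) hc hC ha hdec' hdom
  simp only [← hq, hK.1] at hlin
  have hJ : ∀ {K'}, Stabilizes S K' → J P 𝓕 W S ξ K' = f K' := J_eq hW hQ hR hξ hSig
  refine ⟨?_, fun k => ?_, fun k => ?_, fun k => ?_⟩
  · have hpow : Tendsto (fun k => q ^ k * ((f K₀ - f Kstar) / c)) atTop (𝓝 0) := by
      simpa using (tendsto_pow_atTop_nhds_zero_of_lt_one hq0 hq1).mul_const _
    have hgt : Tendsto g atTop (𝓝 0) := by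
      refine squeeze_zero hg0 (fun k => ?_) hpow
      rw [← mul_div_assoc, le_div_iff₀ hc, mul_comm]
      linarith [hdec' k, ha (k + 1), hlin k]
    rw [tendsto_zero_iff_norm_tendsto_zero]
    have := (Real.continuous_sqrt.tendsto 0).comp hgt
    rw [Real.sqrt_zero] at this
    refine this.congr fun k => ?_
    simp only [Function.comp, hg]
    exact Real.sqrt_sq (norm_nonneg _)
  · have := inf'_le_div_of_decrease (a := fun k => f (K k)) hc
      (fun k => (hmem k).1.lqCost_nonneg hQ hR hSig.posSemidef) hdec k
    rwa [hK.1, ← hJ h₀] at this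
  · rw [hJ (hmem k).1, hJ h₀, hJ hs]
    exact hlin k
  · have h3 := mul_norm_sq_le_lqCost_sub hQ hR (hmem k).1 hs
      (hopt.gainResidual_eq_zero hW hQ hR hξ hSig) hσ hrR (hb _ (hmem k).1 (hmem k).2).1
    have h4 := hlin k
    rw [div_mul_eq_mul_div, le_div_iff₀ (by positivity)]
    calc ‖K k - Kstar‖ ^ 2 * (σ * r) = σ * (r * ‖K k - Kstar‖ ^ 2) := by ring
      _ ≤ q ^ k * (f K₀ - f Kstar) := h3.trans h4
      _ = (f K₀ - f Kstar) * q ^ k := mul_comm _ _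

theorem contDiffOn_J (hW : IsBrownianWrt P 𝓕 W) (hQ : S.Q.PosDef)
    (hR : S.R.PosDef) (hξ : IsInitialState P 𝓕 ξ) (hSig : (secondMoment P ξ).PosDef) :
    ContDiffOn ℝ 2 (J P 𝓕 W S ξ) (stabilizers P 𝓕 W S) := fun _ hK =>
  have h := (mem_stabilizers hW).1 hK
  ((h.contDiffAt_lqCost (N := 2)).congr_of_eventuallyEq
    (J_eventuallyEq hW hQ hR hξ hSig h)).contDiffWithinAt

theorem isOpen_stabilizers (hW : IsBrownianWrt P 𝓕 W) : IsOpen (stabilizers P 𝓕 W S) := by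
  have : stabilizers P 𝓕 W S = {K | Stabilizes S K} := Set.ext fun K => mem_stabilizers hW
  rw [this]
  exact isOpen_stabilizes S

end Descent

end SLQ

theorem theorem4p2 {Ω : Type*} {mΩ : MeasurableSpace Ω} (P : Measure Ω) [IsProbabilityMeasure P]
    (𝓕 : Filtration ℝ≥0 mΩ) (W : ℝ≥0 → Ω → ℝ) (hW : SLQ.IsBrownianWrt P 𝓕 W)
    {n m : ℕ} (S : SLQ.LQData n m) (hQ : S.Q.PosDef) (hR : S.R.PosDef)
    (ξ : Ω → Fin n → ℝ) (hξ : SLQ.IsInitialState P 𝓕 ξ) (hSig : (SLQ.secondMoment P ξ).PosDef)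
    (K₀ : Matrix (Fin m) (Fin n) ℝ) (hK₀ : K₀ ∈ SLQ.stabilizers P 𝓕 W S) :
    -- on the open set of stabilizers, the cost is finite and twice continuously differentiable
    (IsOpen (SLQ.stabilizers P 𝓕 W S) ∧
      (∀ K ∈ SLQ.stabilizers P 𝓕 W S, SLQ.cost P 𝓕 W S ξ K < ∞) ∧
      ContDiffOn ℝ 2 (SLQ.J P 𝓕 W S ξ) (SLQ.stabilizers P 𝓕 W S)) ∧
    -- the explicit smoothness constant
    (S.B ≠ 0 → SLQ.IsSmoothnessConstant P 𝓕 W S ξ K₀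
      (SLQ.explicitL S (SLQ.secondMoment P ξ) (SLQ.J P 𝓕 W S ξ K₀))) ∧
    ∃ Kstar : Matrix (Fin m) (Fin n) ℝ,
      (SLQ.IsOptimal P 𝓕 W S ξ Kstar ∧ ∀ K, SLQ.IsOptimal P 𝓕 W S ξ K → K = Kstar) ∧
      ∀ L : ℝ, SLQ.IsSmoothnessConstant P 𝓕 W S ξ K₀ L →
        -- descent
        (∀ (α : ℕ → ℝ) (K : ℕ → Matrix (Fin m) (Fin n) ℝ),
          SLQ.IsGradientDescent P 𝓕 W S ξ K₀ α K → (∀ k, 0 < α k ∧ α k ≤ 2 / L) →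
          ∀ k, K k ∈ SLQ.stabilizers P 𝓕 W S ∧ K k ∈ SLQ.sublevel P 𝓕 W S ξ K₀ ∧
            SLQ.J P 𝓕 W S ξ (K (k + 1)) ≤ SLQ.J P 𝓕 W S ξ (K k)
              - α k * (1 - L * α k / 2) * ‖SLQ.gradJ P 𝓕 W S ξ (K k)‖ ^ 2) ∧
        -- convergence, with `q` and `c` independent of the step sizes
        ∀ ε₁ ε₂ : ℝ, 0 < ε₁ → 0 < ε₂ → ∃ q c : ℝ, 0 ≤ q ∧ q < 1 ∧
          ∀ (α : ℕ → ℝ) (K : ℕ → Matrix (Fin m) (Fin n) ℝ),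
            SLQ.IsGradientDescent P 𝓕 W S ξ K₀ α K → (∀ k, ε₁ ≤ α k ∧ α k ≤ 2 / L - ε₂) →
            Tendsto (fun k => SLQ.gradJ P 𝓕 W S ξ (K k)) atTop (𝓝 0) ∧
            (∀ k : ℕ, (Finset.range (k + 1)).inf' Finset.nonempty_range_add_one
                (fun j => ‖SLQ.gradJ P 𝓕 W S ξ (K j)‖ ^ 2) ≤
              SLQ.J P 𝓕 W S ξ K₀ / ((ε₁ * ε₂ * L / 2) * (k + 1))) ∧
            (∀ k : ℕ, SLQ.J P 𝓕 W S ξ (K k) - SLQ.J P 𝓕 W S ξ Kstar ≤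
              q ^ k * (SLQ.J P 𝓕 W S ξ K₀ - SLQ.J P 𝓕 W S ξ Kstar)) ∧
            (∀ k : ℕ, ‖K k - Kstar‖ ^ 2 ≤ c * q ^ k) := by
  have h₀ := (SLQ.mem_stabilizers hW).1 hK₀
  refine ⟨⟨SLQ.isOpen_stabilizers hW, fun K hK => ?_, SLQ.contDiffOn_J hW hQ hR hξ hSig⟩,
    SLQ.isSmoothnessConstant_explicitL hW hQ hR hξ hSig h₀, ?_⟩
  · rw [SLQ.cost_eq_ofReal hW hQ hR hξ hSig ((SLQ.mem_stabilizers hW).1 hK)]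
    exact ENNReal.ofReal_lt_top
  obtain ⟨Kstar, hopt⟩ := SLQ.exists_isOptimal hW hQ hR hξ hSig h₀
  refine ⟨Kstar, ⟨hopt, fun K hK => hK.eq hW hQ hR hξ hSig hopt⟩, fun L hL =>
    ⟨fun α K hK hα k => ?_, fun ε₁ ε₂ h₁ h₂ =>
      SLQ.exists_linear_convergence hW hQ hR hξ hSig h₀ hL hopt h₁ h₂⟩⟩
  have hmem := hK.mem_sublevel hW hQ hR hξ hSig h₀ hL hα
  have hs := fun k => ((SLQ.mem_sublevel hW hQ hR hξ hSig h₀).1 (hmem k)).1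
  refine ⟨(SLQ.mem_stabilizers hW).2 (hs k), hmem k, ?_⟩
  rw [SLQ.J_eq hW hQ hR hξ hSig (hs k), SLQ.J_eq hW hQ hR hξ hSig (hs (k + 1))]
  exact hK.lqCost_succ_le hW hQ hR hξ hSig h₀ hL hα k
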